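/- **Setting.** Let $\mathbb C[u,u^{-1};\mathbf v]$ be the algebra of Laurent polynomials in $u$ with coefficients in $\mathbb C[\mathbf v]$, the polynomials in commuting variables $v_{\pm1},v_{\pm2},\dots$; put $v_0:=1$. Let $\mathcal R^+$ and $\mathcal R^-$ be the projections onto the powers $u^k$ with $k\ge 0$ and with $k\le -1$, respectively, and $\mathcal M_{u^k}$ multiplication by $u^k$. Define the operators (locally finite sums; $j,k$ range over integers) $$\mathcal N=\sum_{|k|\ge1}|k|v_k\tfrac{\partial}{\partial v_k}+u\tfrac{\partial}{\partial u}(\mathcal R^+-\mathcal R^-),$$ $$\mathcal Y_1=\sum_{k\ge1}v_ku\mathcal R^+\tfrac{\partial}{\partial u}\mathcal M_{u^{-k}}\mathcal R^+-\sum_{k\le-1}v_ku\mathcal R^-\tfrac{\partial}{\partial u}\mathcal M_{u^{-k}}\mathcal R^-,$$ $$\mathcal Y_2=\sum_{k\ge2}\Big(\sum_{j=1}^{k-1}jv_jv_{k-j}\Big)\tfrac{\partial}{\partial v_k}-\sum_{k\le-2}\Big(\sum_{j=k+1}^{-1}jv_jv_{k-j}\Big)\tfrac{\partial}{\partial v_k},$$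 $$\mathcal Z_1=\sum_{k\ge2}\Big(\sum_{j=1}^{k-1}(k-j)v_{k-2j}\Big)\tfrac{\partial}{\partial v_k}-\sum_{k\le-2}\Big(\sum_{j=k+1}^{-1}(k-j)v_{k-2j}\Big)\tfrac{\partial}{\partial v_k},$$ $$\mathcal Z_2=\sum_{k\ge1}u^{-k+1}\mathcal R^+\tfrac{\partial}{\partial u}\mathcal M_{u^{-k}}\mathcal R^+-\sum_{k\le-1}u^{-k+1}\mathcal R^-\tfrac{\partial}{\partial u}\mathcal M_{u^{-k}}\mathcal R^-,$$ $$\mathcal K_1=\mathcal K_1^+-\mathcal K_1^-,\qquad \mathcal K_1^{\pm}=\sum_{|k|\ge1}k\,u^{\mp k+1}\tfrac{\partial^2}{\partial v_k\partial u},$$ $$\mathcal K_2=\mathcal K_2^+-\mathcal K_2^-,\qquad \mathcal K_2^{\pm}=\sum_{|j|,|k|\ge1}jk\,v_{k\mp j}\tfrac{\partial^2}{\partial v_j\partial v_k},$$ $$\mathcal J=2\sum_{|k|\ge1}k\,u v_k\tfrac{\partial^2}{\partial u\partial v_k}+\sum_{|j|,|k|\ge1}jkv_jv_k\tfrac{\partial^2}{\partial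 v_j\partial v_k}+\sum_{|k|\ge1}k^2v_k\tfrac{\partial}{\partial v_k}+u^2\tfrac{\partial^2}{\partial u^2}+u\tfrac{\partial}{\partial u},$$ and set $\mathcal L_0=-\mathcal N-2\mathcal Y_1-2\mathcal Y_2$; $\mathcal L_1^{(1)}=\mathcal N+2\mathcal Z_1+2\mathcal Z_2$, $\mathcal L_2^{(1)}=2\mathcal K_1+\mathcal K_2$; $\mathcal L_1^{(2)}=0$, $\mathcal L_2^{(2)}=-2\mathcal K_1^--\mathcal K_2^-+\mathcal J$; $\mathcal L_1^{(4)}=-\tfrac12\mathcal L_1^{(1)}$, $\mathcal L_2^{(4)}=\tfrac14\mathcal L_2^{(1)}$; and $$\mathcal D_N^{(\beta)}=\mathcal L_0+\tfrac1N\mathcal L_1^{(\beta)}+\tfrac1{N^2}\mathcal L_2^{(\beta)},\qquad \beta\in\{1,2,4\}.$$ For $N\ge1$ let $K_N^{(1)}=SO(N,\mathbb R)$, $K_N^{(2)}=SU(N)$, and $K_N^{(4)}=Sp(N)=\{A\in M_{2N}(\mathbb C):A^{\mathsf T}\Omega A=\Omega,\ A^*A=I\}$, where $\Omega$ is block diagonal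 with $N$ blocks $\begin{pmatrix}0&1\\-1&0\end{pmatrix}$. Equip the Lie algebras with the inner products $\langle X,Y\rangle=\tfrac N2\mathrm{Tr}(XY^*)$ on $\mathfrak{so}(N,\mathbb R)$, $N\,\mathrm{Tr}(XY^*)$ on $\mathfrak{su}(N)$, and $N\,\mathrm{Tr}(XY^*)$ on $\mathfrak{sp}(N)$. Let $\Delta_N^{(\beta)}=\sum_X\widetilde X^2$, summed over an orthonormal basis of the Lie algebra (the statement holds for every such basis), where $(\widetilde Xf)(A)=\frac{d}{dt}f(Ae^{tX})\big|_{t=0}$ for matrix-valued functions $f$ on the group. For $P\in\mathbb C[u,u^{-1};\mathbf v]$ let $[P]_N=P_N$ be the smooth function $A\mapsto P(u;\mathbf v)|_{u=A,\ v_k=\mathrm{tr}(A^k)}$ on $K_N^{(\beta)}$, where $\mathrm{tr}$ is the trace normalized by $\mathrm{tr}(I)=1$. **Theorem.** Let $\beta\in\{1,2,4\}$ and $N\ge1$. 1. For every $P\in\mathbb C[u,u^{-1};\mathbf v]$, $\ \Delta_N^{(\beta)}P_N=[\mathcal D_N^{(\beta)}P]_N$. 2. For every $\tau\in\mathbb C$,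 the operator $e^{\frac\tau2\mathcal D_N^{(\beta)}}$ is well defined on $\mathbb C[u,u^{-1};\mathbf v]$ by its power series (every element lies in a finite-dimensional $\mathcal D_N^{(\beta)}$-invariant subspace), and for every $P$, $\ e^{\frac\tau2\Delta_N^{(\beta)}}P_N=[e^{\frac\tau2\mathcal D_N^{(\beta)}}P]_N$, where the left side is the convergent series $\sum_{n\ge0}\frac{1}{n!}\left(\frac\tau2\right)^n(\Delta_N^{(\beta)})^nP_N$. 3. The operators $\mathcal L_0,\mathcal L_1^{(\beta)},\mathcal L_2^{(\beta)}$ do not depend on $N$, and $\mathcal L_0$ does not depend on $\beta$; $\mathcal L_0$ and $\mathcal L_1^{(\beta)}$ are pseudodifferential operators of order at most one, and $\mathcal L_2^{(\beta)}$ is a differential operator of order at most two. Here a differential operator of order at most $n$ on a commutative algebra is one whose $(n+1)$-fold commutators with multiplications vanish. An operator $T$ is pseudodifferential of order at most $n$ if for every $s\in\mathbb Z$ the map $q\mapsto$ (the coefficient of $u^{m+s}$ in $T(u^mq)$), $q\in\mathbb C[\mathbf v]$, equals $\sum_{i\le n}m^ip_i$ for all sufficiently large $m$ and $\sum_{i\le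 n}m^ip_i'$ for all sufficiently negative $m$, with differential operators $p_i,p_i'$ of order at most $n-i$ on $\mathbb C[\mathbf v]$. -/

import Mathlib

noncomputable section

namespace TracePoly

open scoped Matrix

/-! ## The algebra of trace polynomials and the operators on it -/

/-- The indices `k = ±1, ±2, …` of the variables `v_k`. -/
abbrev VIdx : Type := {k : ℤ // k ≠ 0}

/-- The polynomial algebra `ℂ[v]` in the commuting variables `v_{±1}, v_{±2}, …`. -/
abbrev CV : Type := MvPolynomial VIdx ℂ

/-- The algebra `ℂ[u, u⁻¹; v]`: Laurent polynomials in `u` with coefficients in `ℂ[v]`. -/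
abbrev CUV : Type := LaurentPolynomial CV

/-- Linear operators on `ℂ[u, u⁻¹; v]`. -/
abbrev Op : Type := Module.End ℂ CUV

/-- The monomial map `q ↦ u^m q`. -/
def mono (m : ℤ) : CV →ₗ[ℂ] CUV := AddMonoidAlgebra.lsingle m

/-- The linear operator on `ℂ[u, u⁻¹; v]` with `u^m q ↦ φ m q` for `m ∈ ℤ` and `q ∈ ℂ[v]`. -/
def onMono (φ : ℤ → CV →ₗ[ℂ] CUV) : Op :=
  Finsupp.lsum ℂ φ ∘ₗ (AddMonoidAlgebra.coeffLinearEquiv ℂ).toLinearMap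

theorem onMono_mono (φ : ℤ → CV →ₗ[ℂ] CUV) (m : ℤ) (q : CV) : onMono φ (mono m q) = φ m q := by
  simp [onMono, mono, -LaurentPolynomial.single_eq_C_mul_T]

/-- The element `u^k`. -/
def uPow (k : ℤ) : CUV := LaurentPolynomial.T k

/-- The element `v_k`, with the usual convention `v_0 = 1` (the normalized trace of `A^0`). -/
def v (k : ℤ) : CUV := if h : k ≠ 0 then LaurentPolynomial.C (MvPolynomial.X ⟨k, h⟩) else 1

/-- Multiplication by `f`. -/
def mulOp (f : CUV) : Op := LinearMap.mulLeft ℂ f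

/-- The projection `R⁺` onto the nonnegative powers of `u`. -/
def Rplus : Op := onMono fun m => if 0 ≤ m then mono m else 0

/-- The projection `R⁻` onto the negative powers of `u`. -/
def Rminus : Op := onMono fun m => if m < 0 then mono m else 0

/-- The partial derivative `∂/∂u`. -/
def du : Op := onMono fun m => (m : ℂ) • mono (m - 1)

/-- The partial derivative `∂/∂v_k`. -/
def dv (k : VIdx) : Op := onMono fun m => mono m ∘ₗ (MvPolynomial.pderiv k).toLinearMap

/-- A family of operators of which only finitely many act nontrivially on each given element. -/
def LocFin {ι : Type} (T : ι → Op) : Prop := ∀ P, (Function.support fun i => T i P).Finite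

/-- The sum of a locally finite family of operators. -/
def lsum {ι : Type} (T : ι → Op) (h : LocFin T) : Op where
  toFun P := ∑ᶠ i, T i P
  map_add' P Q := by
    simp only [map_add]
    exact finsum_add_distrib (h P) (h Q)
  map_smul' c P := by
    simp only [map_smul, RingHom.id_apply]
    exact (smul_finsum' c (h P)).symm

theorem locFin_of_mono {ι : Type} {T : ι → Op}
    (h : ∀ m q, (Function.support fun i => T i (mono m q)).Finite) : LocFin T := by
  intro P
  induction P using AddMonoidAlgebra.induction_linear with
  | zero => simp
  | add P Q hP hQ =>
    refine (hP.union hQ).subset ?_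
    simp only [map_add]
    exact Function.support_add _ _
  | single m q => exact h m q

theorem locFin_mul_dv (S : VIdx → Op) : LocFin fun k => S k * dv k := by
  refine locFin_of_mono fun m q => (q.vars.finite_toSet).subset fun k hk => ?_
  by_contra hq
  refine hk ?_
  simp [dv, onMono_mono, MvPolynomial.pderiv_eq_zero_of_notMem_vars (by simpa using hq)]

theorem locFin_mul_dv_dv (S : VIdx × VIdx → Op) : LocFin fun p => S p * (dv p.1 * dv p.2) := by
  refine locFin_of_mono fun m q => (q.vars.finite_toSet.biUnion fun k _ =>
    (((MvPolynomial.pderiv k q).vars.finite_toSet).prod (Set.finite_singleton k))).subset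
      fun p hp => ?_
  by_contra hq
  refine hp ?_
  have hc : MvPolynomial.pderiv p.1 (MvPolynomial.pderiv p.2 q) = 0 := by
    by_cases h : p.2 ∈ q.vars
    · refine MvPolynomial.pderiv_eq_zero_of_notMem_vars fun h' => hq ?_
      exact Set.mem_biUnion (Finset.mem_coe.2 h) ⟨h', rfl⟩
    · rw [MvPolynomial.pderiv_eq_zero_of_notMem_vars h, map_zero]
  simp [dv, onMono_mono, hc]

theorem mulOp_uPow_mono (k m : ℤ) (q : CV) : mulOp (uPow k) (mono m q) = mono (k + m) q := by
  simp only [mulOp, uPow, mono, LinearMap.mulLeft_apply, AddMonoidAlgebra.lsingle_apply]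
  change AddMonoidAlgebra.single k 1 * AddMonoidAlgebra.single m q = _
  rw [AddMonoidAlgebra.single_mul_single, one_mul]

theorem locFin_plus (S : ℤ → Op) : LocFin fun k : ℤ =>
    if 1 ≤ k then S k * (Rplus * du * mulOp (uPow (-k)) * Rplus) else 0 := by
  refine locFin_of_mono fun m q => (Set.finite_Icc (1 : ℤ) m).subset fun k hk => ?_
  by_contra hkm
  refine hk ?_
  by_cases h1 : 1 ≤ k
  · have h2 : ¬ k < m := fun h => hkm ⟨h1, by omega⟩
    by_cases h3 : 0 ≤ m <;>
      simp [h1, h2, h3, Rplus, du, onMono_mono, mulOp_uPow_mono]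
  · simp [h1]

theorem locFin_minus (S : ℤ → Op) : LocFin fun k : ℤ =>
    if k ≤ -1 then S k * (Rminus * du * mulOp (uPow (-k)) * Rminus) else 0 := by
  refine locFin_of_mono fun m q => (Set.finite_Icc m (-1)).subset fun k hk => ?_
  by_contra hkm
  refine hk ?_
  by_cases h1 : k ≤ -1
  · have h2 : ¬ (-k + m - 1 < 0) := fun h => hkm ⟨by omega, h1⟩
    by_cases h3 : m < 0 <;>
      simp [h1, h2, h3, Rminus, du, onMono_mono, mulOp_uPow_mono]
  · simp [h1]

/-- `N₀ = ∑_{|k| ≥ 1} |k| v_k ∂/∂v_k`. -/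
def opN0 : Op := lsum _ (locFin_mul_dv fun k => mulOp (((|k.1| : ℤ) : ℂ) • v k))

/-- `N₁ = u ∂/∂u (R⁺ - R⁻)`. -/
def opN1 : Op := mulOp (uPow 1) * du * (Rplus - Rminus)

/-- `N = N₀ + N₁`. -/
def opN : Op := opN0 + opN1

/-- `Y₁⁺ = ∑_{k ≥ 1} v_k u R⁺ ∂/∂u M_{u^{-k}} R⁺`. -/
def opY1p : Op := lsum _ (locFin_plus fun k => mulOp (v k * uPow 1))

/-- `Y₁⁻ = ∑_{k ≤ -1} v_k u R⁻ ∂/∂u M_{u^{-k}} R⁻`. -/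
def opY1m : Op := lsum _ (locFin_minus fun k => mulOp (v k * uPow 1))

/-- `Y₁ = Y₁⁺ - Y₁⁻`. -/
def opY1 : Op := opY1p - opY1m

/-- `Y₂⁺ = ∑_{k ≥ 2} (∑_{j=1}^{k-1} j v_j v_{k-j}) ∂/∂v_k`; the inner sum is empty for `k < 2`. -/
def opY2p : Op := lsum _ (locFin_mul_dv fun k =>
  mulOp (∑ j ∈ Finset.Icc 1 (k.1 - 1), (j : ℂ) • (v j * v (k - j))))

/-- `Y₂⁻ = ∑_{k ≤ -2} (∑_{j=k+1}^{-1} j v_j v_{k-j}) ∂/∂v_k`; the inner sum is empty for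
`k > -2`. -/
def opY2m : Op := lsum _ (locFin_mul_dv fun k =>
  mulOp (∑ j ∈ Finset.Icc (k.1 + 1) (-1), (j : ℂ) • (v j * v (k - j))))

/-- `Y₂ = Y₂⁺ - Y₂⁻`. -/
def opY2 : Op := opY2p - opY2m

/-- `Z₁⁺ = ∑_{k ≥ 2} (∑_{j=1}^{k-1} (k-j) v_{k-2j}) ∂/∂v_k`. -/
def opZ1p : Op := lsum _ (locFin_mul_dv fun k =>
  mulOp (∑ j ∈ Finset.Icc 1 (k.1 - 1), ((k - j : ℤ) : ℂ) • v (k - 2 * j)))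

/-- `Z₁⁻ = ∑_{k ≤ -2} (∑_{j=k+1}^{-1} (k-j) v_{k-2j}) ∂/∂v_k`. -/
def opZ1m : Op := lsum _ (locFin_mul_dv fun k =>
  mulOp (∑ j ∈ Finset.Icc (k.1 + 1) (-1), ((k - j : ℤ) : ℂ) • v (k - 2 * j)))

/-- `Z₁ = Z₁⁺ - Z₁⁻`. -/
def opZ1 : Op := opZ1p - opZ1m

/-- `Z₂⁺ = ∑_{k ≥ 1} u^{-k+1} R⁺ ∂/∂u M_{u^{-k}} R⁺`. -/
def opZ2p : Op := lsum _ (locFin_plus fun k => mulOp (uPow (-k + 1)))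

/-- `Z₂⁻ = ∑_{k ≤ -1} u^{-k+1} R⁻ ∂/∂u M_{u^{-k}} R⁻`. -/
def opZ2m : Op := lsum _ (locFin_minus fun k => mulOp (uPow (-k + 1)))

/-- `Z₂ = Z₂⁺ - Z₂⁻`. -/
def opZ2 : Op := opZ2p - opZ2m

theorem locFin_mul_dv_du (S : VIdx → Op) : LocFin fun k => S k * (dv k * du) := fun P =>
  locFin_mul_dv S (du P)

/-- `K₁⁺ = ∑_{|k| ≥ 1} k u^{-k+1} ∂²/∂v_k∂u`. -/
def opK1p : Op := lsum _ (locFin_mul_dv_du fun k => mulOp ((k : ℂ) • uPow (-k + 1)))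

/-- `K₁⁻ = ∑_{|k| ≥ 1} k u^{k+1} ∂²/∂v_k∂u`. -/
def opK1m : Op := lsum _ (locFin_mul_dv_du fun k => mulOp ((k : ℂ) • uPow (k + 1)))

/-- `K₁ = K₁⁺ - K₁⁻`. -/
def opK1 : Op := opK1p - opK1m

/-- `K₂⁺ = ∑_{|j|,|k| ≥ 1} j k v_{k-j} ∂²/∂v_j∂v_k`. -/
def opK2p : Op := lsum _ (locFin_mul_dv_dv fun p =>
  mulOp (((p.1 : ℂ) * (p.2 : ℂ)) • v (p.2 - p.1)))

/-- `K₂⁻ = ∑_{|j|,|k| ≥ 1} j k v_{k+j} ∂²/∂v_j∂v_k`. -/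
def opK2m : Op := lsum _ (locFin_mul_dv_dv fun p =>
  mulOp (((p.1 : ℂ) * (p.2 : ℂ)) • v (p.2 + p.1)))

/-- `K₂ = K₂⁺ - K₂⁻`. -/
def opK2 : Op := opK2p - opK2m

/-- `J = 2 ∑_k k u v_k ∂²/∂u∂v_k + ∑_{j,k} j k v_j v_k ∂²/∂v_j∂v_k + ∑_k k² v_k ∂/∂v_k
+ u² ∂²/∂u² + u ∂/∂u`, all indices running over the nonzero integers. -/
def opJ : Op :=
  (2 : ℂ) • lsum _ (locFin_mul_dv_du fun k => mulOp ((k : ℂ) • (uPow 1 * v k)))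
  + lsum _ (locFin_mul_dv_dv fun p => mulOp (((p.1 : ℂ) * (p.2 : ℂ)) • (v p.1 * v p.2)))
  + lsum _ (locFin_mul_dv fun k => mulOp ((k : ℂ) ^ 2 • v k))
  + mulOp (uPow 2) * (du * du) + mulOp (uPow 1) * du

/-- The parameter `β ∈ {1, 2, 4}`, for the groups `SO(N, ℝ)`, `SU(N)`, `Sp(N)`. -/
inductive Beta : Type
  | one
  | two
  | four

/-- `L₀ = -N - 2 Y₁ - 2 Y₂`, common to the three families of groups. -/
def L0 : Op := -opN - (2 : ℂ) • opY1 - (2 : ℂ) • opY2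

/-- `L₁^{(β)}`. -/
def L1 : Beta → Op
  | .one => opN + (2 : ℂ) • opZ1 + (2 : ℂ) • opZ2
  | .two => 0
  | .four => (-(1 / 2) : ℂ) • (opN + (2 : ℂ) • opZ1 + (2 : ℂ) • opZ2)

/-- `L₂^{(β)}`. -/
def L2 : Beta → Op
  | .one => (2 : ℂ) • opK1 + opK2
  | .two => -((2 : ℂ) • opK1m) - opK2m + opJ
  | .four => (1 / 4 : ℂ) • ((2 : ℂ) • opK1 + opK2)

/-- `D_N^{(β)} = L₀ + (1/N) L₁^{(β)} + (1/N²) L₂^{(β)}`. -/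
def D (β : Beta) (N : ℕ) : Op := L0 + (1 / (N : ℂ)) • L1 β + (1 / (N : ℂ) ^ 2) • L2 β

/-! ## Orders of operators -/

/-- Differential operators of order at most `n` on a commutative algebra `A`, in the usual algebraic
(Grothendieck) sense: order at most `0` means commuting with all multiplications, and `T` has order
at most `n + 1` if all commutators `[T, f]` have order at most `n`. -/
def IsDiffOp {A : Type} [CommRing A] [Algebra ℂ A] : ℕ → (A →ₗ[ℂ] A) → Prop
  | 0, T => ∀ f : A, T ∘ₗ LinearMap.mulLeft ℂ f = LinearMap.mulLeft ℂ f ∘ₗ T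
  | n + 1, T => ∀ f : A,
      IsDiffOp n (T ∘ₗ LinearMap.mulLeft ℂ f - LinearMap.mulLeft ℂ f ∘ₗ T)

/-- Pseudodifferential operators of order at most `n` on `ℂ[u, u⁻¹; v]` (differential in `v`, with a
symbol in the `u`-direction). Such an operator `T` acts on monomials by
`T (u^m q) = ∑_s u^{m+s} σ_s(m) q`, and the requirement is that each component `σ_s(m)` of the
symbol agrees, for all large positive `m`, with a polynomial `∑_{i ≤ n} m^i p_i` in `m`, where `p_i`
is a differential operator of order at most `n - i` on `ℂ[v]`, and likewise, with possibly different
`p_i`, for all large negative `m`. The class contains the differential operators, the two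
projections `R^±` (order `0`), and e.g. `R⁺ ∂/∂u R⁺` (order `1`). -/
def IsPseudoDiffOp (n : ℕ) (T : Op) : Prop :=
  ∀ s : ℤ, ∃ p p' : ℕ → (CV →ₗ[ℂ] CV),
    (∀ i ≤ n, IsDiffOp (n - i) (p i) ∧ IsDiffOp (n - i) (p' i)) ∧
    (∀ᶠ m : ℤ in Filter.atTop, ∀ q : CV,
      (T (mono m q)).coeff (m + s) = ∑ i ∈ Finset.range (n + 1), (m : ℂ) ^ i • p i q) ∧
    (∀ᶠ m : ℤ in Filter.atBot, ∀ q : CV,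
      (T (mono m q)).coeff (m + s) = ∑ i ∈ Finset.range (n + 1), (m : ℂ) ^ i • p' i q)

/-- `E = e^T`, given by the power series: each `P` lies in a finite-dimensional subspace invariant
under `T`, and there `∑_n T^n P / n!` converges to `E P` (coefficient by coefficient, which on a
finite-dimensional subspace is convergence in its only vector space topology). -/
def IsExp (T E : Op) : Prop :=
  ∀ P : CUV, ∃ W : Submodule ℂ CUV, FiniteDimensional ℂ W ∧ P ∈ W ∧ E P ∈ W ∧
    (∀ Q ∈ W, T Q ∈ W) ∧
    ∀ (k : ℤ) (α : VIdx →₀ ℕ),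
      HasSum (fun n : ℕ => ((n.factorial : ℂ)⁻¹) * (((T ^ n) P).coeff k).coeff α)
        (((E P).coeff k).coeff α)

/-! ## The groups -/

/-- A group of complex matrices (closed under inverses in all cases below) with its Lie algebra
and the inner product `⟨X, Y⟩ = scale * Tr (X Y^*)` on the Lie algebra. -/
structure MatrixGroup where
  /-- The index type of the matrices. -/
  n : Type
  [fintype : Fintype n]
  [decEq : DecidableEq n]
  /-- The group. -/
  grp : Submonoid (Matrix n n ℂ)
  /-- The Lie algebra. -/
  lie : Submodule ℝ (Matrix n n ℂ)
  exp_mem : ∀ X ∈ lie, NormedSpace.exp X ∈ grp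
  /-- The factor of the inner product. -/
  scale : ℝ

attribute [instance] MatrixGroup.fintype MatrixGroup.decEq

section Groups

variable (N : ℕ)

/-- The embedding `M_N(ℝ) ⊆ M_N(ℂ)`. -/
def realEmb : Matrix (Fin N) (Fin N) ℝ →+* Matrix (Fin N) (Fin N) ℂ :=
  (algebraMap ℝ ℂ).mapMatrix

/-- `so(N, ℝ) = {X ∈ M_N(ℝ) : Xᵀ = -X}`, inside `M_N(ℂ)`. -/
def soLie : Submodule ℝ (Matrix (Fin N) (Fin N) ℂ) where
  carrier := {X | ∃ Y : Matrix (Fin N) (Fin N) ℝ, Yᵀ = -Y ∧ X = realEmb N Y}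
  zero_mem' := ⟨0, by simp, by simp⟩
  add_mem' := by
    rintro _ _ ⟨Y, hY, rfl⟩ ⟨Z, hZ, rfl⟩
    exact ⟨Y + Z, by rw [Matrix.transpose_add, hY, hZ]; abel, by simp⟩
  smul_mem' := by
    rintro c _ ⟨Y, hY, rfl⟩
    refine ⟨c • Y, by rw [Matrix.transpose_smul, hY, smul_neg], ?_⟩
    ext i j
    simp [realEmb]

/-- `su(N) = {X ∈ M_N(ℂ) : X^* = -X, Tr X = 0}`. -/
def suLie : Submodule ℝ (Matrix (Fin N) (Fin N) ℂ) where
  carrier := {X | Xᴴ = -X ∧ X.trace = 0}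
  zero_mem' := by simp
  add_mem' := by
    rintro X Y ⟨h1, h2⟩ ⟨h3, h4⟩
    exact ⟨by rw [Matrix.conjTranspose_add, h1, h3]; abel, by rw [Matrix.trace_add, h2, h4, add_zero]⟩
  smul_mem' := by
    rintro c X ⟨h1, h2⟩
    exact ⟨by rw [Matrix.conjTranspose_smul, h1]; simp, by rw [Matrix.trace_smul, h2, smul_zero]⟩

/-- `Ω = diag(Ω₀, …, Ω₀)` with `Ω₀ = [0, 1; -1, 0]`. The rows of a `2N × 2N` matrix are indexed by
pairs `(i, a)`: the `a`-th row of the `i`-th `2 × 2` block. -/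
def Omega : Matrix (Fin N × Fin 2) (Fin N × Fin 2) ℂ :=
  Matrix.of fun p q => if p.1 = q.1 then (!![0, 1; -1, 0] : Matrix (Fin 2) (Fin 2) ℂ) p.2 q.2 else 0

theorem Omega_mul_Omega : Omega N * Omega N = -1 := by
  ext ⟨i, a⟩ ⟨j, b⟩
  fin_cases a <;> fin_cases b <;>
    simp [Omega, Matrix.mul_apply, Fintype.sum_prod_type, Matrix.one_apply, Prod.ext_iff] <;>
    split_ifs <;> simp

/-- `Sp(N) = {A ∈ M_{2N}(ℂ) : Aᵀ Ω A = Ω, A^* A = 1}`. -/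
def spGrp : Submonoid (Matrix (Fin N × Fin 2) (Fin N × Fin 2) ℂ) where
  carrier := {A | Aᵀ * Omega N * A = Omega N ∧ Aᴴ * A = 1}
  one_mem' := by simp
  mul_mem' := by
    rintro A B ⟨h1, h2⟩ ⟨h3, h4⟩
    constructor
    · calc (A * B)ᵀ * Omega N * (A * B) = Bᵀ * (Aᵀ * Omega N * A) * B := by
            simp only [Matrix.transpose_mul, Matrix.mul_assoc]
        _ = Omega N := by rw [h1, h3]
    · calc (A * B)ᴴ * (A * B) = Bᴴ * (Aᴴ * A) * B := by
            simp only [Matrix.conjTranspose_mul, Matrix.mul_assoc]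
        _ = 1 := by rw [h2, Matrix.mul_one, h4]

/-- `sp(N) = {X ∈ M_{2N}(ℂ) : Ω Xᵀ Ω = X, X^* = -X}`. -/
def spLie : Submodule ℝ (Matrix (Fin N × Fin 2) (Fin N × Fin 2) ℂ) where
  carrier := {X | Omega N * Xᵀ * Omega N = X ∧ Xᴴ = -X}
  zero_mem' := by simp
  add_mem' := by
    rintro X Y ⟨h1, h2⟩ ⟨h3, h4⟩
    exact ⟨by rw [Matrix.transpose_add, Matrix.mul_add, Matrix.add_mul, h1, h3],
      by rw [Matrix.conjTranspose_add, h2, h4]; abel⟩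
  smul_mem' := by
    rintro c X ⟨h1, h2⟩
    exact ⟨by rw [Matrix.transpose_smul, Matrix.mul_smul, Matrix.smul_mul, h1],
      by rw [Matrix.conjTranspose_smul, h2]; simp⟩

variable {N}

theorem exp_mul_exp_neg {n : Type} [Fintype n] [DecidableEq n] {𝕂 : Type} [RCLike 𝕂]
    (X : Matrix n n 𝕂) : NormedSpace.exp (-X) * NormedSpace.exp X = 1 := by
  rw [← Matrix.exp_add_of_commute _ _ (Commute.neg_left (Commute.refl X)), neg_add_cancel,
    NormedSpace.exp_zero]

theorem det_exp_of_skew (Y : Matrix (Fin N) (Fin N) ℝ) (hY : Yᵀ = -Y) :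
    (NormedSpace.exp Y).det = 1 := by
  set Z : Matrix (Fin N) (Fin N) ℝ := (1 / 2 : ℝ) • Y with hZ
  have hYZ : Y = Z + Z := by rw [hZ, ← add_smul]; norm_num
  have hZt : Zᵀ = -Z := by rw [hZ, Matrix.transpose_smul, hY, smul_neg]
  have h1 : (NormedSpace.exp Z).det * (NormedSpace.exp Z).det = 1 := by
    have := congrArg Matrix.det (exp_mul_exp_neg Z)
    rwa [Matrix.det_mul, ← hZt, Matrix.exp_transpose, Matrix.det_transpose, Matrix.det_one] at this
  rw [hYZ, Matrix.exp_add_of_commute _ _ (Commute.refl Z), Matrix.det_mul, h1]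

theorem so_exp_mem (X : Matrix (Fin N) (Fin N) ℂ) (hX : X ∈ soLie N) :
    NormedSpace.exp X ∈
      (Matrix.specialOrthogonalGroup (Fin N) ℝ).map (realEmb N) := by
  obtain ⟨Y, hY, rfl⟩ := hX
  have hc : Continuous (realEmb N) :=
    continuous_matrix fun i j => Complex.continuous_ofReal.comp (continuous_id.matrix_elem i j)
  refine ⟨NormedSpace.exp Y, ?_, ?_⟩
  · refine Matrix.mem_specialOrthogonalGroup_iff.2 ⟨?_, det_exp_of_skew Y hY⟩
    rw [Matrix.mem_orthogonalGroup_iff', ← Matrix.exp_transpose, hY]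
    exact exp_mul_exp_neg Y
  · open scoped Matrix.Norms.Operator in
    exact NormedSpace.map_exp (realEmb N) hc Y

theorem su_exp_mem (X : Matrix (Fin N) (Fin N) ℂ) (hX : X ∈ suLie N) :
    NormedSpace.exp X ∈ Matrix.specialUnitaryGroup (Fin N) ℂ := by
  obtain ⟨h1, h2⟩ := hX
  refine Matrix.mem_specialUnitaryGroup_iff.2 ⟨?_, ?_⟩
  · rw [Matrix.mem_unitaryGroup_iff', Matrix.star_eq_conjTranspose, ← Matrix.exp_conjTranspose, h1]
    exact exp_mul_exp_neg X
  · have hH : (Complex.I • X).IsHermitian := by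
      rw [Matrix.IsHermitian, Matrix.conjTranspose_smul, h1]
      simp
    set U := hH.eigenvectorUnitary
    set w : Fin N → ℂ := fun i => -Complex.I * (hH.eigenvalues i : ℂ) with hw
    have hU : (U : Matrix (Fin N) (Fin N) ℂ) * star (U : Matrix (Fin N) (Fin N) ℂ) = 1 :=
      Unitary.coe_mul_star_self U
    have hX : X = (U : Matrix (Fin N) (Fin N) ℂ) * Matrix.diagonal w * (U : Matrix _ _ ℂ)⁻¹ := by
      have h3 := hH.spectral_theorem
      have h4 : X = (-Complex.I) • (Complex.I • X) := by simp [smul_smul]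
      rw [Matrix.inv_eq_right_inv hU, h4, h3, Unitary.conjStarAlgAut_apply]
      have : Matrix.diagonal w = (-Complex.I) • Matrix.diagonal (RCLike.ofReal ∘ hH.eigenvalues) := by
        rw [← Matrix.diagonal_smul]
        rfl
      rw [this, Matrix.mul_smul, Matrix.smul_mul]
    have hunit : IsUnit (U : Matrix (Fin N) (Fin N) ℂ) :=
      IsUnit.of_mul_eq_one _ hU
    have htr : ∑ i, w i = 0 := by
      rw [hX, Matrix.trace_mul_comm, ← Matrix.mul_assoc, Matrix.nonsing_inv_mul _
        ((Matrix.isUnit_iff_isUnit_det _).1 hunit), Matrix.one_mul, Matrix.trace_diagonal] at h2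
      exact h2
    rw [hX, Matrix.exp_conj _ _ hunit, Matrix.det_conj hunit, Matrix.exp_diagonal,
      Matrix.det_diagonal]
    have : ∀ i, NormedSpace.exp w i = Complex.exp (w i) := fun i => by
      rw [Complex.exp_eq_exp_ℂ]
      exact Pi.coe_exp w i
    simp only [this]
    rw [← Complex.exp_sum, htr, Complex.exp_zero]

theorem sp_exp_mem (X : Matrix (Fin N × Fin 2) (Fin N × Fin 2) ℂ) (hX : X ∈ spLie N) :
    NormedSpace.exp X ∈ spGrp N := by
  obtain ⟨h1, h2⟩ := hX
  have hΩ := Omega_mul_Omega N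
  have hinv : (Omega N)⁻¹ = -Omega N := Matrix.inv_eq_right_inv (by rw [Matrix.mul_neg, hΩ, neg_neg])
  have hunit : IsUnit (Omega N) :=
    IsUnit.of_mul_eq_one (-Omega N) (by rw [Matrix.mul_neg, hΩ, neg_neg])
  constructor
  · have h3 : Xᵀ = Omega N * (-X) * (Omega N)⁻¹ := by
      rw [hinv]
      nth_rw 2 [← h1]
      calc Xᵀ = (Omega N * Omega N) * Xᵀ * (Omega N * Omega N) := by rw [hΩ]; simp
        _ = _ := by simp only [Matrix.mul_assoc, Matrix.mul_neg, Matrix.neg_mul, neg_neg]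
    rw [← Matrix.exp_transpose, h3, Matrix.exp_conj _ _ hunit, Matrix.mul_assoc, Matrix.mul_assoc,
      ← Matrix.mul_assoc (Omega N)⁻¹, Matrix.nonsing_inv_mul _
        ((Matrix.isUnit_iff_isUnit_det _).1 hunit), Matrix.one_mul, Matrix.mul_assoc,
      exp_mul_exp_neg, Matrix.mul_one]
  · rw [← Matrix.exp_conjTranspose, h2]
    exact exp_mul_exp_neg X

end Groups

/-- `SO(N, ℝ) ⊆ M_N(ℂ)`, with `⟨X, Y⟩ = (N/2) Tr (X Y^*)` on `so(N, ℝ)`. -/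
def SOgroup (N : ℕ) : MatrixGroup where
  n := Fin N
  grp := (Matrix.specialOrthogonalGroup (Fin N) ℝ).map (realEmb N)
  lie := soLie N
  exp_mem := so_exp_mem
  scale := N / 2

/-- `SU(N) ⊆ M_N(ℂ)`, with `⟨X, Y⟩ = N Tr (X Y^*)` on `su(N)`. -/
def SUgroup (N : ℕ) : MatrixGroup where
  n := Fin N
  grp := Matrix.specialUnitaryGroup (Fin N) ℂ
  lie := suLie N
  exp_mem := su_exp_mem
  scale := N

/-- `Sp(N) ⊆ M_{2N}(ℂ)`, with `⟨X, Y⟩ = N Tr (X Y^*)` on `sp(N)`. -/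
def Spgroup (N : ℕ) : MatrixGroup where
  n := Fin N × Fin 2
  grp := spGrp N
  lie := spLie N
  exp_mem := sp_exp_mem
  scale := N

/-- `K_N^{(β)}`. -/
def K : Beta → ℕ → MatrixGroup
  | .one, N => SOgroup N
  | .two, N => SUgroup N
  | .four, N => Spgroup N

namespace MatrixGroup

variable (G : MatrixGroup)

/-- Matrix-valued functions on the group. -/
abbrev Fn : Type := G.grp → Matrix G.n G.n ℂ

/-- The exponential map from the Lie algebra to the group. -/
def expMap (X : G.lie) : G.grp :=
  ⟨NormedSpace.exp (X : Matrix G.n G.n ℂ), G.exp_mem X X.2⟩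

/-- The left-invariant vector field `X̃`, acting by `(X̃ f)(A) = d/dt f(A e^{tX})` at `t = 0`. -/
def leftDeriv (X : G.lie) (f : G.Fn) : G.Fn := fun A =>
  deriv (fun t : ℝ => f (A * G.expMap (t • X))) 0

/-- Smoothness of `f` on the group, in exponential coordinates around each of its points. -/
def IsSmooth (f : G.Fn) : Prop :=
  ∀ (d : ℕ) (b : Module.Basis (Fin d) ℝ G.lie) (A : G.grp) (i j : G.n),
    ContDiff ℝ (⊤ : ℕ∞) fun x : Fin d → ℝ => f (A * G.expMap (∑ k, x k • b k)) i j

/-- The basis `b` of the Lie algebra is orthonormal for `⟨X, Y⟩ = scale * Tr (X Y^*)`. -/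
def IsOrthonormal {d : ℕ} (b : Module.Basis (Fin d) ℝ G.lie) : Prop :=
  ∀ k l, (G.scale : ℂ) * ((b k : Matrix G.n G.n ℂ) * (b l : Matrix G.n G.n ℂ)ᴴ).trace =
    if k = l then 1 else 0

/-- The Laplacian `Δ = ∑_k X̃_k²` of a basis `X_1, …, X_d` of the Lie algebra. -/
def laplacian {d : ℕ} (b : Module.Basis (Fin d) ℝ G.lie) (f : G.Fn) : G.Fn :=
  ∑ k, G.leftDeriv (b k) (G.leftDeriv (b k) f)

/-- The trace polynomial `P_N`: the function `A ↦ P(u; v)` at `u = A` and `v_k = tr (A^k)`, where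
`tr` is the normalized trace (so `(1/N) Tr` for `SO(N, ℝ)`, `SU(N)` and `(1/2N) Tr` for `Sp(N)`).
The powers `A^k`, `k ∈ ℤ`, are integer powers of an invertible matrix. -/
def traceFn (P : CUV) : G.Fn := fun A =>
  P.coeff.sum fun k q =>
    MvPolynomial.eval
      (fun j : VIdx => ((A : Matrix G.n G.n ℂ) ^ (j : ℤ)).trace / (Fintype.card G.n : ℂ)) q
    • (A : Matrix G.n G.n ℂ) ^ k

end MatrixGroup

end TracePoly

end

/-! For an orthonormal basis of the Lie algebra, the contractions `∑ X_i A^k X_i` and `∑ tr(X_i A^k)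
X_i` can be evaluated on the group, and the results are linear combinations of `A^k`, `A^(-k)` and
the identity with trace coefficients. `CasimirRel` records these identities with three parameters
`a`, `b`, `c`, and `casimirOp a b c` is the operator on trace polynomials that they force. The three
families differ only in the parameters: `(1/N, 0, 1/N²)` for SO, `(0, 1/N², 1/N²)` for SU,
`(-1/(2N), 0, 1/(4N²))` for Sp.

Differentiating `A^m` twice inserts `X_i` at two places. The sandwich identity acts on the power
caught between them, and collecting the pairs of places by that power gives exactly the terms of the
operator on `u^m` (`orientedSum_orientedSum`, `traceEval_casimirOp_mono_one`). The step from `P` to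
`v_k P` is the product rule `Δ(fg) = fΔg + 2⟨∇f,∇g⟩ + gΔf`. Its cross term needs the pairing of the
gradient of `P` with those of the traces, so the induction hypothesis `LaplacianFormula` carries
this pairing along; it is a combination of the derivations `shiftDeriv` (`LaplacianFormula.v_mul`).
On the operator side the same three terms arise as commutators with multiplication by `v_k`
(`traceEval_casimirOp_v_mul`).

The contraction identities come from projecting a matrix onto the complexified Lie algebra
(`sum_trace_smul`): half the difference of `B` and its adjoint for the bilinear form in the
orthogonal and symplectic cases (`casimirRel_of_form`), and the traceless part in the unitary case
(`casimirRel_of_unitary`).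

For the exponential, give `u^m v^α` the degree `|m| + ∑ |k| α_k`. The spaces of bounded degree are
finite-dimensional, exhaust the algebra, and are invariant (`degPres_D`), so the series converges
against every linear functional. Entries of the evaluation at a group element are such functionals,
which transfers the convergence to the group.

The orders are read off from commutators with multiplications and from the action on `u^m q`, whose
components are eventually affine in `m` for the order-one pieces. -/

noncomputable section
namespace TracePoly
open scoped Matrix

/-! ## Oriented sums over integer intervals -/

section OrientedSum

variable {V : Type*} [AddCommGroup V]

/-- The sum `f 1 + ⋯ + f m`, extended to negative `m` by `-(f (m+1) + ⋯ + f 0)`. -/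
def orientedSum (f : ℤ → V) (m : ℤ) : V :=
  ∑ j ∈ Finset.Icc 1 m, f j - ∑ j ∈ Finset.Icc (m + 1) 0, f j

theorem orientedSum_zero (f : ℤ → V) : orientedSum f 0 = 0 := by simp [orientedSum]

theorem orientedSum_succ (f : ℤ → V) (m : ℤ) :
    orientedSum f (m + 1) = orientedSum f m + f (m + 1) := by
  rcases lt_or_ge m 0 with h | h
  · have h1 : Finset.Icc 1 m = ∅ := Finset.Icc_eq_empty (by omega)
    have h2 : Finset.Icc 1 (m + 1) = ∅ := Finset.Icc_eq_empty (by omega)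
    have h3 : Finset.Icc (m + 1) 0 = insert (m + 1) (Finset.Icc (m + 1 + 1) 0) := by
      ext; simp only [Finset.mem_Icc, Finset.mem_insert]; omega
    rw [orientedSum, orientedSum, h1, h2, h3, Finset.sum_insert (by simp)]
    abel
  · have h1 : Finset.Icc (m + 1) 0 = ∅ := Finset.Icc_eq_empty (by omega)
    have h2 : Finset.Icc (m + 1 + 1) 0 = ∅ := Finset.Icc_eq_empty (by omega)
    have h3 : Finset.Icc 1 (m + 1) = insert (m + 1) (Finset.Icc 1 m) := by
      ext; simp only [Finset.mem_Icc, Finset.mem_insert]; omega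
    rw [orientedSum, orientedSum, h1, h2, h3, Finset.sum_insert (by simp)]
    abel

theorem orientedSum_pred (f : ℤ → V) (m : ℤ) :
    orientedSum f (m - 1) = orientedSum f m - f m := by
  have := orientedSum_succ f (m - 1)
  rw [sub_add_cancel] at this
  rw [this, add_sub_cancel_right]

/-- An oriented sum is determined by its value at 0 and its increments over all of ℤ, so identities
proved this way need no case split on the sign of `m`. -/
theorem eq_orientedSum {f F : ℤ → V} (h0 : F 0 = 0) (h : ∀ m, F (m + 1) = F m + f (m + 1))
    (m : ℤ) : F m = orientedSum f m := by
  induction m using Int.induction_on with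
  | zero => rw [h0, orientedSum_zero]
  | succ n ih => rw [h, ih, orientedSum_succ]
  | pred n ih =>
    have h1 := h (-n - 1)
    rw [sub_add_cancel, ih] at h1
    rw [orientedSum_pred, h1, add_sub_cancel_right]

theorem orientedSum_add (f g : ℤ → V) (m : ℤ) :
    orientedSum (fun j => f j + g j) m = orientedSum f m + orientedSum g m := by
  simp only [orientedSum, Finset.sum_add_distrib]
  abel

theorem map_orientedSum {W F : Type*} [AddCommGroup W] [FunLike F V W] [AddMonoidHomClass F V W]
    (φ : F) (f : ℤ → V) (m : ℤ) : φ (orientedSum f m) = orientedSum (fun j => φ (f j)) m := by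
  simp [orientedSum]

theorem mul_orientedSum {R : Type*} [Ring R] (x : R) (f : ℤ → R) (m : ℤ) :
    x * orientedSum f m = orientedSum (fun j => x * f j) m :=
  map_orientedSum (AddMonoidHom.mulLeft x) f m

theorem orientedSum_mul {R : Type*} [Ring R] (f : ℤ → R) (x : R) (m : ℤ) :
    orientedSum f m * x = orientedSum (fun j => f j * x) m :=
  map_orientedSum (AddMonoidHom.mulRight x) f m

theorem smul_orientedSum [Module ℂ V] (c : ℂ) (f : ℤ → V) (m : ℤ) :
    c • orientedSum f m = orientedSum (fun j => c • f j) m :=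
  map_orientedSum (DistribSMul.toAddMonoidHom V c) f m

theorem sum_orientedSum {ι : Type*} (s : Finset ι) (f : ι → ℤ → V) (m : ℤ) :
    ∑ i ∈ s, orientedSum (f i) m = orientedSum (fun j => ∑ i ∈ s, f i j) m := by
  simp only [orientedSum, Finset.sum_sub_distrib]
  rw [Finset.sum_comm, Finset.sum_comm (s := s)]

theorem orientedSum_const (c : V) (m : ℤ) : orientedSum (fun _ => c) m = m • c :=
  (eq_orientedSum (F := fun m => m • c) (zero_zsmul c) (fun m => by rw [add_zsmul, one_zsmul]) m).symm

theorem orientedSum_shift (f : ℤ → V) (m : ℤ) :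
    orientedSum (fun j => f (j - 1)) m = orientedSum f m + f 0 - f m :=
  (eq_orientedSum (F := fun m => orientedSum f m + f 0 - f m) (by simp [orientedSum_zero])
    (fun m => by simp only [orientedSum_succ, add_sub_cancel_right]; abel) m).symm

/-- Reflection carries the range `1, …, m` to `0, …, m - 1`; the mismatch at the two ends produces
the boundary terms. -/
theorem orientedSum_reflect (f : ℤ → V) (m : ℤ) :
    orientedSum (fun j => f (m - j)) m = orientedSum f m + f 0 - f m := by
  rw [← orientedSum_shift]
  have h1 : ∀ a b : ℤ, ∑ j ∈ Finset.Icc a b, f (m - j) =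
      ∑ j ∈ Finset.Icc (m + 1 - b) (m + 1 - a), f (j - 1) := fun a b =>
    Finset.sum_nbij' (fun j => m + 1 - j) (fun j => m + 1 - j)
      (fun j hj => by simp only [Finset.mem_Icc] at hj ⊢; omega)
      (fun j hj => by simp only [Finset.mem_Icc] at hj ⊢; omega)
      (fun j _ => by ring) (fun j _ => by ring) (fun j _ => by congr 1; ring)
  rw [orientedSum, orientedSum, h1, h1]
  congr 3 <;> ring

/-- A double sum over pairs `j < l` in an interval, by the value of the difference. -/
theorem orientedSum_orientedSum (h : ℤ → V) (m : ℤ) :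
    orientedSum (fun j => orientedSum (fun l => h (j - l)) j + orientedSum h (m - j)) m =
      m • h 0 + (2 : ℤ) • orientedSum (fun r => (m - r) • h r) m := by
  -- Summation by parts: raising `m` by one raises each weight `m - r` by one, and the new end term
  -- has weight zero.
  have h1 : orientedSum (fun r => (m - r) • h r) m =
      orientedSum (fun j => orientedSum h (j - 1)) m := by
    refine eq_orientedSum (F := fun m => orientedSum (fun r => (m - r) • h r) m)
      (orientedSum_zero _) (fun m => ?_) m
    have h2 : (fun r => (m + 1 - r) • h r) = fun r => (m - r) • h r + h r := by
      funext r
      rw [add_sub_right_comm, add_zsmul, one_zsmul]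
    rw [orientedSum_succ, h2, orientedSum_add, add_sub_cancel_right]
    simp
  rw [orientedSum_add, orientedSum_reflect (orientedSum h), ← orientedSum_shift, ← h1]
  have h2 : (fun j => orientedSum (fun l => h (j - l)) j) =
      fun j => orientedSum h (j - 1) + h 0 := by
    funext j
    rw [orientedSum_reflect, orientedSum_pred]
    abel
  rw [h2, orientedSum_add, ← h1, orientedSum_const, two_zsmul]
  abel

theorem zsmul_orientedSum (c : ℤ) (f : ℤ → V) (m : ℤ) :
    c • orientedSum f m = orientedSum (fun j => c • f j) m := by
  simp [orientedSum, Finset.smul_sum, smul_sub]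

/-- The operators sum over indices strictly between 0 and `m`, whereas the oriented sum includes `m`
if `m > 0` and 0 if `m < 0`. -/
theorem sum_Icc_sub_sum_Icc (f : ℤ → V) (m : ℤ) :
    ∑ j ∈ Finset.Icc 1 (m - 1), f j - ∑ j ∈ Finset.Icc (m + 1) (-1), f j =
      orientedSum f m + (if m < 0 then f 0 else 0) - (if 0 < m then f m else 0) := by
  rcases lt_trichotomy m 0 with h | h | h
  · have h1 : Finset.Icc 1 m = ∅ := Finset.Icc_eq_empty (by omega)
    have h2 : Finset.Icc 1 (m - 1) = ∅ := Finset.Icc_eq_empty (by omega)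
    have h3 : Finset.Icc (m + 1) 0 = insert 0 (Finset.Icc (m + 1) (-1)) := by
      ext; simp only [Finset.mem_Icc, Finset.mem_insert]; omega
    rw [orientedSum, h1, h2, h3, Finset.sum_insert (by simp), if_pos h, if_neg (by omega)]
    abel
  · subst h
    simp [orientedSum]
  · have h1 : Finset.Icc (m + 1) 0 = ∅ := Finset.Icc_eq_empty (by omega)
    have h2 : Finset.Icc (m + 1) (-1) = ∅ := Finset.Icc_eq_empty (by omega)
    have h3 : Finset.Icc 1 m = insert m (Finset.Icc 1 (m - 1)) := by
      ext; simp only [Finset.mem_Icc, Finset.mem_insert]; omega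
    rw [orientedSum, h1, h2, h3, Finset.sum_insert (by simp), if_neg (by omega), if_pos h]
    abel

/-- `∑ (m - r) h(r)` over the interior of the interval, with the diagonal contribution. -/
theorem abs_zsmul_add_two_zsmul_sum (h : ℤ → V) (m : ℤ) :
    |m| • h 0 + (2 : ℤ) • (∑ r ∈ Finset.Icc 1 (m - 1), (m - r) • h r -
      ∑ r ∈ Finset.Icc (m + 1) (-1), (m - r) • h r) =
      m • h 0 + (2 : ℤ) • orientedSum (fun r => (m - r) • h r) m := by
  rw [sum_Icc_sub_sum_Icc]
  rcases lt_trichotomy m 0 with h0 | h0 | h0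
  · rw [if_pos h0, if_neg (by omega), abs_of_neg h0, sub_zero m]
    module
  · simp [h0]
  · simp [abs_of_pos h0, h0, not_lt.2 h0.le]

/-- Under reflection the weights `k - r` and `r` trade places, so each carries half of the constant
weight `k`, up to an end term that cancels `k • h 0`. -/
theorem two_zsmul_orientedSum_of_symm {h : ℤ → V} {k : ℤ} (hs : ∀ j, h (k - j) = h j) :
    k • h 0 + (2 : ℤ) • orientedSum (fun r => (k - r) • h r) k = k • orientedSum h k := by
  have h1 : orientedSum (fun r => (k - r) • h r) k = orientedSum (fun r => r • h r) k - k • h k := by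
    have := orientedSum_reflect (fun r => r • h r) k
    simp only [hs, zero_zsmul, add_zero] at this
    exact this
  have h2 : k • orientedSum h k =
      orientedSum (fun r => (k - r) • h r) k + orientedSum (fun r => r • h r) k := by
    rw [← orientedSum_add, zsmul_orientedSum]
    congr 1
    funext r
    module
  have h3 : h k = h 0 := by simpa using hs 0
  rw [h2, two_zsmul, h1, h3]
  abel

/-- Reconciles the weight `j` in the definition of `opY2` with the weight `k - j` that
differentiation produces. -/
theorem sum_Icc_zsmul_of_symm {h : ℤ → V} {k : ℤ} (hs : ∀ j, h (k - j) = h j) :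
    ∑ r ∈ Finset.Icc 1 (k - 1), r • h r = ∑ r ∈ Finset.Icc 1 (k - 1), (k - r) • h r :=
  Finset.sum_nbij' (fun j => k - j) (fun j => k - j)
      (fun j hj => by simp only [Finset.mem_Icc] at hj ⊢; omega)
      (fun j hj => by simp only [Finset.mem_Icc] at hj ⊢; omega)
      (fun j _ => by ring) (fun j _ => by ring) (fun j _ => by rw [hs, sub_sub_cancel])

theorem sum_Icc_neg_zsmul_of_symm {h : ℤ → V} {k : ℤ} (hs : ∀ j, h (k - j) = h j) :
    ∑ r ∈ Finset.Icc (k + 1) (-1), r • h r = ∑ r ∈ Finset.Icc (k + 1) (-1), (k - r) • h r :=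
  Finset.sum_nbij' (fun j => k - j) (fun j => k - j)
      (fun j hj => by simp only [Finset.mem_Icc] at hj ⊢; omega)
      (fun j hj => by simp only [Finset.mem_Icc] at hj ⊢; omega)
      (fun j _ => by ring) (fun j _ => by ring) (fun j _ => by rw [hs, sub_sub_cancel])

end OrientedSum

/-! ## First and second order operators -/

theorem mono_induction {p : CUV → Prop} (P : CUV) (hadd : ∀ P Q, p P → p Q → p (P + Q))
    (hmono : ∀ m q, p (mono m q)) : p P := by
  induction P using AddMonoidAlgebra.induction_linear with
  | zero => simpa using hmono 0 0
  | add P Q hP hQ => exact hadd P Q hP hQ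
  | single m q => exact hmono m q

theorem mono_mul_mono (m n : ℤ) (q r : CV) : mono m q * mono n r = mono (m + n) (q * r) :=
  AddMonoidAlgebra.single_mul_single ..

theorem mono_zero (q : CV) : mono 0 q = LaurentPolynomial.C q := rfl

theorem v_of_ne {k : ℤ} (h : k ≠ 0) : v k = mono 0 (MvPolynomial.X ⟨k, h⟩) := by
  rw [v, dif_pos h, mono_zero]

theorem v_zero : v 0 = 1 := by simp [v]

/-- The representative of `v k` in `ℂ[v]`. -/
def vPoly (k : ℤ) : CV := if h : k ≠ 0 then MvPolynomial.X ⟨k, h⟩ else 1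

theorem v_eq_mono (k : ℤ) : v k = mono 0 (vPoly k) := by
  by_cases h : k ≠ 0
  · rw [v_of_ne h, vPoly, dif_pos h]
  · rw [v, dif_neg h, vPoly, dif_neg h]
    rfl

theorem uPow_eq_mono (k : ℤ) : uPow k = mono k 1 := rfl

theorem mulOp_apply (f P : CUV) : mulOp f P = f * P := rfl

theorem du_mono (m : ℤ) (q : CV) : du (mono m q) = (m : ℂ) • mono (m - 1) q := by
  rw [du, onMono_mono]; rfl

theorem dv_mono (k : VIdx) (m : ℤ) (q : CV) :
    dv k (mono m q) = mono m (MvPolynomial.pderiv k q) := by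
  rw [dv, onMono_mono]; rfl

/-- A linear operator on `ℂ[u, u⁻¹; v]` satisfying the product rule. -/
def IsDeriv (T : Op) : Prop := ∀ f g, T (f * g) = f * T g + T f * g

theorem isDeriv_of_mono {T : Op} (h : ∀ m n q r, T (mono m q * mono n r) =
    mono m q * T (mono n r) + T (mono m q) * mono n r) : IsDeriv T := by
  intro f g
  induction f using mono_induction with
  | hadd P Q hP hQ => rw [add_mul, map_add, hP, hQ, map_add]; ring
  | hmono m q =>
    induction g using mono_induction with
    | hadd P Q hP hQ => rw [mul_add, map_add, hP, hQ, map_add]; ring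
    | hmono n r => exact h m n q r

theorem isDeriv_du : IsDeriv du := isDeriv_of_mono fun m n q r => by
  simp only [mono_mul_mono, du_mono, mul_smul_comm, smul_mul_assoc]
  rw [show m + (n - 1) = m + n - 1 by ring, show m - 1 + n = m + n - 1 by ring, ← add_smul]
  push_cast
  rw [add_comm]

theorem isDeriv_dv (k : VIdx) : IsDeriv (dv k) := isDeriv_of_mono fun m n q r => by
  simp only [mono_mul_mono, dv_mono, ← map_add, Derivation.leibniz, smul_eq_mul]
  rw [mul_comm r]

theorem IsDeriv.mulOp {T : Op} (h : IsDeriv T) (f : CUV) : IsDeriv (mulOp f * T) := fun g h' => by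
  simp only [Module.End.mul_apply, mulOp_apply, h g h']
  ring

theorem lsum_apply {ι : Type} (T : ι → Op) (h : LocFin T) (P : CUV) :
    lsum T h P = ∑ᶠ i, T i P := rfl

theorem mul_finsum_locFin {ι : Type} {T : ι → Op} (h : LocFin T) (f P : CUV) :
    f * lsum T h P = ∑ᶠ i, f * T i P := mul_finsum _ _

theorem IsDeriv.lsum {ι : Type} {T : ι → Op} (h : LocFin T) (hT : ∀ i, IsDeriv (T i)) :
    IsDeriv (lsum T h) := fun f g => by
  have h1 : (Function.support fun i => f * T i g).Finite :=
    (h g).subset fun i hi h0 => hi (by simp only [h0, mul_zero])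
  have h2 : (Function.support fun i => T i f * g).Finite :=
    (h f).subset fun i hi h0 => hi (by simp only [h0, zero_mul])
  rw [mul_finsum_locFin, lsum_apply, lsum_apply, finsum_mul _ _, ← finsum_add_distrib h1 h2]
  exact finsum_congr fun i => hT i f g

/-- The first order operator `∑ s_k ∂/∂v_k`. -/
def vField (s : VIdx → CUV) : Op := lsum _ (locFin_mul_dv fun k => mulOp (s k))

/-- The second order operator `∑ s_{j,k} ∂²/∂v_j∂v_k`. -/
def vHess (s : VIdx × VIdx → CUV) : Op := lsum _ (locFin_mul_dv_dv fun p => mulOp (s p))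

theorem isDeriv_vField (s : VIdx → CUV) : IsDeriv (vField s) :=
  IsDeriv.lsum _ fun k => (isDeriv_dv k).mulOp (s k)

theorem dv_v (j k : VIdx) : dv j (v k) = if j = k then 1 else 0 := by
  rw [v_of_ne k.2, dv_mono, MvPolynomial.pderiv_X]
  by_cases h : j = k
  · subst h; simp [mono_zero]
  · simp [h, Ne.symm h]

theorem dv_mono_one (j : VIdx) (m : ℤ) : dv j (mono m 1) = 0 := by
  rw [dv_mono, Derivation.map_one_eq_zero, map_zero]

theorem du_v (k : ℤ) : du (v k) = 0 := by
  rw [v_eq_mono, du_mono]; simp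

theorem vField_v (s : VIdx → CUV) (k : VIdx) : vField s (v k) = s k := by
  rw [vField, lsum_apply, finsum_eq_single _ k]
  · simp [dv_v, mulOp_apply]
  · intro j hj
    simp [dv_v, hj]

theorem vField_mono_one (s : VIdx → CUV) (m : ℤ) : vField s (mono m 1) = 0 := by
  simp [vField, lsum_apply, dv_mono_one]

theorem vField_v_mul (s : VIdx → CUV) (k : VIdx) (P : CUV) :
    vField s (v k * P) = v k * vField s P + s k * P := by
  rw [isDeriv_vField, vField_v]

theorem vHess_mono_one (s : VIdx × VIdx → CUV) (m : ℤ) : vHess s (mono m 1) = 0 := by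
  simp [vHess, lsum_apply, dv_mono_one]

theorem dv_v_mul (j k : VIdx) (P : CUV) :
    dv j (v k * P) = v k * dv j P + if j = k then P else 0 := by
  rw [isDeriv_dv, dv_v]
  split_ifs <;> simp

theorem finsum_pair_fst {M : Type*} [AddCommMonoid M] (f : VIdx × VIdx → M) (k : VIdx)
    (h : ∀ p, p.1 ≠ k → f p = 0) : ∑ᶠ p, f p = ∑ᶠ j, f (k, j) := by
  rw [← finsum_mem_range (g := fun j : VIdx => (k, j)) (Prod.mk_right_injective k)]
  refine finsum_congr fun p => ?_
  by_cases hp : p ∈ Set.range fun j : VIdx => (k, j)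
  · simp only [hp, finsum_true]
  · simp only [hp, finsum_false]
    exact h p fun h1 => hp ⟨p.2, by rw [← h1]⟩

theorem finsum_pair_snd {M : Type*} [AddCommMonoid M] (f : VIdx × VIdx → M) (k : VIdx)
    (h : ∀ p, p.2 ≠ k → f p = 0) : ∑ᶠ p, f p = ∑ᶠ j, f (j, k) := by
  rw [← finsum_comp_equiv (Equiv.prodComm VIdx VIdx)]
  exact finsum_pair_fst _ k fun p hp => h _ hp

/-- Either derivative may fall on `v k`, but not both, so the commutator is a pure first order
operator, with the coefficients symmetrized. -/
theorem vHess_v_mul (s : VIdx × VIdx → CUV) (k : VIdx) (P : CUV) :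
    vHess s (v k * P) = v k * vHess s P + vField (fun j => s (k, j) + s (j, k)) P := by
  have h0 : ∀ p : VIdx × VIdx, (mulOp (s p) * (dv p.1 * dv p.2)) (v k * P) =
      v k * (mulOp (s p) * (dv p.1 * dv p.2)) P +
        ((if p.1 = k then s p * dv p.2 P else 0) + (if p.2 = k then s p * dv p.1 P else 0)) := by
    intro p
    simp only [Module.End.mul_apply, mulOp_apply, dv_v_mul, map_add]
    split_ifs <;> simp only [map_zero, mul_zero, add_zero, zero_add, add_assoc,
      mul_left_comm (s p)]
  have hdv : (Function.support fun j => dv j P).Finite := by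
    have := locFin_mul_dv (fun _ => 1) P
    simpa using this
  have h1 : (Function.support fun p : VIdx × VIdx => if p.1 = k then s p * dv p.2 P else 0).Finite := by
    refine ((Set.finite_singleton k).prod hdv).subset fun p hp => ?_
    simp only [Function.mem_support, ne_eq, ite_eq_right_iff, Classical.not_imp] at hp
    exact ⟨hp.1, fun h => hp.2 (by simp only [h, mul_zero])⟩
  have h2 : (Function.support fun p : VIdx × VIdx => if p.2 = k then s p * dv p.1 P else 0).Finite := by
    refine (hdv.prod (Set.finite_singleton k)).subset fun p hp => ?_
    simp only [Function.mem_support, ne_eq, ite_eq_right_iff, Classical.not_imp] at hp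
    exact ⟨fun h => hp.2 (by simp only [h, mul_zero]), hp.1⟩
  have h3 : (Function.support fun p : VIdx × VIdx =>
      v k * (mulOp (s p) * (dv p.1 * dv p.2)) P).Finite :=
    (locFin_mul_dv_dv (fun p => mulOp (s p)) P).subset fun i hi h0 => hi (by
      simp only [h0, mul_zero])
  have h4 : ∀ t : VIdx → CUV, (Function.support fun j => t j * dv j P).Finite := fun t =>
    hdv.subset fun i hi h0 => hi (by simp only [h0, mul_zero])
  rw [vHess, mul_finsum_locFin, lsum_apply, finsum_congr h0, finsum_add_distrib h3
    ((h1.union h2).subset (Function.support_add _ _)), finsum_add_distrib h1 h2,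
    finsum_pair_fst (fun p => if p.1 = k then s p * dv p.2 P else 0) k fun p hp => if_neg hp,
    finsum_pair_snd (fun p => if p.2 = k then s p * dv p.1 P else 0) k fun p hp => if_neg hp,
    vField, lsum_apply]
  simp only [if_true]
  rw [← finsum_add_distrib (h4 _) (h4 _)]
  congr 1
  refine finsum_congr fun j => ?_
  simp only [Module.End.mul_apply, mulOp_apply, add_mul]

/-! ### The operators of the theorem in terms of `vField` and `vHess` -/

theorem opN0_eq : opN0 = vField fun k => ((|k.1| : ℤ) : ℂ) • v k := rfl

theorem opY2p_eq : opY2p = vField fun k =>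
    ∑ j ∈ Finset.Icc 1 (k.1 - 1), (j : ℂ) • (v j * v (k - j)) := rfl

theorem opY2m_eq : opY2m = vField fun k =>
    ∑ j ∈ Finset.Icc (k.1 + 1) (-1), (j : ℂ) • (v j * v (k - j)) := rfl

theorem opZ1p_eq : opZ1p = vField fun k =>
    ∑ j ∈ Finset.Icc 1 (k.1 - 1), ((k - j : ℤ) : ℂ) • v (k - 2 * j) := rfl

theorem opZ1m_eq : opZ1m = vField fun k =>
    ∑ j ∈ Finset.Icc (k.1 + 1) (-1), ((k - j : ℤ) : ℂ) • v (k - 2 * j) := rfl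

theorem opK1p_eq : opK1p = vField (fun k => (k : ℂ) • uPow (-k + 1)) * du := rfl

theorem opK1m_eq : opK1m = vField (fun k => (k : ℂ) • uPow (k + 1)) * du := rfl

theorem opK2p_eq : opK2p = vHess fun p => ((p.1 : ℂ) * (p.2 : ℂ)) • v (p.2 - p.1) := rfl

theorem opK2m_eq : opK2m = vHess fun p => ((p.1 : ℂ) * (p.2 : ℂ)) • v (p.2 + p.1) := rfl

theorem opJ_eq : opJ = (2 : ℂ) • (vField (fun k => (k : ℂ) • (uPow 1 * v k)) * du)
    + vHess (fun p => ((p.1 : ℂ) * (p.2 : ℂ)) • (v p.1 * v p.2))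
    + vField (fun k => (k : ℂ) ^ 2 • v k)
    + mulOp (uPow 2) * (du * du) + mulOp (uPow 1) * du := rfl

theorem vField_mul_du_v_mul (s : VIdx → CUV) (k : VIdx) (P : CUV) :
    (vField s * du) (v k * P) = v k * (vField s * du) P + s k * du P := by
  simp only [Module.End.mul_apply, isDeriv_du (v k), du_v, zero_mul, add_zero, vField_v_mul]

theorem vField_mul_du_mono_one (s : VIdx → CUV) (m : ℤ) : (vField s * du) (mono m 1) = 0 := by
  rw [Module.End.mul_apply, du_mono, map_smul, vField_mono_one, smul_zero]

/-! ## Operators on the powers of `u` -/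

theorem Rplus_mono (m : ℤ) (q : CV) : Rplus (mono m q) = if 0 ≤ m then mono m q else 0 := by
  rw [Rplus, onMono_mono]; split_ifs <;> rfl

theorem Rminus_mono (m : ℤ) (q : CV) : Rminus (mono m q) = if m < 0 then mono m q else 0 := by
  rw [Rminus, onMono_mono]; split_ifs <;> rfl

theorem opN1_mono (m : ℤ) (q : CV) : opN1 (mono m q) = ((|m| : ℤ) : ℂ) • mono m q := by
  simp only [opN1, Module.End.mul_apply, LinearMap.sub_apply, Rplus_mono, Rminus_mono]
  rcases lt_or_ge m 0 with h | h
  · rw [if_neg (by omega), if_pos h, zero_sub, map_neg, map_neg, du_mono, map_smul,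
      mulOp_uPow_mono, abs_of_neg h, add_sub_cancel]
    push_cast
    rw [neg_smul]
  · rw [if_pos h, if_neg (by omega), sub_zero, du_mono, map_smul,
      mulOp_uPow_mono, abs_of_nonneg h, add_sub_cancel]

/-- The outer projection removes every `k ≥ m`, since the exponent left after differentiation is `m
- k - 1`. -/
theorem lsum_plus_mono (S : ℤ → Op) (m : ℤ) (q : CV) :
    lsum _ (locFin_plus S) (mono m q) =
      ∑ k ∈ Finset.Icc 1 (m - 1), ((m - k : ℤ) : ℂ) • S k (mono (m - k - 1) q) := by
  rw [lsum_apply, finsum_eq_sum_of_support_subset (s := Finset.Icc 1 (m - 1))]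
  · refine Finset.sum_congr rfl fun k hk => ?_
    rw [Finset.mem_Icc] at hk
    rw [if_pos hk.1]
    simp only [Module.End.mul_apply, Rplus_mono, if_pos (show 0 ≤ m by omega), mulOp_uPow_mono,
      du_mono, map_smul, if_pos (show 0 ≤ -k + m - 1 by omega)]
    rw [neg_add_eq_sub]
  · intro k hk
    by_contra hkm
    rw [Finset.coe_Icc, Set.mem_Icc, not_and_or] at hkm
    refine hk ?_
    by_cases h1 : 1 ≤ k
    · have h2 : ¬ k < m := by omega
      by_cases h3 : 0 ≤ m <;>
        simp [h1, h2, h3, Rplus, du, onMono_mono, mulOp_uPow_mono]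
    · simp [h1]

theorem lsum_minus_mono (S : ℤ → Op) (m : ℤ) (q : CV) :
    lsum _ (locFin_minus S) (mono m q) =
      ∑ k ∈ Finset.Icc (m + 1) (-1), ((m - k : ℤ) : ℂ) • S k (mono (m - k - 1) q) := by
  rw [lsum_apply, finsum_eq_sum_of_support_subset (s := Finset.Icc (m + 1) (-1))]
  · refine Finset.sum_congr rfl fun k hk => ?_
    rw [Finset.mem_Icc] at hk
    rw [if_pos hk.2]
    simp only [Module.End.mul_apply, Rminus_mono, if_pos (show m < 0 by omega), mulOp_uPow_mono,
      du_mono, map_smul, if_pos (show -k + m - 1 < 0 by omega)]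
    rw [neg_add_eq_sub]
  · intro k hk
    by_contra hkm
    rw [Finset.coe_Icc, Set.mem_Icc, not_and_or] at hkm
    refine hk ?_
    by_cases h1 : k ≤ -1
    · by_cases h3 : m < 0
      -- For `k = m` the exponent is -1, which `Rminus` keeps; this term vanishes because the
      -- derivative contributes the factor `m - k = 0`.
      · rcases eq_or_ne k m with rfl | h4
        · simp [h1, h3, Rminus, du, onMono_mono, mulOp_uPow_mono]
        · have h2 : ¬ (-k + m - 1 < 0) := by omega
          simp [h1, h2, h3, Rminus, du, onMono_mono, mulOp_uPow_mono]
      · simp [h1, h3, Rminus, onMono_mono]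
    · simp [h1]

theorem v_mul_mono (k m : ℤ) (q : CV) : v k * mono m q = mono m (vPoly k * q) := by
  rw [v_eq_mono, mono_mul_mono, zero_add]

theorem uPow_mul_mono (k m : ℤ) (q : CV) : uPow k * mono m q = mono (k + m) q := by
  rw [uPow_eq_mono, mono_mul_mono, one_mul]

theorem opY1p_mono (m : ℤ) (q : CV) : opY1p (mono m q) =
    ∑ k ∈ Finset.Icc 1 (m - 1), ((m - k : ℤ) : ℂ) • mono (m - k) (vPoly k * q) := by
  rw [opY1p, lsum_plus_mono]
  refine Finset.sum_congr rfl fun k _ => ?_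
  rw [mulOp_apply, mul_assoc, uPow_mul_mono, v_mul_mono, add_sub_cancel]

theorem opY1m_mono (m : ℤ) (q : CV) : opY1m (mono m q) =
    ∑ k ∈ Finset.Icc (m + 1) (-1), ((m - k : ℤ) : ℂ) • mono (m - k) (vPoly k * q) := by
  rw [opY1m, lsum_minus_mono]
  refine Finset.sum_congr rfl fun k _ => ?_
  rw [mulOp_apply, mul_assoc, uPow_mul_mono, v_mul_mono, add_sub_cancel]

theorem opZ2p_mono (m : ℤ) (q : CV) : opZ2p (mono m q) =
    ∑ k ∈ Finset.Icc 1 (m - 1), ((m - k : ℤ) : ℂ) • mono (m - 2 * k) q := by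
  rw [opZ2p, lsum_plus_mono]
  refine Finset.sum_congr rfl fun k _ => ?_
  rw [mulOp_apply, uPow_mul_mono, show -k + 1 + (m - k - 1) = m - 2 * k by ring]

theorem opZ2m_mono (m : ℤ) (q : CV) : opZ2m (mono m q) =
    ∑ k ∈ Finset.Icc (m + 1) (-1), ((m - k : ℤ) : ℂ) • mono (m - 2 * k) q := by
  rw [opZ2m, lsum_minus_mono]
  refine Finset.sum_congr rfl fun k _ => ?_
  rw [mulOp_apply, uPow_mul_mono, show -k + 1 + (m - k - 1) = m - 2 * k by ring]

/-- Operators commuting with the multiplications by the `v_k`. -/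
def CommV (T : Op) : Prop := ∀ k P, T (v k * P) = v k * T P

theorem commV_of_mono {T : Op} (h : ∀ k m q, T (mono m (vPoly k * q)) = v k * T (mono m q)) :
    CommV T := fun k P => by
  induction P using mono_induction with
  | hadd P Q hP hQ => rw [mul_add, map_add, hP, hQ, map_add, mul_add]
  | hmono m q => rw [v_mul_mono, h]

theorem commV_opN1 : CommV opN1 := commV_of_mono fun k m q => by
  rw [opN1_mono, opN1_mono, mul_smul_comm, v_mul_mono]

theorem commV_opY1p : CommV opY1p := commV_of_mono fun k m q => by
  simp only [opY1p_mono, Finset.mul_sum, mul_smul_comm, v_mul_mono, mul_left_comm]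

theorem commV_opY1m : CommV opY1m := commV_of_mono fun k m q => by
  simp only [opY1m_mono, Finset.mul_sum, mul_smul_comm, v_mul_mono, mul_left_comm]

theorem commV_opZ2p : CommV opZ2p := commV_of_mono fun k m q => by
  simp only [opZ2p_mono, Finset.mul_sum, mul_smul_comm, v_mul_mono]

theorem commV_opZ2m : CommV opZ2m := commV_of_mono fun k m q => by
  simp only [opZ2m_mono, Finset.mul_sum, mul_smul_comm, v_mul_mono]

theorem commV_mulOp_mul_du (f : CUV) : CommV (mulOp f * du) := fun k P => by
  simp only [Module.End.mul_apply, mulOp_apply, isDeriv_du (v k), du_v, zero_mul, add_zero]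
  exact mul_left_comm _ _ _

theorem commV_mulOp_mul_du_mul_du (f : CUV) : CommV (mulOp f * (du * du)) := fun k P => by
  simp only [Module.End.mul_apply, mulOp_apply, isDeriv_du (v k), du_v, zero_mul, add_zero]
  exact mul_left_comm _ _ _

/-! ## The orders of the operators -/

section DiffOp

variable {A : Type} [CommRing A] [Algebra ℂ A]

/-- The commutator of `T` with the multiplication by `f`. -/
def commMul (T : A →ₗ[ℂ] A) (f : A) : A →ₗ[ℂ] A :=
  T ∘ₗ LinearMap.mulLeft ℂ f - LinearMap.mulLeft ℂ f ∘ₗ T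

theorem commMul_apply (T : A →ₗ[ℂ] A) (f g : A) : commMul T f g = T (f * g) - f * T g := rfl

theorem isDiffOp_zero_iff {T : A →ₗ[ℂ] A} : IsDiffOp 0 T ↔ ∀ f, commMul T f = 0 :=
  forall_congr' fun _ => sub_eq_zero.symm

theorem isDiffOp_succ_iff {n : ℕ} {T : A →ₗ[ℂ] A} :
    IsDiffOp (n + 1) T ↔ ∀ f, IsDiffOp n (commMul T f) := Iff.rfl

theorem isDiffOp_zero_op (n : ℕ) : IsDiffOp n (0 : A →ₗ[ℂ] A) := by
  induction n with
  | zero => exact isDiffOp_zero_iff.2 fun f => by ext; simp [commMul_apply]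
  | succ n ih =>
    refine isDiffOp_succ_iff.2 fun f => ?_
    rwa [show commMul (0 : A →ₗ[ℂ] A) f = 0 by ext; simp [commMul_apply]]

theorem IsDiffOp.succ {n : ℕ} {T : A →ₗ[ℂ] A} (h : IsDiffOp n T) : IsDiffOp (n + 1) T := by
  induction n generalizing T with
  | zero =>
    refine isDiffOp_succ_iff.2 fun f => ?_
    rw [isDiffOp_zero_iff.1 h f]
    exact isDiffOp_zero_op 0
  | succ n ih => exact isDiffOp_succ_iff.2 fun f => ih (isDiffOp_succ_iff.1 h f)

theorem IsDiffOp.of_le {m n : ℕ} (hmn : m ≤ n) {T : A →ₗ[ℂ] A} (h : IsDiffOp m T) :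
    IsDiffOp n T := by
  induction hmn with
  | refl => exact h
  | step _ ih => exact ih.succ

theorem IsDiffOp.add {n : ℕ} {S T : A →ₗ[ℂ] A} (hS : IsDiffOp n S) (hT : IsDiffOp n T) :
    IsDiffOp n (S + T) := by
  have h : ∀ (S T : A →ₗ[ℂ] A) f, commMul (S + T) f = commMul S f + commMul T f := fun S T f => by
    ext; simp only [commMul_apply, LinearMap.add_apply]; ring
  induction n generalizing S T with
  | zero =>
    refine isDiffOp_zero_iff.2 fun f => ?_
    rw [h, isDiffOp_zero_iff.1 hS, isDiffOp_zero_iff.1 hT, add_zero]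
  | succ n ih => exact isDiffOp_succ_iff.2 fun f => by rw [h]; exact ih (hS f) (hT f)

theorem IsDiffOp.smul {n : ℕ} {T : A →ₗ[ℂ] A} (c : ℂ) (hT : IsDiffOp n T) :
    IsDiffOp n (c • T) := by
  have h : ∀ (T : A →ₗ[ℂ] A) f, commMul (c • T) f = c • commMul T f := fun T f => by
    ext; simp only [commMul_apply, LinearMap.smul_apply, mul_smul_comm, smul_sub]
  induction n generalizing T with
  | zero => exact isDiffOp_zero_iff.2 fun f => by rw [h, isDiffOp_zero_iff.1 hT, smul_zero]
  | succ n ih => exact isDiffOp_succ_iff.2 fun f => by rw [h]; exact ih (hT f)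

theorem IsDiffOp.sub {n : ℕ} {S T : A →ₗ[ℂ] A} (hS : IsDiffOp n S) (hT : IsDiffOp n T) :
    IsDiffOp n (S - T) := by
  have := hS.add (hT.smul (-1))
  rwa [show (-1 : ℂ) • T = -T from neg_one_smul ℂ T, ← show S - T = S + -T from sub_eq_add_neg S T] at this

theorem IsDiffOp.neg {n : ℕ} {T : A →ₗ[ℂ] A} (hT : IsDiffOp n T) : IsDiffOp n (-T) := by
  have := hT.smul (-1)
  rwa [show (-1 : ℂ) • T = -T from neg_one_smul ℂ T] at this

theorem isDiffOp_mulLeft (f : A) : IsDiffOp 0 (LinearMap.mulLeft ℂ f) :=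
  isDiffOp_zero_iff.2 fun g => by
    ext
    simp only [commMul_apply, LinearMap.mulLeft_apply, LinearMap.zero_apply]
    ring

theorem IsDiffOp.mulLeft_comp {n : ℕ} {T : A →ₗ[ℂ] A} (f : A) (hT : IsDiffOp n T) :
    IsDiffOp n (LinearMap.mulLeft ℂ f ∘ₗ T) := by
  have h : ∀ (T : A →ₗ[ℂ] A) g, commMul (LinearMap.mulLeft ℂ f ∘ₗ T) g =
      LinearMap.mulLeft ℂ f ∘ₗ commMul T g := fun T g => by
    ext; simp only [commMul_apply, LinearMap.comp_apply, LinearMap.mulLeft_apply]; ring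
  induction n generalizing T with
  | zero =>
    refine isDiffOp_zero_iff.2 fun g => ?_
    rw [h, isDiffOp_zero_iff.1 hT, LinearMap.comp_zero]
  | succ n ih => exact isDiffOp_succ_iff.2 fun g => by rw [h]; exact ih (hT g)

/-- By the product rule, the commutator of `T` with `f` is multiplication by `T f`. -/
theorem isDiffOp_one_of_leibniz {T : A →ₗ[ℂ] A} (h : ∀ f g, T (f * g) = f * T g + T f * g) :
    IsDiffOp 1 T := isDiffOp_succ_iff.2 fun f => by
  rw [show commMul T f = LinearMap.mulLeft ℂ (T f) by
    ext g; simp only [commMul_apply, LinearMap.mulLeft_apply, h]; ring]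
  exact isDiffOp_mulLeft _

/-- The commutator with `f` is `S (T f) + (S f) T + (T f) S`, a first order operator. -/
theorem isDiffOp_two_comp {S T : A →ₗ[ℂ] A} (hS : ∀ f g, S (f * g) = f * S g + S f * g)
    (hT : ∀ f g, T (f * g) = f * T g + T f * g) : IsDiffOp 2 (S ∘ₗ T) :=
  isDiffOp_succ_iff.2 fun f => by
  rw [show commMul (S ∘ₗ T) f = LinearMap.mulLeft ℂ (S (T f)) + LinearMap.mulLeft ℂ (S f) ∘ₗ T +
      LinearMap.mulLeft ℂ (T f) ∘ₗ S by
    ext g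
    simp only [commMul_apply, LinearMap.mulLeft_apply, LinearMap.comp_apply, hS, hT, map_add,
      LinearMap.add_apply]
    ring]
  exact (((isDiffOp_mulLeft _).succ).add ((isDiffOp_one_of_leibniz hT).mulLeft_comp _)).add
    ((isDiffOp_one_of_leibniz hS).mulLeft_comp _)

end DiffOp

/-- Taking commutators preserves local finiteness and passes through the sum, so the order is
controlled term by term. -/
theorem isDiffOp_lsum {ι : Type} {n : ℕ} {T : ι → Op} (h : LocFin T)
    (hT : ∀ i, IsDiffOp n (T i)) : IsDiffOp n (lsum T h) := by
  have hl : ∀ (T : ι → Op), LocFin T → ∀ f, LocFin fun i => commMul (T i) f := fun T h f P => by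
    refine ((h (f * P)).union (h P)).subset fun i hi => ?_
    by_contra h0
    rw [Set.mem_union, not_or, Function.notMem_support, Function.notMem_support] at h0
    refine hi ?_
    simp only [commMul_apply, h0.1, h0.2, mul_zero, sub_zero]
  have hc : ∀ (T : ι → Op) (h : LocFin T) (f : CUV),
      commMul (lsum T h) f = lsum (fun i => commMul (T i) f) (hl T h f) := fun T h f => by
    refine LinearMap.ext fun P => ?_
    have h1 : (Function.support fun i => f * T i P).Finite :=
      (h P).subset fun i hi h0 => hi (by simp only [h0, mul_zero])
    rw [commMul_apply, mul_finsum_locFin, lsum_apply, lsum_apply, ← finsum_sub_distrib (h _) h1]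
    rfl
  induction n generalizing T with
  | zero =>
    refine isDiffOp_zero_iff.2 fun f => ?_
    rw [hc]
    refine LinearMap.ext fun P => ?_
    rw [lsum_apply, LinearMap.zero_apply]
    simp only [isDiffOp_zero_iff.1 (hT _), LinearMap.zero_apply, finsum_zero]
  | succ n ih => exact isDiffOp_succ_iff.2 fun f => by rw [hc]; exact ih _ fun i => hT i f

theorem isDiffOp_vField (s : VIdx → CUV) : IsDiffOp 1 (vField s) :=
  isDiffOp_one_of_leibniz (isDeriv_vField s)

theorem isDiffOp_vField_mul_du (s : VIdx → CUV) : IsDiffOp 2 (vField s * du) :=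
  isDiffOp_two_comp (isDeriv_vField s) isDeriv_du

theorem isDiffOp_vHess (s : VIdx × VIdx → CUV) : IsDiffOp 2 (vHess s) :=
  isDiffOp_lsum _ fun p => (isDiffOp_two_comp (isDeriv_dv p.1) (isDeriv_dv p.2)).mulLeft_comp (s p)

theorem isDiffOp_opK1p : IsDiffOp 2 opK1p := by
  rw [opK1p_eq]
  exact isDiffOp_vField_mul_du _

theorem isDiffOp_opK1m : IsDiffOp 2 opK1m := by
  rw [opK1m_eq]
  exact isDiffOp_vField_mul_du _

theorem isDiffOp_opK2p : IsDiffOp 2 opK2p := isDiffOp_vHess _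

theorem isDiffOp_opK2m : IsDiffOp 2 opK2m := isDiffOp_vHess _

theorem isDiffOp_opJ : IsDiffOp 2 opJ := by
  rw [opJ_eq]
  exact (((((isDiffOp_vField_mul_du _).smul 2).add (isDiffOp_vHess _)).add
    (isDiffOp_vField _).succ).add ((isDiffOp_two_comp isDeriv_du isDeriv_du).mulLeft_comp _)).add
    ((isDiffOp_one_of_leibniz isDeriv_du).mulLeft_comp _).succ

theorem isDiffOp_L2 (β : Beta) : IsDiffOp 2 (L2 β) := by
  have h : IsDiffOp 2 ((2 : ℂ) • opK1 + opK2) :=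
    ((isDiffOp_opK1p.sub isDiffOp_opK1m).smul 2).add (isDiffOp_opK2p.sub isDiffOp_opK2m)
  cases β with
  | one => exact h
  | two => exact ((isDiffOp_opK1m.smul 2).neg.sub isDiffOp_opK2m).add isDiffOp_opJ
  | four => exact h.smul _

/-! ### Pseudodifferential operators and their symbols -/

theorem IsPseudoDiffOp.add {n : ℕ} {S T : Op} (hS : IsPseudoDiffOp n S) (hT : IsPseudoDiffOp n T) :
    IsPseudoDiffOp n (S + T) := fun s => by
  obtain ⟨p, p', h1, h2, h3⟩ := hS s
  obtain ⟨r, r', h4, h5, h6⟩ := hT s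
  refine ⟨p + r, p' + r', fun i hi => ⟨(h1 i hi).1.add (h4 i hi).1, (h1 i hi).2.add (h4 i hi).2⟩,
    ?_, ?_⟩
  · filter_upwards [h2, h5] with m hm hm' q
    rw [LinearMap.add_apply, AddMonoidAlgebra.coeff_add, Finsupp.add_apply, hm, hm',
      ← Finset.sum_add_distrib]
    simp only [Pi.add_apply, LinearMap.add_apply, smul_add]
  · filter_upwards [h3, h6] with m hm hm' q
    rw [LinearMap.add_apply, AddMonoidAlgebra.coeff_add, Finsupp.add_apply, hm, hm',
      ← Finset.sum_add_distrib]
    simp only [Pi.add_apply, LinearMap.add_apply, smul_add]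

theorem IsPseudoDiffOp.smul {n : ℕ} {T : Op} (c : ℂ) (hT : IsPseudoDiffOp n T) :
    IsPseudoDiffOp n (c • T) := fun s => by
  obtain ⟨p, p', h1, h2, h3⟩ := hT s
  refine ⟨c • p, c • p', fun i hi => ⟨(h1 i hi).1.smul c, (h1 i hi).2.smul c⟩, ?_, ?_⟩
  · filter_upwards [h2] with m hm q
    rw [LinearMap.smul_apply, AddMonoidAlgebra.coeff_smul, Finsupp.smul_apply, hm, Finset.smul_sum]
    simp only [Pi.smul_apply, LinearMap.smul_apply, smul_comm c]
  · filter_upwards [h3] with m hm q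
    rw [LinearMap.smul_apply, AddMonoidAlgebra.coeff_smul, Finsupp.smul_apply, hm, Finset.smul_sum]
    simp only [Pi.smul_apply, LinearMap.smul_apply, smul_comm c]

theorem IsPseudoDiffOp.sub {n : ℕ} {S T : Op} (hS : IsPseudoDiffOp n S) (hT : IsPseudoDiffOp n T) :
    IsPseudoDiffOp n (S - T) := by
  have := hS.add (hT.smul (-1))
  rwa [show (-1 : ℂ) • T = -T from neg_one_smul ℂ T, ← show S - T = S + -T from sub_eq_add_neg S T] at this

theorem IsPseudoDiffOp.neg {n : ℕ} {T : Op} (hT : IsPseudoDiffOp n T) :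
    IsPseudoDiffOp n (-T) := by
  have := hT.smul (-1)
  rwa [show (-1 : ℂ) • T = -T from neg_one_smul ℂ T] at this

theorem coeff_mono (m k : ℤ) (q : CV) : (mono m q).coeff k = if m = k then q else 0 :=
  Finsupp.single_apply

/-- An operator is pseudodifferential of order one if its components are eventually affine in the
exponent of `u`, with coefficients acting by multiplication. -/
theorem isPseudoDiffOp_one_of_affine {T : Op}
    (h : ∀ s : ℤ, ∃ a b a' b' : CV,
      (∀ᶠ m : ℤ in Filter.atTop, ∀ q, (T (mono m q)).coeff (m + s) = (a + (m : ℂ) • b) * q) ∧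
      (∀ᶠ m : ℤ in Filter.atBot, ∀ q, (T (mono m q)).coeff (m + s) = (a' + (m : ℂ) • b') * q)) :
    IsPseudoDiffOp 1 T := fun s => by
  obtain ⟨a, b, a', b', h1, h2⟩ := h s
  refine ⟨fun i => LinearMap.mulLeft ℂ (if i = 0 then a else b),
    fun i => LinearMap.mulLeft ℂ (if i = 0 then a' else b'),
    fun i _ => ⟨(isDiffOp_mulLeft _).of_le (Nat.zero_le _), (isDiffOp_mulLeft _).of_le (Nat.zero_le _)⟩,
    ?_, ?_⟩
  · filter_upwards [h1] with m hm q
    rw [hm]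
    simp [Finset.sum_range_succ, add_mul]
  · filter_upwards [h2] with m hm q
    rw [hm]
    simp [Finset.sum_range_succ, add_mul]

theorem isPseudoDiffOp_opN1 : IsPseudoDiffOp 1 opN1 := isPseudoDiffOp_one_of_affine fun s => by
  refine ⟨0, if s = 0 then 1 else 0, 0, if s = 0 then -1 else 0, ?_, ?_⟩
  · filter_upwards [Filter.eventually_ge_atTop 0] with m hm q
    rw [opN1_mono, AddMonoidAlgebra.coeff_smul, Finsupp.smul_apply, coeff_mono, abs_of_nonneg hm]
    by_cases hs : s = 0 <;> simp [hs]
  · filter_upwards [Filter.eventually_le_atBot 0] with m hm q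
    rw [opN1_mono, AddMonoidAlgebra.coeff_smul, Finsupp.smul_apply, coeff_mono, abs_of_nonpos hm]
    by_cases hs : s = 0 <;> simp [hs]

/-- At most one `k` contributes to the coefficient of `u^(m+s)`, as `c ≠ 0`. Once `m` exceeds that
`k` the contribution is `(m - k) w_k q`, which is affine in `m`; for `m ≤ 0` the sum is empty. -/
theorem isPseudoDiffOp_of_sum_pos {T : Op} (c : ℤ) (hc : c ≠ 0) (w : ℤ → CV)
    (hT : ∀ m q, T (mono m q) =
      ∑ k ∈ Finset.Icc 1 (m - 1), ((m - k : ℤ) : ℂ) • mono (m - c * k) (w k * q)) :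
    IsPseudoDiffOp 1 T := isPseudoDiffOp_one_of_affine fun s => by
  have hcoef : ∀ m q, (T (mono m q)).coeff (m + s) =
      ∑ k ∈ Finset.Icc 1 (m - 1), if -(c * k) = s then ((m - k : ℤ) : ℂ) • (w k * q) else 0 := by
    intro m q
    rw [hT, AddMonoidAlgebra.coeff_sum, Finsupp.finsetSum_apply]
    refine Finset.sum_congr rfl fun k _ => ?_
    rw [AddMonoidAlgebra.coeff_smul, Finsupp.smul_apply, coeff_mono]
    simp only [sub_eq_add_neg, add_right_inj, smul_ite, smul_zero]
  by_cases hk : ∃ k : ℤ, 1 ≤ k ∧ -(c * k) = s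
  · obtain ⟨k, hk1, rfl⟩ := hk
    -- The constant and linear parts of `(m - k) w_k`; the symbol at negative infinity is zero.
    refine ⟨-(k : ℂ) • w k, w k, 0, 0, ?_, ?_⟩
    · filter_upwards [Filter.eventually_ge_atTop (k + 1)] with m hm q
      rw [hcoef, Finset.sum_eq_single k]
      · rw [if_pos rfl, ← smul_mul_assoc]
        congr 1
        push_cast
        module
      · intro j _ hj
        rw [if_neg]
        intro h
        exact hj (mul_left_cancel₀ hc (neg_injective h))
      · intro h
        exact absurd (Finset.mem_Icc.2 ⟨hk1, by omega⟩) h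
    · filter_upwards [Filter.eventually_le_atBot 0] with m hm q
      rw [hcoef, Finset.Icc_eq_empty (by omega)]
      simp
  · refine ⟨0, 0, 0, 0, Filter.Eventually.of_forall fun m q => ?_,
      Filter.Eventually.of_forall fun m q => ?_⟩ <;>
    · rw [hcoef, Finset.sum_eq_zero]
      · simp
      · intro k hk'
        exact if_neg fun h => hk ⟨k, (Finset.mem_Icc.1 hk').1, h⟩

theorem isPseudoDiffOp_of_sum_neg {T : Op} (c : ℤ) (hc : c ≠ 0) (w : ℤ → CV)
    (hT : ∀ m q, T (mono m q) =
      ∑ k ∈ Finset.Icc (m + 1) (-1), ((m - k : ℤ) : ℂ) • mono (m - c * k) (w k * q)) :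
    IsPseudoDiffOp 1 T := isPseudoDiffOp_one_of_affine fun s => by
  have hcoef : ∀ m q, (T (mono m q)).coeff (m + s) =
      ∑ k ∈ Finset.Icc (m + 1) (-1),
        if -(c * k) = s then ((m - k : ℤ) : ℂ) • (w k * q) else 0 := by
    intro m q
    rw [hT, AddMonoidAlgebra.coeff_sum, Finsupp.finsetSum_apply]
    refine Finset.sum_congr rfl fun k _ => ?_
    rw [AddMonoidAlgebra.coeff_smul, Finsupp.smul_apply, coeff_mono]
    simp only [sub_eq_add_neg, add_right_inj, smul_ite, smul_zero]
  by_cases hk : ∃ k : ℤ, k ≤ -1 ∧ -(c * k) = s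
  · obtain ⟨k, hk1, rfl⟩ := hk
    refine ⟨0, 0, -(k : ℂ) • w k, w k, ?_, ?_⟩
    · filter_upwards [Filter.eventually_ge_atTop 0] with m hm q
      rw [hcoef, Finset.Icc_eq_empty (by omega)]
      simp
    · filter_upwards [Filter.eventually_le_atBot (k - 1)] with m hm q
      rw [hcoef, Finset.sum_eq_single k]
      · rw [if_pos rfl, ← smul_mul_assoc]
        congr 1
        push_cast
        module
      · intro j _ hj
        rw [if_neg]
        intro h
        exact hj (mul_left_cancel₀ hc (neg_injective h))
      · intro h
        exact absurd (Finset.mem_Icc.2 ⟨by omega, hk1⟩) h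
  · refine ⟨0, 0, 0, 0, Filter.Eventually.of_forall fun m q => ?_,
      Filter.Eventually.of_forall fun m q => ?_⟩ <;>
    · rw [hcoef, Finset.sum_eq_zero]
      · simp
      · intro k hk'
        exact if_neg fun h => hk ⟨k, (Finset.mem_Icc.1 hk').2, h⟩

theorem isPseudoDiffOp_opY1 : IsPseudoDiffOp 1 opY1 :=
  (isPseudoDiffOp_of_sum_pos 1 one_ne_zero vPoly fun m q => by simp only [one_mul, opY1p_mono]).sub
    (isPseudoDiffOp_of_sum_neg 1 one_ne_zero vPoly fun m q => by simp only [one_mul, opY1m_mono])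

theorem isPseudoDiffOp_opZ2 : IsPseudoDiffOp 1 opZ2 :=
  (isPseudoDiffOp_of_sum_pos 2 two_ne_zero 1 fun m q => by
    simp only [Pi.one_apply, one_mul, opZ2p_mono]).sub
    (isPseudoDiffOp_of_sum_neg 2 two_ne_zero 1 fun m q => by
      simp only [Pi.one_apply, one_mul, opZ2m_mono])

/-- The component `q ↦ (coefficient of u^s in T q)` of an operator. -/
def component (T : Op) (s : ℤ) : CV →ₗ[ℂ] CV where
  toFun q := (T (mono 0 q)).coeff s
  map_add' q r := by simp only [map_add, AddMonoidAlgebra.coeff_add, Finsupp.add_apply]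
  map_smul' c q := by
    simp only [map_smul, AddMonoidAlgebra.coeff_smul, Finsupp.smul_apply, RingHom.id_apply]

theorem component_apply (T : Op) (s : ℤ) (q : CV) :
    component T s q = (T (mono 0 q)).coeff s := rfl

theorem coeff_mono_zero_mul (f : CV) (P : CUV) (s : ℤ) :
    (mono 0 f * P).coeff s = f * P.coeff s := by
  induction P using mono_induction with
  | hadd P Q hP hQ =>
    rw [mul_add, AddMonoidAlgebra.coeff_add, Finsupp.add_apply, hP, hQ,
      AddMonoidAlgebra.coeff_add, Finsupp.add_apply, mul_add]
  | hmono m q =>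
    rw [mono_mul_mono, zero_add, coeff_mono, coeff_mono, mul_ite, mul_zero]

/-- Extracting a coefficient of `u` commutes with multiplication by elements free of `u`, so
commutators of a component are components of commutators. -/
theorem IsDiffOp.component {n : ℕ} {T : Op} (hT : IsDiffOp n T) (s : ℤ) :
    IsDiffOp n (component T s) := by
  have h : ∀ (T : Op) f, commMul (TracePoly.component T s) f =
      TracePoly.component (commMul T (mono 0 f)) s := fun T f => by
    refine LinearMap.ext fun q => ?_
    simp only [commMul_apply, component_apply, mono_mul_mono, zero_add,
      AddMonoidAlgebra.coeff_sub, Finsupp.sub_apply, coeff_mono_zero_mul]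
  induction n generalizing T with
  | zero =>
    refine isDiffOp_zero_iff.2 fun f => ?_
    rw [h, isDiffOp_zero_iff.1 hT]
    rfl
  | succ n ih => exact isDiffOp_succ_iff.2 fun f => by rw [h]; exact ih (hT _)

theorem coeff_mono_one_mul (m s : ℤ) (P : CUV) :
    (mono m 1 * P).coeff (m + s) = P.coeff s := by
  induction P using mono_induction with
  | hadd P Q hP hQ =>
    rw [mul_add, AddMonoidAlgebra.coeff_add, Finsupp.add_apply, hP, hQ,
      AddMonoidAlgebra.coeff_add, Finsupp.add_apply]
  | hmono n q =>
    rw [mono_mul_mono, one_mul, coeff_mono, coeff_mono]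
    simp only [add_right_inj]

/-- A `vField` annihilates `u^m`, so its symbol does not depend on `m`: the constant term is a first
order operator and the linear term is zero. -/
theorem isPseudoDiffOp_vField (s : VIdx → CUV) : IsPseudoDiffOp 1 (vField s) := fun k => by
  have h : ∀ m q, ((vField s) (mono m q)).coeff (m + k) = component (vField s) k q := by
    intro m q
    have h1 : mono m q = mono m 1 * mono 0 q := by rw [mono_mul_mono, add_zero, one_mul]
    rw [h1, isDeriv_vField, vField_mono_one, zero_mul, add_zero, coeff_mono_one_mul,
      component_apply]
  refine ⟨fun i => if i = 0 then component (vField s) k else 0,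
    fun i => if i = 0 then component (vField s) k else 0, fun i _ => ?_,
    Filter.Eventually.of_forall fun m q => ?_, Filter.Eventually.of_forall fun m q => ?_⟩
  · by_cases hi : i = 0
    · subst hi
      exact ⟨(isDiffOp_vField s).component k, (isDiffOp_vField s).component k⟩
    · simp only [if_neg hi]
      exact ⟨isDiffOp_zero_op _, isDiffOp_zero_op _⟩
  · simp [h, Finset.sum_range_succ]
  · simp [h, Finset.sum_range_succ]

theorem isPseudoDiffOp_opN : IsPseudoDiffOp 1 opN :=
  (isPseudoDiffOp_vField _).add isPseudoDiffOp_opN1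

theorem isPseudoDiffOp_L0 : IsPseudoDiffOp 1 L0 :=
  (isPseudoDiffOp_opN.neg.sub (isPseudoDiffOp_opY1.smul 2)).sub
    (((isPseudoDiffOp_vField _).sub (isPseudoDiffOp_vField _)).smul 2)

theorem isPseudoDiffOp_L1 (β : Beta) : IsPseudoDiffOp 1 (L1 β) := by
  have h : IsPseudoDiffOp 1 (opN + (2 : ℂ) • opZ1 + (2 : ℂ) • opZ2) :=
    (isPseudoDiffOp_opN.add (((isPseudoDiffOp_vField _).sub (isPseudoDiffOp_vField _)).smul 2)).add
      (isPseudoDiffOp_opZ2.smul 2)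
  cases β with
  | one => exact h
  | two =>
    have := h.smul 0
    rwa [zero_smul] at this
  | four => exact h.smul _

/-! ## Exponentials of locally finite operators -/

/-- In coordinates this is the matrix exponential; a linear functional on matrices is automatically
continuous and may be applied termwise. -/
theorem exists_exp_of_finiteDimensional {W : Type*} [AddCommGroup W] [Module ℂ W]
    [FiniteDimensional ℂ W] (T : Module.End ℂ W) :
    ∃ E : Module.End ℂ W, ∀ (φ : W →ₗ[ℂ] ℂ) (w : W),
      HasSum (fun n : ℕ => ((n.factorial : ℂ)⁻¹) * φ ((T ^ n) w)) (φ (E w)) := by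
  set e := LinearMap.toMatrixAlgEquiv (Module.finBasis ℂ W)
  refine ⟨e.symm (NormedSpace.exp (e T)), fun φ w => ?_⟩
  open scoped Matrix.Norms.Operator in
  have h := NormedSpace.exp_series_hasSum_exp' (𝕂 := ℂ) (e T)
  set L : Matrix _ _ ℂ →ₗ[ℂ] ℂ :=
    φ ∘ₗ LinearMap.applyₗ w ∘ₗ e.symm.toLinearEquiv.toLinearMap with hL
  open scoped Matrix.Norms.Operator in
  have h2 := h.mapL (LinearMap.toContinuousLinearMap L)
  have h3 : ∀ n : ℕ, L (((n.factorial : ℂ)⁻¹) • (e T) ^ n) =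
      ((n.factorial : ℂ)⁻¹) * φ ((T ^ n) w) := fun n => by
    rw [map_smul, smul_eq_mul, ← map_pow]
    simp [hL]
  simp only [← h3]
  exact h2

/-- `E P` is chosen separately for each `P` inside some invariant subspace. Since functionals
separate points and limits are unique, the value does not depend on the choice and is linear in `P`.
-/
theorem exists_exp_of_locallyFinite {V : Type*} [AddCommGroup V] [Module ℂ V]
    (T : Module.End ℂ V)
    (hT : ∀ P, ∃ W : Submodule ℂ V, FiniteDimensional ℂ W ∧ P ∈ W ∧ ∀ Q ∈ W, T Q ∈ W) :
    ∃ E : Module.End ℂ V,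
      (∀ P, ∃ W : Submodule ℂ V, FiniteDimensional ℂ W ∧ P ∈ W ∧ E P ∈ W ∧ ∀ Q ∈ W, T Q ∈ W) ∧
      ∀ (φ : V →ₗ[ℂ] ℂ) (P : V),
        HasSum (fun n : ℕ => ((n.factorial : ℂ)⁻¹) * φ ((T ^ n) P)) (φ (E P)) := by
  have h : ∀ P, ∃ R, (∃ W : Submodule ℂ V, FiniteDimensional ℂ W ∧ P ∈ W ∧ R ∈ W ∧
      ∀ Q ∈ W, T Q ∈ W) ∧ ∀ φ : V →ₗ[ℂ] ℂ,
        HasSum (fun n : ℕ => ((n.factorial : ℂ)⁻¹) * φ ((T ^ n) P)) (φ R) := fun P => by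
    obtain ⟨W, hW, hP, hinv⟩ := hT P
    obtain ⟨E, hE⟩ := exists_exp_of_finiteDimensional (T.restrict hinv)
    refine ⟨E ⟨P, hP⟩, ⟨W, hW, hP, (E _).2, hinv⟩, fun φ => ?_⟩
    have h1 := hE (φ ∘ₗ W.subtype) ⟨P, hP⟩
    have h2 : ∀ n : ℕ, (φ ∘ₗ W.subtype) ((T.restrict hinv ^ n) ⟨P, hP⟩) = φ ((T ^ n) P) := fun n => by
      rw [Module.End.pow_restrict]
      rfl
    simp only [h2] at h1
    exact h1
  choose E hW hE using h
  have hext : ∀ x y : V, (∀ φ : V →ₗ[ℂ] ℂ, φ x = φ y) → x = y := fun x y hxy =>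
    sub_eq_zero.1 ((Module.forall_dual_apply_eq_zero_iff ℂ (x - y)).1 fun φ => by
      rw [map_sub, hxy, sub_self])
  refine ⟨{ toFun := E, map_add' := fun P Q => ?_, map_smul' := fun c P => ?_ }, hW,
    fun φ P => hE P φ⟩
  · refine hext _ _ fun φ => (hE (P + Q) φ).unique ?_
    rw [map_add]
    convert (hE P φ).add (hE Q φ) using 2 with n
    rw [map_add, map_add, mul_add]
  · refine hext _ _ fun φ => (hE (c • P) φ).unique ?_
    rw [RingHom.id_apply, map_smul, smul_eq_mul]
    have h1 := (hE P φ).mul_left c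
    simp only [map_smul, smul_eq_mul, mul_left_comm _ c]
    exact h1

/-! ## The degree filtration -/

/-- The weight `∑ |k| α_k` of the monomial `v^α`. -/
def wt : (VIdx →₀ ℕ) →+ ℤ := Finsupp.weight fun k : VIdx => |k.1|

theorem wt_single (k : VIdx) (e : ℕ) : wt (Finsupp.single k e) = e * |k.1| := by
  simp [wt, Finsupp.weight_single]

theorem wt_nonneg (α : VIdx →₀ ℕ) : 0 ≤ wt α := by
  rw [wt, Finsupp.weight_apply]
  exact Finset.sum_nonneg fun k _ => nsmul_nonneg (abs_nonneg _) _

theorem mul_abs_le_wt (α : VIdx →₀ ℕ) (k : VIdx) : α k * |k.1| ≤ wt α := by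
  have h : α = Finsupp.single k (α k) + α.erase k := (Finsupp.single_add_erase k α).symm
  rw [h, map_add, wt_single, ← h]
  linarith [wt_nonneg (α.erase k)]

/-- Every index has `|k| ≥ 1`, so a bound on the weight bounds both the indices that occur and their
exponents. -/
theorem finite_setOf_wt_le (n : ℤ) : {α : VIdx →₀ ℕ | wt α ≤ n}.Finite := by
  have hs : {k : VIdx | |k.1| ≤ n}.Finite := by
    refine Set.Finite.of_finite_image (f := Subtype.val) ((Set.finite_Icc (-n) n).subset ?_)
      Subtype.val_injective.injOn
    rintro _ ⟨k, hk, rfl⟩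
    exact abs_le.1 hk
  refine (Finset.finite_toSet (Finset.finsupp hs.toFinset fun _ => Finset.range (n.toNat + 1))).subset
    fun α hα => ?_
  have h1 : ∀ k, k ∈ α.support → (α k : ℤ) ≤ n ∧ |k.1| ≤ n := fun k hk => by
    have h2 := (mul_abs_le_wt α k).trans hα
    have h3 : 1 ≤ |k.1| := Int.one_le_abs k.2
    have h4 : (1 : ℤ) ≤ α k := by
      have := Finsupp.mem_support_iff.1 hk
      omega
    constructor <;> nlinarith
  rw [Finset.mem_coe, Finset.mem_finsupp_iff]
  refine ⟨fun k hk => by simpa using (h1 k hk).2, fun k _ => ?_⟩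
  rw [Finset.mem_range]
  by_cases hk : k ∈ α.support
  · have := (h1 k hk).1
    omega
  · rw [Finsupp.notMem_support_iff.1 hk]
    omega

/-- The span of the monomials `u^m v^α` of degree `|m| + ∑ |k| α_k` at most `n`. -/
def degLE (n : ℤ) : Submodule ℂ CUV :=
  Submodule.span ℂ ((fun p : ℤ × (VIdx →₀ ℕ) => mono p.1 (MvPolynomial.monomial p.2 1)) ''
    {p | |p.1| + wt p.2 ≤ n})

theorem finiteDimensional_degLE (n : ℤ) : FiniteDimensional ℂ (degLE n) := by
  refine FiniteDimensional.span_of_finite ℂ (Set.Finite.image _ ?_)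
  refine ((Set.finite_Icc (-n) n).prod (finite_setOf_wt_le n)).subset fun p hp => ?_
  have h1 := wt_nonneg p.2
  have h2 := abs_nonneg p.1
  have h3 : |p.1| + wt p.2 ≤ n := hp
  exact ⟨abs_le.1 (by linarith), by simp only [Set.mem_ofPred_eq]; linarith⟩

theorem mono_monomial_mem_degLE {n m : ℤ} {α : VIdx →₀ ℕ} (c : ℂ) (h : |m| + wt α ≤ n) :
    mono m (MvPolynomial.monomial α c) ∈ degLE n := by
  have h1 : MvPolynomial.monomial α c = c • MvPolynomial.monomial α (1 : ℂ) := by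
    rw [MvPolynomial.smul_monomial, smul_eq_mul, mul_one]
  rw [h1, map_smul]
  exact Submodule.smul_mem _ _ (Submodule.subset_span ⟨(m, α), h, rfl⟩)

theorem map_mem_of_mem_degLE {T : Op} {n : ℤ} {S : Submodule ℂ CUV}
    (h : ∀ m α, |m| + wt α ≤ n → T (mono m (MvPolynomial.monomial α 1)) ∈ S) {P : CUV}
    (hP : P ∈ degLE n) : T P ∈ S := by
  have : degLE n ≤ S.comap T := Submodule.span_le.2 (by
    rintro _ ⟨p, hp, rfl⟩
    exact h p.1 p.2 hp)
  exact this hP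

theorem degLE_mono {a b : ℤ} (hab : a ≤ b) : degLE a ≤ degLE b :=
  Submodule.span_mono (Set.image_mono fun p (hp : |p.1| + wt p.2 ≤ a) => hp.trans hab)

theorem exists_mem_degLE (P : CUV) : ∃ n, P ∈ degLE n := by
  have hadd : ∀ P Q : CUV, (∃ n, P ∈ degLE n) → (∃ n, Q ∈ degLE n) → ∃ n, P + Q ∈ degLE n := by
    rintro P Q ⟨a, ha⟩ ⟨b, hb⟩
    exact ⟨max a b, Submodule.add_mem _ (degLE_mono (le_max_left _ _) ha) (degLE_mono (le_max_right _ _) hb)⟩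
  induction P using mono_induction with
  | hadd P Q hP hQ => exact hadd P Q hP hQ
  | hmono m q =>
    induction q using MvPolynomial.induction_on' with
    | monomial α c => exact ⟨_, mono_monomial_mem_degLE c le_rfl⟩
    | add p q hp hq => rw [map_add]; exact hadd _ _ hp hq

theorem mul_mem_degLE {a b c : ℤ} (hc : a + b ≤ c) {P Q : CUV} (hP : P ∈ degLE a)
    (hQ : Q ∈ degLE b) : P * Q ∈ degLE c := by
  have h1 : mulOp Q P ∈ degLE c := by
    refine map_mem_of_mem_degLE (fun m α hm => ?_) hP
    rw [mulOp_apply, mul_comm]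
    refine map_mem_of_mem_degLE (T := mulOp _) (fun k γ hk => ?_) hQ
    rw [mulOp_apply, mono_mul_mono, MvPolynomial.monomial_mul]
    refine mono_monomial_mem_degLE _ ?_
    rw [map_add]
    linarith [abs_add_le m k]
  rwa [mulOp_apply, mul_comm] at h1

theorem v_mem_degLE {k n : ℤ} (h : |k| ≤ n) : v k ∈ degLE n := by
  by_cases hk : k ≠ 0
  · rw [v_of_ne hk, MvPolynomial.X]
    refine mono_monomial_mem_degLE _ ?_
    simpa [wt_single] using h
  · rw [not_not] at hk
    subst hk
    rw [v_zero]
    exact mono_monomial_mem_degLE (m := 0) (α := 0) 1 (by simpa using h)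

theorem dv_mem_degLE {n : ℤ} {P : CUV} (k : VIdx) (h : P ∈ degLE n) :
    dv k P ∈ degLE (n - |k.1|) := by
  refine map_mem_of_mem_degLE (fun m α hm => ?_) h
  rw [dv_mono, MvPolynomial.pderiv_monomial]
  -- If `v k` does not occur, the factor `α k` kills the term, and the truncated subtraction in the
  -- exponent is harmless.
  by_cases hk : α k = 0
  · simp [hk]
  · refine mono_monomial_mem_degLE _ ?_
    have h1 : α - Finsupp.single k 1 + Finsupp.single k 1 = α := by
      refine tsub_add_cancel_of_le (Finsupp.single_le_iff.2 ?_)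
      omega
    rw [← h1, map_add, wt_single] at hm
    push_cast at hm
    linarith

theorem uPow_mul_du_mem_degLE {n c : ℤ} {P : CUV} (k : ℤ) (hc : n + |k| ≤ c) (h : P ∈ degLE n) :
    uPow (k + 1) * du P ∈ degLE c := by
  refine map_mem_of_mem_degLE (T := mulOp (uPow (k + 1)) * du) (fun m α hm => ?_) h
  rw [Module.End.mul_apply, du_mono, map_smul, mulOp_uPow_mono]
  refine Submodule.smul_mem _ _ (mono_monomial_mem_degLE _ ?_)
  rw [show k + 1 + (m - 1) = k + m by ring]
  linarith [abs_add_le k m]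

theorem dv_du_comm (k : VIdx) (P : CUV) : dv k (du P) = du (dv k P) := by
  induction P using mono_induction with
  | hadd P Q hP hQ => simp only [map_add, hP, hQ]
  | hmono m q => simp only [du_mono, dv_mono, map_smul]

/-- Operators that do not raise the degree. -/
def DegPres (T : Op) : Prop := ∀ n P, P ∈ degLE n → T P ∈ degLE n

theorem DegPres.add {S T : Op} (hS : DegPres S) (hT : DegPres T) : DegPres (S + T) :=
  fun n P h => Submodule.add_mem _ (hS n P h) (hT n P h)

theorem DegPres.sub {S T : Op} (hS : DegPres S) (hT : DegPres T) : DegPres (S - T) :=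
  fun n P h => Submodule.sub_mem _ (hS n P h) (hT n P h)

theorem DegPres.neg {T : Op} (hT : DegPres T) : DegPres (-T) :=
  fun n P h => Submodule.neg_mem _ (hT n P h)

theorem DegPres.smul {T : Op} (c : ℂ) (hT : DegPres T) : DegPres (c • T) :=
  fun n P h => Submodule.smul_mem _ c (hT n P h)

theorem degPres_lsum {ι : Type} {T : ι → Op} (h : LocFin T) (hT : ∀ i, DegPres (T i)) :
    DegPres (lsum T h) := fun n P hP =>
  finsum_induction (· ∈ degLE n) (Submodule.zero_mem _) (fun _ _ => Submodule.add_mem _)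
    fun i => hT i n P hP

theorem degPres_of_mono {T : Op}
    (h : ∀ m α, T (mono m (MvPolynomial.monomial α 1)) ∈ degLE (|m| + wt α)) : DegPres T :=
  fun _ _ hP => map_mem_of_mem_degLE (fun m α hm => degLE_mono hm (h m α)) hP

/-- The derivative in `v k` lowers the degree by `|k|`, which is what the coefficient may put back.
-/
theorem degPres_vField {s : VIdx → CUV} (hs : ∀ k, s k ∈ degLE |k.1|) : DegPres (vField s) :=
  degPres_lsum _ fun k _ _ h => mul_mem_degLE (by linarith) (hs k) (dv_mem_degLE k h)

theorem degPres_vHess {s : VIdx × VIdx → CUV} (hs : ∀ p, s p ∈ degLE (|p.1.1| + |p.2.1|)) :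
    DegPres (vHess s) :=
  degPres_lsum _ fun p _ _ h =>
    mul_mem_degLE (by linarith) (hs p) (dv_mem_degLE p.1 (dv_mem_degLE p.2 h))

theorem degPres_opN0 : DegPres opN0 := by
  rw [opN0_eq]
  exact degPres_vField fun k => Submodule.smul_mem _ _ (v_mem_degLE le_rfl)

theorem degPres_opN1 : DegPres opN1 := degPres_of_mono fun m α => by
  rw [opN1_mono]
  exact Submodule.smul_mem _ _ (mono_monomial_mem_degLE _ le_rfl)

theorem degPres_opY1p : DegPres opY1p := degPres_of_mono fun m α => by
  rw [opY1p_mono]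
  refine Submodule.sum_mem _ fun k hk => Submodule.smul_mem _ _ ?_
  rw [Finset.mem_Icc] at hk
  rw [← v_mul_mono]
  refine mul_mem_degLE ?_ (v_mem_degLE le_rfl) (mono_monomial_mem_degLE _ le_rfl)
  rw [abs_of_pos (show 0 < k by omega), abs_of_pos (show 0 < m - k by omega),
    abs_of_pos (show 0 < m by omega)]
  linarith

theorem degPres_opY1m : DegPres opY1m := degPres_of_mono fun m α => by
  rw [opY1m_mono]
  refine Submodule.sum_mem _ fun k hk => Submodule.smul_mem _ _ ?_
  rw [Finset.mem_Icc] at hk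
  rw [← v_mul_mono]
  refine mul_mem_degLE ?_ (v_mem_degLE le_rfl) (mono_monomial_mem_degLE _ le_rfl)
  rw [abs_of_neg (show k < 0 by omega), abs_of_neg (show m - k < 0 by omega),
    abs_of_neg (show m < 0 by omega)]
  linarith

theorem degPres_opZ2p : DegPres opZ2p := degPres_of_mono fun m α => by
  rw [opZ2p_mono]
  refine Submodule.sum_mem _ fun k hk => Submodule.smul_mem _ _ (mono_monomial_mem_degLE _ ?_)
  rw [Finset.mem_Icc] at hk
  have : |m - 2 * k| ≤ |m| := by
    rw [abs_of_pos (show 0 < m by omega), abs_le]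
    omega
  linarith

theorem degPres_opZ2m : DegPres opZ2m := degPres_of_mono fun m α => by
  rw [opZ2m_mono]
  refine Submodule.sum_mem _ fun k hk => Submodule.smul_mem _ _ (mono_monomial_mem_degLE _ ?_)
  rw [Finset.mem_Icc] at hk
  have : |m - 2 * k| ≤ |m| := by
    rw [abs_of_neg (show m < 0 by omega), abs_le]
    omega
  linarith

theorem degPres_opY2p : DegPres opY2p := by
  rw [opY2p_eq]
  refine degPres_vField fun k => Submodule.sum_mem _ fun j hj => Submodule.smul_mem _ _ ?_
  rw [Finset.mem_Icc] at hj
  refine mul_mem_degLE ?_ (v_mem_degLE le_rfl) (v_mem_degLE le_rfl)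
  rw [abs_of_pos (show 0 < j by omega), abs_of_pos (show 0 < k.1 - j by omega),
    abs_of_pos (show 0 < k.1 by omega)]
  linarith

theorem degPres_opY2m : DegPres opY2m := by
  rw [opY2m_eq]
  refine degPres_vField fun k => Submodule.sum_mem _ fun j hj => Submodule.smul_mem _ _ ?_
  rw [Finset.mem_Icc] at hj
  refine mul_mem_degLE ?_ (v_mem_degLE le_rfl) (v_mem_degLE le_rfl)
  rw [abs_of_neg (show j < 0 by omega), abs_of_neg (show k.1 - j < 0 by omega),
    abs_of_neg (show k.1 < 0 by omega)]
  linarith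

theorem degPres_opZ1p : DegPres opZ1p := by
  rw [opZ1p_eq]
  refine degPres_vField fun k => Submodule.sum_mem _ fun j hj =>
    Submodule.smul_mem _ _ (v_mem_degLE ?_)
  rw [Finset.mem_Icc] at hj
  rw [abs_of_pos (show 0 < k.1 by omega), abs_le]
  omega

theorem degPres_opZ1m : DegPres opZ1m := by
  rw [opZ1m_eq]
  refine degPres_vField fun k => Submodule.sum_mem _ fun j hj =>
    Submodule.smul_mem _ _ (v_mem_degLE ?_)
  rw [Finset.mem_Icc] at hj
  rw [abs_of_neg (show k.1 < 0 by omega), abs_le]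
  omega

/-- The operator `u^(l+1) ∂/∂u` raises the degree by at most `|l|`; of the `|k|` freed by the
derivative in `v k`, this leaves `|k| - |l|` for the coefficient. -/
theorem degPres_vField_mul_du {c : VIdx → CUV} {l : VIdx → ℤ}
    (hc : ∀ k, c k ∈ degLE (|k.1| - |l k|)) :
    DegPres (vField (fun k => c k * uPow (l k + 1)) * du) := fun n P hP => by
  refine finsum_induction (· ∈ degLE n) (Submodule.zero_mem _) (fun _ _ => Submodule.add_mem _)
    fun k => ?_
  -- The derivatives are exchanged so that the power of `u` stands next to `du`. This matters
  -- because `du` alone can raise the degree on negative powers.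
  rw [Module.End.mul_apply, mulOp_apply, dv_du_comm, mul_assoc]
  exact mul_mem_degLE (by linarith) (hc k) (uPow_mul_du_mem_degLE (l k) le_rfl (dv_mem_degLE k hP))

theorem smul_one_mem_degLE (c : ℂ) {n : ℤ} (h : 0 ≤ n) : c • (1 : CUV) ∈ degLE n :=
  Submodule.smul_mem _ _ (mono_monomial_mem_degLE (m := 0) (α := 0) 1 (by simpa using h))

theorem degPres_opK1p : DegPres opK1p := by
  rw [opK1p_eq]
  have := degPres_vField_mul_du (c := fun k => (k : ℂ) • 1) (l := fun k => -k.1)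
    fun k => smul_one_mem_degLE _ (by rw [abs_neg, sub_self])
  simpa only [smul_mul_assoc, one_mul] using this

theorem degPres_opK1m : DegPres opK1m := by
  rw [opK1m_eq]
  have := degPres_vField_mul_du (c := fun k => (k : ℂ) • 1) (l := fun k => k.1)
    fun k => smul_one_mem_degLE _ (by rw [sub_self])
  simpa only [smul_mul_assoc, one_mul] using this

theorem degPres_opK2p : DegPres opK2p := by
  rw [opK2p_eq]
  refine degPres_vHess fun p => Submodule.smul_mem _ _ (v_mem_degLE ?_)
  linarith [abs_sub p.2.1 p.1.1]

theorem degPres_opK2m : DegPres opK2m := by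
  rw [opK2m_eq]
  refine degPres_vHess fun p => Submodule.smul_mem _ _ (v_mem_degLE ?_)
  linarith [abs_add_le p.2.1 p.1.1]

theorem degPres_opJ : DegPres opJ := by
  rw [opJ_eq]
  refine ((((DegPres.smul 2 ?_).add ?_).add ?_).add ?_).add ?_
  · have := degPres_vField_mul_du (c := fun k => (k : ℂ) • v k) (l := fun _ => 0)
      fun k => Submodule.smul_mem _ _ (v_mem_degLE (by simp))
    simpa only [smul_mul_assoc, zero_add, mul_comm (uPow 1)] using this
  · exact degPres_vHess fun p => Submodule.smul_mem _ _
      (mul_mem_degLE le_rfl (v_mem_degLE le_rfl) (v_mem_degLE le_rfl))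
  · exact degPres_vField fun k => Submodule.smul_mem _ _ (v_mem_degLE le_rfl)
  · refine degPres_of_mono fun m α => ?_
    rw [Module.End.mul_apply, Module.End.mul_apply, du_mono, map_smul, du_mono, map_smul, map_smul,
      mulOp_uPow_mono]
    refine Submodule.smul_mem _ _ (Submodule.smul_mem _ _ (mono_monomial_mem_degLE _ ?_))
    rw [show 2 + (m - 1 - 1) = m by ring]
  · exact fun n P hP => uPow_mul_du_mem_degLE 0 (by simp) hP

theorem degPres_D (β : Beta) (N : ℕ) : DegPres (D β N) := by
  have hN : DegPres opN := degPres_opN0.add degPres_opN1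
  have h1 : DegPres (opN + (2 : ℂ) • opZ1 + (2 : ℂ) • opZ2) :=
    (hN.add ((degPres_opZ1p.sub degPres_opZ1m).smul 2)).add
      ((degPres_opZ2p.sub degPres_opZ2m).smul 2)
  have h2 : DegPres ((2 : ℂ) • opK1 + opK2) :=
    ((degPres_opK1p.sub degPres_opK1m).smul 2).add (degPres_opK2p.sub degPres_opK2m)
  have hL1 : DegPres (L1 β) := by
    cases β with
    | one => exact h1
    | two => exact fun n P _ => Submodule.zero_mem _
    | four => exact h1.smul _
  have hL2 : DegPres (L2 β) := by
    cases β with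
    | one => exact h2
    | two => exact ((degPres_opK1m.smul 2).neg.sub degPres_opK2m).add degPres_opJ
    | four => exact h2.smul _
  exact (((hN.neg.sub ((degPres_opY1p.sub degPres_opY1m).smul 2)).sub
    ((degPres_opY2p.sub degPres_opY2m).smul 2)).add (hL1.smul _)).add (hL2.smul _)

/-- The exponential of an operator that does not raise the degree; the power series converges
against every linear functional. -/
theorem DegPres.exists_isExp {T : Op} (hT : DegPres T) :
    ∃ E : Op, IsExp T E ∧ ∀ (φ : CUV →ₗ[ℂ] ℂ) (P : CUV),
      HasSum (fun n : ℕ => ((n.factorial : ℂ)⁻¹) * φ ((T ^ n) P)) (φ (E P)) := by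
  obtain ⟨E, hW, hE⟩ := exists_exp_of_locallyFinite T fun P => by
    obtain ⟨n, hn⟩ := exists_mem_degLE P
    exact ⟨degLE n, finiteDimensional_degLE n, hn, hT n⟩
  refine ⟨E, fun P => ?_, hE⟩
  obtain ⟨W, h1, h2, h3, h4⟩ := hW P
  refine ⟨W, h1, h2, h3, h4, fun k α => ?_⟩
  exact hE { toFun := fun Q => (Q.coeff k).coeff α
             map_add' := fun _ _ => rfl
             map_smul' := fun _ _ => rfl } P

/-! ## Left-invariant derivatives of trace polynomials -/

section MatrixCalculus

variable {n : Type} [Fintype n]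

/-- Here and in the lemmas below a norm serves only inside the proof; the statement depends on the
topology of the matrix space alone. -/
theorem hasDerivAt_matrix_exp [DecidableEq n] (X : Matrix n n ℂ) :
    HasDerivAt (fun t : ℝ => NormedSpace.exp (t • X)) X 0 := by
  open scoped Matrix.Norms.Operator in
  have := hasDerivAt_exp_smul_const X (0 : ℝ)
  rw [zero_smul, NormedSpace.exp_zero, one_mul] at this
  exact this

variable {f g : ℝ → Matrix n n ℂ} {f' g' : Matrix n n ℂ} {x : ℝ}

theorem hasDerivAt_matrix_mul [DecidableEq n] (hf : HasDerivAt f f' x) (hg : HasDerivAt g g' x) :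
    HasDerivAt (fun t => f t * g t) (f' * g x + f x * g') x := by
  open scoped Matrix.Norms.Operator in
  exact HasDerivAt.mul hf hg

theorem hasDerivAt_matrix_smul {r : ℝ → ℂ} {r' : ℂ} (hr : HasDerivAt r r' x)
    (hg : HasDerivAt g g' x) : HasDerivAt (fun t => r t • g t) (r' • g x + r x • g') x := by
  open scoped Matrix.Norms.Operator in
  rw [add_comm]
  exact HasDerivAt.smul hr hg

theorem hasDerivAt_matrix_trace (hg : HasDerivAt g g' x) :
    HasDerivAt (fun t => (g t).trace) g'.trace x := by
  open scoped Matrix.Norms.Operator in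
  exact (LinearMap.toContinuousLinearMap
    (Matrix.traceLinearMap n ℝ ℂ)).hasFDerivAt.comp_hasDerivAt x hg

theorem hasDerivAt_matrix_sum {ι : Type} {s : Finset ι} {F : ι → ℝ → Matrix n n ℂ}
    {F' : ι → Matrix n n ℂ} (h : ∀ i ∈ s, HasDerivAt (F i) (F' i) x) :
    HasDerivAt (fun t => ∑ i ∈ s, F i t) (∑ i ∈ s, F' i) x := by
  open scoped Matrix.Norms.Operator in
  exact HasDerivAt.fun_sum h

theorem hasDerivAt_matrix_sub (hf : HasDerivAt f f' x) (hg : HasDerivAt g g' x) :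
    HasDerivAt (fun t => f t - g t) (f' - g') x := by
  open scoped Matrix.Norms.Operator in
  exact HasDerivAt.sub hf hg

theorem hasDerivAt_matrix_add (hf : HasDerivAt f f' x) (hg : HasDerivAt g g' x) :
    HasDerivAt (fun t => f t + g t) (f' + g') x := by
  open scoped Matrix.Norms.Operator in
  exact HasDerivAt.add hf hg

theorem hasDerivAt_matrix_const (M : Matrix n n ℂ) (x : ℝ) :
    HasDerivAt (fun _ : ℝ => M) 0 x := by
  open scoped Matrix.Norms.Operator in
  exact hasDerivAt_const x M

theorem deriv_matrix (hg : HasDerivAt g g' x) : deriv g x = g' := by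
  open scoped Matrix.Norms.Operator in
  exact HasDerivAt.deriv hg

theorem exp_mul_exp_neg' [DecidableEq n] (X : Matrix n n ℂ) : NormedSpace.exp X * NormedSpace.exp (-X) = 1 := by
  have := exp_mul_exp_neg (-X)
  rwa [neg_neg] at this

end MatrixCalculus

namespace MatrixGroup

variable {G : MatrixGroup}

/-- The function `f` is differentiable along the left-invariant vector field `X̃`, with derivative
`f'`. -/
def HasLeftDeriv {E : Type} [AddCommGroup E] [Module ℝ E] [TopologicalSpace E]
    [ContinuousSMul ℝ E] (X : G.lie) (f f' : G.grp → E) : Prop :=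
  ∀ A, HasDerivAt (fun t : ℝ => f (A * G.expMap (t • X))) (f' A) 0

theorem mul_expMap_zero_smul (A : G.grp) (X : G.lie) : A * G.expMap ((0 : ℝ) • X) = A := by
  refine Subtype.ext ?_
  simp [expMap]

theorem coe_mul_expMap (A : G.grp) (X : G.lie) (t : ℝ) :
    ((A * G.expMap (t • X) : G.grp) : Matrix G.n G.n ℂ) =
      (A : Matrix G.n G.n ℂ) * NormedSpace.exp (t • (X : Matrix G.n G.n ℂ)) := rfl

theorem HasLeftDeriv.leftDeriv_eq {X : G.lie} {f f' : G.Fn} (h : HasLeftDeriv X f f') :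
    G.leftDeriv X f = f' := funext fun A => deriv_matrix (h A)

theorem HasLeftDeriv.mul {X : G.lie} {f f' g g' : G.Fn} (hf : HasLeftDeriv X f f')
    (hg : HasLeftDeriv X g g') :
    HasLeftDeriv X (fun A => f A * g A) (fun A => f' A * g A + f A * g' A) := fun A => by
  have := hasDerivAt_matrix_mul (hf A) (hg A)
  rwa [mul_expMap_zero_smul] at this

theorem HasLeftDeriv.smul {X : G.lie} {r r' : G.grp → ℂ} {g g' : G.Fn} (hr : HasLeftDeriv X r r')
    (hg : HasLeftDeriv X g g') :
    HasLeftDeriv X (fun A => r A • g A) (fun A => r' A • g A + r A • g' A) := fun A => by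
  have := hasDerivAt_matrix_smul (hr A) (hg A)
  rwa [mul_expMap_zero_smul] at this

theorem HasLeftDeriv.add {X : G.lie} {f f' g g' : G.Fn} (hf : HasLeftDeriv X f f')
    (hg : HasLeftDeriv X g g') :
    HasLeftDeriv X (fun A => f A + g A) (fun A => f' A + g' A) := fun A =>
  hasDerivAt_matrix_add (hf A) (hg A)

theorem hasLeftDeriv_const (X : G.lie) (M : Matrix G.n G.n ℂ) :
    HasLeftDeriv X (fun _ => M) (fun _ => 0) := fun _ =>
  hasDerivAt_matrix_const M 0

theorem HasLeftDeriv.const_mul {X : G.lie} {f f' : G.Fn} (M : Matrix G.n G.n ℂ)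
    (hf : HasLeftDeriv X f f') : HasLeftDeriv X (fun A => M * f A) (fun A => M * f' A) := by
  have := (hasLeftDeriv_const X M).mul hf
  simpa only [zero_mul, zero_add] using this

theorem HasLeftDeriv.mul_const {X : G.lie} {f f' : G.Fn} (M : Matrix G.n G.n ℂ)
    (hf : HasLeftDeriv X f f') : HasLeftDeriv X (fun A => f A * M) (fun A => f' A * M) := by
  have := hf.mul (hasLeftDeriv_const X M)
  simpa only [mul_zero, add_zero] using this

theorem HasLeftDeriv.trace_mul {X : G.lie} {f f' : G.Fn} (c : ℂ) (hf : HasLeftDeriv X f f') :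
    HasLeftDeriv X (fun A => c * (f A).trace) (fun A => c * (f' A).trace) := fun A =>
  (hasDerivAt_matrix_trace (hf A)).const_mul c

theorem HasLeftDeriv.orientedSum {X : G.lie} {f f' : ℤ → G.Fn}
    (hf : ∀ j, HasLeftDeriv X (f j) (f' j)) (m : ℤ) :
    HasLeftDeriv X (fun A => orientedSum (fun j => f j A) m)
      (fun A => TracePoly.orientedSum (fun j => f' j A) m) := fun A =>
  hasDerivAt_matrix_sub (hasDerivAt_matrix_sum fun j _ => hf j A)
    (hasDerivAt_matrix_sum fun j _ => hf j A)

theorem hasLeftDeriv_coe (X : G.lie) :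
    HasLeftDeriv X (fun A : G.grp => (A : Matrix G.n G.n ℂ))
      (fun A => (A : Matrix G.n G.n ℂ) * (X : Matrix G.n G.n ℂ)) := fun A => by
  have := hasDerivAt_matrix_mul (hasDerivAt_matrix_const (A : Matrix G.n G.n ℂ) 0)
    (hasDerivAt_matrix_exp (X : Matrix G.n G.n ℂ))
  simpa only [zero_mul, zero_add, coe_mul_expMap] using this

/-- The exponential is invertible and `Matrix.mul_inv_rev` is unconditional, so nothing is asked of
`A`. -/
theorem inv_mul_exp (A X : Matrix G.n G.n ℂ) :
    (A * NormedSpace.exp X)⁻¹ = NormedSpace.exp (-X) * A⁻¹ := by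
  rw [Matrix.mul_inv_rev, Matrix.inv_eq_right_inv (exp_mul_exp_neg' X)]

theorem hasLeftDeriv_inv (X : G.lie) :
    HasLeftDeriv X (fun A : G.grp => (A : Matrix G.n G.n ℂ)⁻¹)
      (fun A => -(X : Matrix G.n G.n ℂ) * (A : Matrix G.n G.n ℂ)⁻¹) := fun A => by
  have := hasDerivAt_matrix_mul (hasDerivAt_matrix_exp (-(X : Matrix G.n G.n ℂ)))
    (hasDerivAt_matrix_const (A : Matrix G.n G.n ℂ)⁻¹ 0)
  simpa only [mul_zero, add_zero, coe_mul_expMap, inv_mul_exp, smul_neg] using this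

/-- Each factor `A` contributes one insertion of `X` to its right, and each factor `A⁻¹` one of `-X`
to its left; the oriented sum puts both signs of the exponent into one formula. -/
theorem hasLeftDeriv_zpow (hu : ∀ A : G.grp, IsUnit (A : Matrix G.n G.n ℂ).det) (X : G.lie) (m : ℤ) :
    HasLeftDeriv X (fun A : G.grp => (A : Matrix G.n G.n ℂ) ^ m) (fun A =>
      TracePoly.orientedSum (fun j => (A : Matrix G.n G.n ℂ) ^ j * (X : Matrix G.n G.n ℂ) *
        (A : Matrix G.n G.n ℂ) ^ (m - j)) m) := by
  induction m using Int.induction_on with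
  | zero =>
    simp only [zpow_zero, orientedSum_zero]
    exact hasLeftDeriv_const X 1
  | succ k ih =>
    convert ih.mul (hasLeftDeriv_coe X) using 2 with A A
    · exact Matrix.zpow_add_one (hu A) _
    · rw [orientedSum_succ, sub_self, zpow_zero, mul_one, Matrix.zpow_add_one (hu A), mul_assoc]
      congr 1
      rw [← AddMonoidHom.mulRight_apply, map_orientedSum]
      congr 1
      funext j
      rw [AddMonoidHom.mulRight_apply, mul_assoc _ _ (A : Matrix G.n G.n ℂ),
        ← Matrix.zpow_add_one (hu A), sub_add_eq_add_sub]
  | pred k ih =>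
    convert ih.mul (hasLeftDeriv_inv X) using 2 with A A
    · exact Matrix.zpow_sub_one (hu A) _
    · rw [orientedSum_pred, neg_mul, mul_neg, ← sub_eq_add_neg, ← mul_assoc]
      congr 1
      · rw [← AddMonoidHom.mulRight_apply, map_orientedSum]
        congr 1
        funext j
        rw [AddMonoidHom.mulRight_apply, mul_assoc _ _ (A : Matrix G.n G.n ℂ)⁻¹,
          ← Matrix.zpow_sub_one (hu A), sub_right_comm]
      · rw [sub_sub_cancel_left, Matrix.zpow_neg_one]

/-! ### Evaluation of trace polynomials -/

/-- The normalized trace of `A ^ k`. -/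
def ntr (A : G.grp) (k : ℤ) : ℂ := ((A : Matrix G.n G.n ℂ) ^ k).trace / (Fintype.card G.n : ℂ)

theorem traceFn_mono (m : ℤ) (q : CV) (A : G.grp) : G.traceFn (mono m q) A =
    MvPolynomial.eval (fun j : VIdx => ntr A j) q • (A : Matrix G.n G.n ℂ) ^ m := by
  rw [traceFn]
  exact Finsupp.sum_single_index (by rw [map_zero, zero_smul])

theorem traceFn_add (P Q : CUV) (A : G.grp) :
    G.traceFn (P + Q) A = G.traceFn P A + G.traceFn Q A := by
  simp only [traceFn, AddMonoidAlgebra.coeff_add]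
  exact Finsupp.sum_add_index' (fun _ => by rw [map_zero, zero_smul])
    fun _ _ _ => by rw [map_add, add_smul]

/-- Evaluation of trace polynomials at `A`, as a linear map. -/
def traceEval (A : G.grp) : CUV →ₗ[ℂ] Matrix G.n G.n ℂ where
  toFun P := G.traceFn P A
  map_add' P Q := traceFn_add P Q A
  map_smul' c P := by
    induction P using mono_induction with
    | hadd P Q hP hQ => rw [smul_add, traceFn_add, hP, hQ, traceFn_add, smul_add]
    | hmono m q =>
      rw [← map_smul, traceFn_mono, traceFn_mono, MvPolynomial.smul_eval, mul_smul,
        RingHom.id_apply]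

theorem traceFn_eq_traceEval (P : CUV) (A : G.grp) : G.traceFn P A = traceEval A P := rfl

theorem traceEval_mono (m : ℤ) (q : CV) (A : G.grp) : traceEval A (mono m q) =
    MvPolynomial.eval (fun j : VIdx => ntr A j) q • (A : Matrix G.n G.n ℂ) ^ m :=
  traceFn_mono m q A

theorem traceEval_uPow (m : ℤ) (A : G.grp) : traceEval A (uPow m) = (A : Matrix G.n G.n ℂ) ^ m := by
  rw [uPow_eq_mono, traceEval_mono, map_one, one_smul]

theorem traceEval_mul {A : G.grp} (hA : IsUnit (A : Matrix G.n G.n ℂ).det) (P Q : CUV) :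
    traceEval A (P * Q) = traceEval A P * traceEval A Q := by
  induction P using mono_induction with
  | hadd P P' hP hP' => rw [add_mul, map_add, hP, hP', map_add, add_mul]
  | hmono m q =>
    induction Q using mono_induction with
    | hadd Q Q' hQ hQ' => rw [mul_add, map_add, hQ, hQ', map_add, mul_add]
    | hmono n r =>
      rw [mono_mul_mono, traceEval_mono, traceEval_mono, traceEval_mono, map_mul,
        Matrix.zpow_add hA, smul_mul_smul_comm]

/-- This matches the convention `v 0 = 1` and needs `N ≥ 1`: for empty matrices the quotient would
be `0 / 0 = 0`. -/
theorem ntr_zero [Nonempty G.n] (A : G.grp) : ntr A 0 = 1 := by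
  rw [ntr, zpow_zero, Matrix.trace_one, div_self]
  exact Nat.cast_ne_zero.2 Fintype.card_ne_zero

theorem traceEval_v [Nonempty G.n] (A : G.grp) (k : ℤ) :
    traceEval A (v k) = ntr A k • (1 : Matrix G.n G.n ℂ) := by
  by_cases hk : k ≠ 0
  · rw [v_of_ne hk, traceEval_mono, MvPolynomial.eval_X, zpow_zero]
  · rw [not_not] at hk
    subst hk
    rw [v_zero, ntr_zero]
    exact (traceEval_uPow 0 A).trans (by rw [zpow_zero, one_smul])

theorem traceEval_v_mul [Nonempty G.n] {A : G.grp} (hA : IsUnit (A : Matrix G.n G.n ℂ).det) (k : ℤ)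
    (P : CUV) : traceEval A (v k * P) = ntr A k • traceEval A P := by
  rw [traceEval_mul hA, traceEval_v, smul_mul_assoc, one_mul]

/-! ### Smoothness -/

theorem contDiff_exp_sum (d : ℕ) (X : Fin d → Matrix G.n G.n ℂ) (i j : G.n) :
    ContDiff ℝ (⊤ : ℕ∞) (fun x : Fin d → ℝ => NormedSpace.exp (∑ k, x k • X k) i j) := by
  open scoped Matrix.Norms.Operator in
  have h : ContDiff ℝ (⊤ : ℕ∞) (NormedSpace.exp : Matrix G.n G.n ℂ → Matrix G.n G.n ℂ) := by
    rw [contDiff_iff_contDiffAt]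
    exact fun x => (NormedSpace.exp_analytic (𝕂 := ℝ) x).contDiffAt
  open scoped Matrix.Norms.Operator in
  have h2 : ContDiff ℝ (⊤ : ℕ∞) (fun x : Fin d → ℝ => ∑ k, x k • X k) := by fun_prop
  open scoped Matrix.Norms.Operator in
  have h3 : ContDiff ℝ (⊤ : ℕ∞) (fun M : Matrix G.n G.n ℂ => M i j) :=
    (LinearMap.toContinuousLinearMap (Matrix.entryLinearMap ℝ ℂ i j)).contDiff
  open scoped Matrix.Norms.Operator in
  exact h3.comp (h.comp h2)

/-- Entrywise smoothness of a matrix-valued function. -/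
def EntrySmooth {d : ℕ} (F : (Fin d → ℝ) → Matrix G.n G.n ℂ) : Prop :=
  ∀ i j, ContDiff ℝ (⊤ : ℕ∞) fun x => F x i j

theorem EntrySmooth.mul {d : ℕ} {F H : (Fin d → ℝ) → Matrix G.n G.n ℂ} (hF : EntrySmooth F)
    (hH : EntrySmooth H) : EntrySmooth fun x => F x * H x := fun i j => by
  simp only [Matrix.mul_apply]
  exact ContDiff.sum fun k _ => (hF i k).mul (hH k j)

theorem entrySmooth_const {d : ℕ} (M : Matrix G.n G.n ℂ) :
    EntrySmooth fun _ : Fin d → ℝ => M := fun _ _ => contDiff_const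

theorem EntrySmooth.pow {d : ℕ} {F : (Fin d → ℝ) → Matrix G.n G.n ℂ} (hF : EntrySmooth F) (k : ℕ) :
    EntrySmooth fun x => F x ^ k := by
  induction k with
  | zero => simpa only [pow_zero] using entrySmooth_const 1
  | succ k ih => simpa only [pow_succ] using ih.mul hF

/-- In exponential coordinates the group element and its inverse have smooth entries, and the
function is polynomial in these entries. -/
theorem isSmooth_traceFn (P : CUV) : G.IsSmooth (G.traceFn P) := by
  intro d b A
  set F : (Fin d → ℝ) → G.grp := fun x => A * G.expMap (∑ k, x k • b k) with hF
  have hFx : ∀ x, (F x : Matrix G.n G.n ℂ) =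
      (A : Matrix G.n G.n ℂ) * NormedSpace.exp (∑ k, x k • (b k : Matrix G.n G.n ℂ)) := fun x => by
    simp [hF, expMap]
  have h1 : EntrySmooth fun x => (F x : Matrix G.n G.n ℂ) := by
    simp only [hFx]
    exact (entrySmooth_const _).mul (contDiff_exp_sum d _)
  have h2 : EntrySmooth fun x => (F x : Matrix G.n G.n ℂ)⁻¹ := by
    simp only [hFx, inv_mul_exp, ← Finset.sum_neg_distrib, ← smul_neg]
    exact EntrySmooth.mul (contDiff_exp_sum d _) (entrySmooth_const _)
  have h3 : ∀ m : ℤ, EntrySmooth fun x => (F x : Matrix G.n G.n ℂ) ^ m := fun m => by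
    obtain ⟨k, rfl | rfl⟩ := m.eq_nat_or_neg
    · simpa only [zpow_natCast] using h1.pow k
    · simpa only [Matrix.zpow_neg_natCast, Matrix.inv_pow'] using h2.pow k
  have h4 : ∀ m : ℤ, ContDiff ℝ (⊤ : ℕ∞) fun x => ntr (F x) m := fun m =>
    (ContDiff.sum fun i _ => h3 m i i).div_const _
  have h5 : ∀ q : CV, ContDiff ℝ (⊤ : ℕ∞) fun x =>
      MvPolynomial.eval (fun j : VIdx => ntr (F x) j) q := fun q => by
    induction q using MvPolynomial.induction_on with
    | C a => simpa only [MvPolynomial.eval_C] using contDiff_const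
    | add p q hp hq => simpa only [map_add] using hp.add hq
    | mul_X p k hp => simpa only [map_mul, MvPolynomial.eval_X] using hp.mul (h4 k)
  intro i j
  induction P using mono_induction with
  | hadd P Q hP hQ =>
    simp only [traceFn_add, Matrix.add_apply]
    exact hP.add hQ
  | hmono m q =>
    simp only [traceFn_mono, Matrix.smul_apply, smul_eq_mul]
    exact (h5 q).mul (h3 m i j)

end MatrixGroup

/-! ## The Laplacian on trace polynomials -/

section LapSum

variable {V : Type*} [AddCommGroup V]

/-- The sum `|m| h(0) + 2 ∑ (|m| - |r|) h(r)` over the `r` strictly between `0` and `m`. -/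
def lapSum (h : ℤ → V) (m : ℤ) : V :=
  |m| • h 0 + (2 : ℤ) • (∑ r ∈ Finset.Icc 1 (m - 1), (m - r) • h r -
    ∑ r ∈ Finset.Icc (m + 1) (-1), (m - r) • h r)

/-- The right side is the shape of the second derivative of `A^m`: the second insertion falls to the
left or to the right of the first, and `h` is evaluated at the power caught between them. -/
theorem lapSum_eq_orientedSum (h : ℤ → V) (m : ℤ) : lapSum h m =
    orientedSum (fun j => orientedSum (fun l => h (j - l)) j + orientedSum h (m - j)) m := by
  rw [lapSum, abs_zsmul_add_two_zsmul_sum, orientedSum_orientedSum]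

theorem lapSum_of_symm {h : ℤ → V} {k : ℤ} (hs : ∀ j, h (k - j) = h j) :
    lapSum h k = k • orientedSum h k := by
  rw [lapSum, abs_zsmul_add_two_zsmul_sum, two_zsmul_orientedSum_of_symm hs]

theorem lapSum_const (c : V) (m : ℤ) : lapSum (fun _ => c) m = m • m • c := by
  rw [lapSum_of_symm fun _ => rfl, orientedSum_const]

theorem lapSum_add (f g : ℤ → V) (m : ℤ) :
    lapSum (fun r => f r + g r) m = lapSum f m + lapSum g m := by
  simp only [lapSum, smul_add, Finset.sum_add_distrib, smul_sub]
  abel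

theorem map_lapSum {W F : Type*} [AddCommGroup W] [FunLike F V W] [AddMonoidHomClass F V W]
    (φ : F) (h : ℤ → V) (m : ℤ) : φ (lapSum h m) = lapSum (fun r => φ (h r)) m := by
  simp only [lapSum, map_add, map_sub, map_zsmul, map_sum]

theorem lapSum_smul [Module ℂ V] (c : ℂ) (h : ℤ → V) (m : ℤ) :
    lapSum (fun r => c • h r) m = c • lapSum h m :=
  (map_lapSum (DistribSMul.toAddMonoidHom V c) h m).symm

end LapSum

/-- The derivation `u^m ↦ m u^{m+l}`, `v_k ↦ k v_{k+l}`. -/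
def shiftDeriv (l : ℤ) : Op :=
  mulOp (uPow (l + 1)) * du + vField fun k => (k : ℂ) • v (k + l)

theorem shiftDeriv_mono_one (l m : ℤ) : shiftDeriv l (mono m 1) = (m : ℂ) • mono (m + l) 1 := by
  rw [shiftDeriv, LinearMap.add_apply, vField_mono_one, add_zero, Module.End.mul_apply, du_mono,
    map_smul, mulOp_uPow_mono, show l + 1 + (m - 1) = m + l by ring]

/-- `shiftDeriv l` models the derivative in the direction `X = A^l`, which sends `A^m` to `m
A^(m+l)`. The contraction of a gradient with `tr(X_i A^l)` is a combination of such derivatives. -/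
theorem shiftDeriv_v_mul (l : ℤ) (k : VIdx) (P : CUV) :
    shiftDeriv l (v k * P) = v k * shiftDeriv l P + ((k : ℂ) • v (k + l)) * P := by
  rw [shiftDeriv, LinearMap.add_apply, LinearMap.add_apply, vField_v_mul, commV_mulOp_mul_du,
    mul_add, add_assoc]

/-- `2 K₁⁺ + K₂⁺`. -/
def opKp : Op := (2 : ℂ) • opK1p + opK2p

/-- `2 K₁⁻ + K₂⁻`. -/
def opKm : Op := (2 : ℂ) • opK1m + opK2m

/-- `L₀ + a L₁ + a² (2 K₁⁺ + K₂⁺) - c (2 K₁⁻ + K₂⁻) + b J`. -/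
def casimirOp (a b c : ℂ) : Op :=
  L0 + a • (opN + (2 : ℂ) • opZ1 + (2 : ℂ) • opZ2) + a ^ 2 • opKp - c • opKm + b • opJ

theorem casimirOp_apply (a b c : ℂ) (P : CUV) : casimirOp a b c P =
    -opN P - (2 : ℂ) • opY1 P - (2 : ℂ) • opY2 P +
      a • (opN P + (2 : ℂ) • opZ1 P + (2 : ℂ) • opZ2 P) + a ^ 2 • opKp P - c • opKm P + b • opJ P :=
  rfl

/-! ### Commutators of the operators with multiplication by `v k` -/

section VMul

variable (k : VIdx) (P : CUV)

theorem opN_v_mul : opN (v k * P) = v k * opN P + (((|k.1| : ℤ) : ℂ) • v k) * P := by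
  rw [opN, LinearMap.add_apply, LinearMap.add_apply, opN0_eq, vField_v_mul, commV_opN1, mul_add]
  abel

theorem opY1_v_mul : opY1 (v k * P) = v k * opY1 P := by
  rw [opY1, LinearMap.sub_apply, LinearMap.sub_apply, commV_opY1p, commV_opY1m, mul_sub]

theorem opZ2_v_mul : opZ2 (v k * P) = v k * opZ2 P := by
  rw [opZ2, LinearMap.sub_apply, LinearMap.sub_apply, commV_opZ2p, commV_opZ2m, mul_sub]

theorem opY2_v_mul : opY2 (v k * P) = v k * opY2 P +
    (∑ j ∈ Finset.Icc 1 (k.1 - 1), (j : ℂ) • (v j * v (k - j)) -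
      ∑ j ∈ Finset.Icc (k.1 + 1) (-1), (j : ℂ) • (v j * v (k - j))) * P := by
  rw [opY2, LinearMap.sub_apply, LinearMap.sub_apply, opY2p_eq, opY2m_eq, vField_v_mul,
    vField_v_mul, mul_sub, sub_mul]
  abel

theorem opZ1_v_mul : opZ1 (v k * P) = v k * opZ1 P +
    (∑ j ∈ Finset.Icc 1 (k.1 - 1), ((k - j : ℤ) : ℂ) • v (k - 2 * j) -
      ∑ j ∈ Finset.Icc (k.1 + 1) (-1), ((k - j : ℤ) : ℂ) • v (k - 2 * j)) * P := by
  rw [opZ1, LinearMap.sub_apply, LinearMap.sub_apply, opZ1p_eq, opZ1m_eq, vField_v_mul,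
    vField_v_mul, mul_sub, sub_mul]
  abel

theorem vField_smul_apply (c : ℂ) (s : VIdx → CUV) :
    vField (fun j => c • s j) P = c • vField s P := by
  rw [vField, vField, lsum_apply, lsum_apply, smul_finsum' c (locFin_mul_dv _ P)]
  exact finsum_congr fun j => smul_mul_assoc _ _ _

theorem vField_add_apply (s t : VIdx → CUV) :
    vField (fun j => s j + t j) P = vField s P + vField t P := by
  rw [vField, vField, vField, lsum_apply, lsum_apply, lsum_apply,
    ← finsum_add_distrib (locFin_mul_dv _ P) (locFin_mul_dv _ P)]
  exact finsum_congr fun j => add_mul _ _ _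

/-- The coefficient `v (p.2 - p.1)` is not symmetric, so symmetrizing produces both `v (j - k)` and
`v (k - j)`. The two halves are identified only after evaluation, in `smul_traceEval_vField_sub`. -/
theorem opKp_v_mul : opKp (v k * P) = v k * opKp P + (k : ℂ) • shiftDeriv (-k) P +
      (k : ℂ) • (uPow (-k + 1) * du P + vField (fun j => (j : ℂ) • v (k - j)) P) := by
  rw [opKp, LinearMap.add_apply, LinearMap.add_apply, opK2p_eq, vHess_v_mul, opK1p_eq,
    LinearMap.smul_apply, LinearMap.smul_apply, vField_mul_du_v_mul, shiftDeriv,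
    LinearMap.add_apply, Module.End.mul_apply (mulOp _), mulOp_apply, vField_add_apply]
  simp only [mul_comm (Int.cast (Subtype.val _) : ℂ) (k : ℂ), mul_smul, vField_smul_apply,
    sub_eq_add_neg (Subtype.val _) k.1]
  simp only [mul_add, smul_add, smul_mul_assoc, two_smul]
  abel

theorem opKm_v_mul : opKm (v k * P) = v k * opKm P + (2 * k : ℂ) • shiftDeriv k P := by
  rw [opKm, LinearMap.add_apply, LinearMap.add_apply, opK2m_eq, vHess_v_mul, opK1m_eq,
    LinearMap.smul_apply, LinearMap.smul_apply, vField_mul_du_v_mul, shiftDeriv,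
    LinearMap.add_apply, Module.End.mul_apply (mulOp _), mulOp_apply, vField_add_apply]
  simp only [mul_comm (Int.cast (Subtype.val _) : ℂ) (k : ℂ), mul_smul, vField_smul_apply,
    add_comm k.1]
  simp only [mul_add, smul_add, smul_mul_assoc, two_smul]
  abel

theorem opJ_v_mul_aux {R : Type*} [CommRing R] [Algebra ℂ R] (x u y d h f f' p e e' : R) (c : ℂ) :
    (2 : ℂ) • (x * y + (c • (u * x)) * d) + (x * h + (c • (x * f) + c • (x * f))) +
      (x * f' + (c ^ 2 • x) * p) + x * e + x * e' =
    x * ((2 : ℂ) • y + h + f' + e + e') + (2 : ℂ) • (c • (x * (u * d + f))) + (c ^ 2 • x) * p := by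
  simp only [Algebra.smul_def, map_ofNat]
  ring

/-- `opJ` is the expanded square of the Euler derivation `shiftDeriv 0`, for which `v k` has
eigenvalue `k`; this is the Leibniz rule for that square. -/
theorem opJ_v_mul : opJ (v k * P) =
    v k * opJ P + (2 * k : ℂ) • (v k * shiftDeriv 0 P) + ((k : ℂ) ^ 2 • v k) * P := by
  have h1 : vField (fun j => (j : ℂ) • (v k * v j)) P =
      v k * vField (fun j => (j : ℂ) • v j) P := by
    rw [vField, vField, mul_finsum_locFin, lsum_apply]
    refine finsum_congr fun j => ?_
    simp only [Module.End.mul_apply, mulOp_apply, smul_mul_assoc, mul_smul_comm, mul_assoc]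
  rw [opJ_eq]
  simp only [LinearMap.add_apply, LinearMap.smul_apply]
  rw [vField_mul_du_v_mul, vHess_v_mul, vField_v_mul, commV_mulOp_mul_du,
    commV_mulOp_mul_du_mul_du, shiftDeriv, LinearMap.add_apply, Module.End.mul_apply (mulOp _) du,
    mulOp_apply, vField_add_apply]
  simp only [mul_comm (Int.cast (Subtype.val _) : ℂ) (k : ℂ), mul_smul, vField_smul_apply,
    add_zero, zero_add, mul_comm (v (Subtype.val _)) (v k), h1]
  exact opJ_v_mul_aux ..

end VMul

namespace MatrixGroup

variable {G : MatrixGroup}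

/-- The contraction identities for a family of elements of the Lie algebra, restricted to the
powers of the elements of the group. -/
structure CasimirRel {d : ℕ} (X : Fin d → G.lie) (a b c : ℂ) : Prop where
  sandwich : ∀ (A : G.grp) (k : ℤ),
    ∑ i, (X i : Matrix G.n G.n ℂ) * (A : Matrix G.n G.n ℂ) ^ k * (X i : Matrix G.n G.n ℂ) =
      (-ntr A k) • (1 : Matrix G.n G.n ℂ) + a • (A : Matrix G.n G.n ℂ) ^ (-k) +
        b • (A : Matrix G.n G.n ℂ) ^ k
  contract : ∀ (A : G.grp) (k : ℤ),
    ∑ i, (((X i : Matrix G.n G.n ℂ) * (A : Matrix G.n G.n ℂ) ^ k).trace /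
        (Fintype.card G.n : ℂ)) • (X i : Matrix G.n G.n ℂ) =
      a ^ 2 • (A : Matrix G.n G.n ℂ) ^ (-k) - c • (A : Matrix G.n G.n ℂ) ^ k +
        (b * ntr A k) • (1 : Matrix G.n G.n ℂ)
  symm : ∀ (A : G.grp) (k : ℤ), a * ntr A (-k) = a * ntr A k

/-- The scalar `r` will be the parameter `a`: the symmetry `tr(A^(-k)) = tr(A^k)` is available only
after multiplication by `a`, which is zero for the unitary family. -/
theorem traceEval_vField_congr {A : G.grp} (hA : IsUnit (A : Matrix G.n G.n ℂ).det) {r : ℂ}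
    {s s' : VIdx → CUV} (h : ∀ j, r • traceEval A (s j) = r • traceEval A (s' j)) (P : CUV) :
    r • traceEval A (vField s P) = r • traceEval A (vField s' P) := by
  have hs : ∀ s : VIdx → CUV, r • traceEval A (vField s P) =
      ∑ᶠ j, (r • traceEval A (s j)) * traceEval A (dv j P) := fun s => by
    have h1 : (vField s P : CUV) = ∑ᶠ j, s j * dv j P := rfl
    have h2 : (Function.support fun j => s j * dv j P).Finite :=
      locFin_mul_dv (fun k => mulOp (s k)) P
    have h3 : (Function.support fun j => traceEval A (s j * dv j P)).Finite :=
      h2.subset fun j hj h0 => hj (by simp only [h0, map_zero])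
    rw [h1, map_finsum _ h2, smul_finsum' r h3]
    refine finsum_congr fun j => ?_
    rw [traceEval_mul hA, smul_mul_assoc]
  rw [hs, hs]
  exact finsum_congr fun j => by rw [h j]

theorem traceEval_mul_of_scalar {A : G.grp} (hA : IsUnit (A : Matrix G.n G.n ℂ).det) {x : ℂ}
    {Q : CUV} (hQ : traceEval A Q = x • 1) (P : CUV) :
    traceEval A (Q * P) = x • traceEval A P := by
  rw [traceEval_mul hA, hQ, smul_mul_assoc, one_mul]

variable {d : ℕ} {X : Fin d → G.lie} {a b c : ℂ}

/-- `P` has first and second derivatives along the `X_i`, with the expected sum of the second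
derivatives and the expected pairing of the first derivatives with those of the traces. -/
def LaplacianFormula (X : Fin d → G.lie) (a b c : ℂ) (P : CUV) : Prop :=
  ∃ g h : Fin d → G.Fn, (∀ i, HasLeftDeriv (X i) (G.traceFn P) (g i)) ∧
    (∀ i, HasLeftDeriv (X i) (g i) (h i)) ∧
    (∀ A, ∑ i, h i A = traceEval A (casimirOp a b c P)) ∧
    ∀ (A : G.grp) (l : ℤ), ∑ i, (((X i : Matrix G.n G.n ℂ) * (A : Matrix G.n G.n ℂ) ^ l).trace /
        (Fintype.card G.n : ℂ)) • g i A =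
      a ^ 2 • traceEval A (shiftDeriv (-l) P) - c • traceEval A (shiftDeriv l P) +
        (b * ntr A l) • traceEval A (shiftDeriv 0 P)

theorem LaplacianFormula.add {P Q : CUV} (hP : LaplacianFormula X a b c P)
    (hQ : LaplacianFormula X a b c Q) : LaplacianFormula X a b c (P + Q) := by
  obtain ⟨g, h, h1, h2, h3, h4⟩ := hP
  obtain ⟨g', h', h1', h2', h3', h4'⟩ := hQ
  refine ⟨fun i A => g i A + g' i A, fun i A => h i A + h' i A, fun i => ?_,
    fun i => (h2 i).add (h2' i), fun A => ?_, fun A l => ?_⟩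
  · have := (h1 i).add (h1' i)
    rwa [show G.traceFn (P + Q) = fun A => G.traceFn P A + G.traceFn Q A from
      funext fun A => traceFn_add P Q A]
  · rw [Finset.sum_add_distrib, h3, h3', map_add, map_add]
  · simp only [smul_add, Finset.sum_add_distrib, h4, h4', map_add]
    abel

theorem LaplacianFormula.smul {P : CUV} (z : ℂ) (hP : LaplacianFormula X a b c P) :
    LaplacianFormula X a b c (z • P) := by
  obtain ⟨g, h, h1, h2, h3, h4⟩ := hP
  have hz : ∀ i (f f' : G.Fn), HasLeftDeriv (X i) f f' →
      HasLeftDeriv (X i) (fun A => z • f A) (fun A => z • f' A) := fun i f f' hf => by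
    have := hf.const_mul (z • 1)
    simpa only [smul_mul_assoc, one_mul] using this
  refine ⟨fun i A => z • g i A, fun i A => z • h i A, fun i => ?_,
    fun i => hz i _ _ (h2 i), fun A => ?_, fun A l => ?_⟩
  · have := hz i _ _ (h1 i)
    rwa [show G.traceFn (z • P) = fun A => z • G.traceFn P A from
      funext fun A => (traceEval A).map_smul z P]
  · rw [← Finset.smul_sum, h3, map_smul, map_smul]
  · simp only [smul_comm _ z, ← Finset.smul_sum, h4, map_smul]
    rw [smul_add, smul_sub]

theorem sum_smul_insert {A : G.grp} (hA : IsUnit (A : Matrix G.n G.n ℂ).det)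
    (h : CasimirRel X a b c) (l m j : ℤ) :
    ∑ i, (((X i : Matrix G.n G.n ℂ) * (A : Matrix G.n G.n ℂ) ^ l).trace /
        (Fintype.card G.n : ℂ)) • ((A : Matrix G.n G.n ℂ) ^ j * (X i : Matrix G.n G.n ℂ) *
          (A : Matrix G.n G.n ℂ) ^ (m - j)) =
      a ^ 2 • (A : Matrix G.n G.n ℂ) ^ (m + -l) - c • (A : Matrix G.n G.n ℂ) ^ (m + l) +
        (b * ntr A l) • (A : Matrix G.n G.n ℂ) ^ (m + 0) := by
  have h1 := congrArg (fun M => (A : Matrix G.n G.n ℂ) ^ j * M * (A : Matrix G.n G.n ℂ) ^ (m - j))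
    (h.contract A l)
  simp only [Finset.mul_sum, Finset.sum_mul, mul_smul_comm, smul_mul_assoc, mul_add, add_mul,
    mul_sub, sub_mul, mul_one, ← Matrix.zpow_add hA] at h1
  rw [h1, show j + -l + (m - j) = m + -l by ring, show j + l + (m - j) = m + l by ring,
    show j + (m - j) = m + 0 by ring]

theorem sum_insert_insert {A : G.grp} (hA : IsUnit (A : Matrix G.n G.n ℂ).det)
    (h : CasimirRel X a b c) (p q r : ℤ) :
    ∑ i, (A : Matrix G.n G.n ℂ) ^ p * (X i : Matrix G.n G.n ℂ) * (A : Matrix G.n G.n ℂ) ^ q *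
        (X i : Matrix G.n G.n ℂ) * (A : Matrix G.n G.n ℂ) ^ r =
      (-ntr A q) • (A : Matrix G.n G.n ℂ) ^ (p + r) + a • (A : Matrix G.n G.n ℂ) ^ (p - q + r) +
        b • (A : Matrix G.n G.n ℂ) ^ (p + q + r) := by
  have h1 := congrArg (fun M => (A : Matrix G.n G.n ℂ) ^ p * M * (A : Matrix G.n G.n ℂ) ^ r)
    (h.sandwich A q)
  simp only [Finset.mul_sum, Finset.sum_mul, mul_smul_comm, smul_mul_assoc, mul_add, add_mul,
    mul_one, ← Matrix.zpow_add hA, ← mul_assoc, ← sub_eq_add_neg] at h1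
  exact h1

theorem trace_orientedSum (f : ℤ → Matrix G.n G.n ℂ) (k : ℤ) :
    (orientedSum f k).trace = orientedSum (fun j => (f j).trace) k :=
  map_orientedSum (Matrix.traceAddMonoidHom G.n ℂ) f k

theorem sum_trace_mul_trace {A : G.grp} (hA : IsUnit (A : Matrix G.n G.n ℂ).det)
    (hX : CasimirRel X a b c) (k l : ℤ) :
    ∑ i, (((X i : Matrix G.n G.n ℂ) * (A : Matrix G.n G.n ℂ) ^ l).trace / (Fintype.card G.n : ℂ)) *
      (((X i : Matrix G.n G.n ℂ) * (A : Matrix G.n G.n ℂ) ^ k).trace / (Fintype.card G.n : ℂ)) =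
      a ^ 2 * ntr A (k + -l) - c * ntr A (k + l) + b * ntr A l * ntr A (k + 0) := by
  have h1 := congrArg (fun M => (M * (A : Matrix G.n G.n ℂ) ^ k).trace / (Fintype.card G.n : ℂ))
    (hX.contract A l)
  simp only [Finset.sum_mul, smul_mul_assoc, add_mul, sub_mul, one_mul, ← Matrix.zpow_add hA,
    Matrix.trace_sum, Matrix.trace_add, Matrix.trace_sub, Matrix.trace_smul, smul_eq_mul,
    Finset.sum_div] at h1
  simp only [mul_div_assoc] at h1 ⊢
  rw [h1, add_comm k (-l), add_comm k l, add_zero]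
  simp only [ntr]
  ring

/-- By cyclicity of the trace all insertions of `Y` into `A^k` contribute equally, whence the factor
`k`. -/
theorem hasLeftDeriv_ntr (hu : ∀ A : G.grp, IsUnit (A : Matrix G.n G.n ℂ).det) (Y : G.lie) (k : ℤ) :
    HasLeftDeriv Y (fun A : G.grp => ntr A k) (fun A =>
      ((k : ℂ) / (Fintype.card G.n : ℂ)) *
        ((Y : Matrix G.n G.n ℂ) * (A : Matrix G.n G.n ℂ) ^ k).trace) := by
  have h1 := (hasLeftDeriv_zpow hu Y k).trace_mul ((Fintype.card G.n : ℂ)⁻¹)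
  convert h1 using 2 with A A
  · rw [ntr, div_eq_inv_mul]
  · rw [trace_orientedSum, show (fun j => ((A : Matrix G.n G.n ℂ) ^ j * (Y : Matrix G.n G.n ℂ) *
      (A : Matrix G.n G.n ℂ) ^ (k - j)).trace) = fun _ =>
        ((Y : Matrix G.n G.n ℂ) * (A : Matrix G.n G.n ℂ) ^ k).trace from funext fun j => by
      rw [mul_assoc, Matrix.trace_mul_comm, mul_assoc, ← Matrix.zpow_add (hu A), sub_add_cancel],
      orientedSum_const, zsmul_eq_mul]
    ring

/-- This is the Laplacian of the normalized trace of `A^k`. Differentiation gives a plain oriented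
sum with factor `k`; the summand is invariant under `r ↦ k - r`, by `symm`, so `lapSum_of_symm`
applies. -/
theorem sum_trace_mul_orientedSum {A : G.grp} (hA : IsUnit (A : Matrix G.n G.n ℂ).det)
    (hX : CasimirRel X a b c) (k : ℤ) :
    ∑ i, ((k : ℂ) / (Fintype.card G.n : ℂ)) * ((X i : Matrix G.n G.n ℂ) *
        orientedSum (fun j => (A : Matrix G.n G.n ℂ) ^ j * (X i : Matrix G.n G.n ℂ) *
          (A : Matrix G.n G.n ℂ) ^ (k - j)) k).trace =
      lapSum (fun r => -(ntr A r * ntr A (k - r)) + a * ntr A (k - 2 * r) + b * ntr A k) k := by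
  rw [lapSum_of_symm, ← Finset.mul_sum]
  · simp only [mul_orientedSum, trace_orientedSum]
    rw [sum_orientedSum, div_eq_mul_inv, mul_assoc, zsmul_eq_mul]
    congr 1
    rw [mul_orientedSum]
    congr 1
    funext j
    have h2 := congrArg (fun M => (M * (A : Matrix G.n G.n ℂ) ^ (k - j)).trace) (hX.sandwich A j)
    simp only [Finset.sum_mul, smul_mul_assoc, add_mul, one_mul, ← Matrix.zpow_add hA,
      Matrix.trace_sum, Matrix.trace_add, Matrix.trace_smul, smul_eq_mul, mul_assoc] at h2
    simp only [mul_assoc]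
    rw [h2, show -j + (k - j) = k - 2 * j by ring, add_sub_cancel]
    simp only [ntr]
    ring
  · intro j
    rw [sub_sub_cancel, show k - 2 * (k - j) = -(k - 2 * j) by ring, hX.symm]
    ring

section Main

variable [Nonempty G.n]

/-- On a pure power of `u` only `opN`, `opY1`, `opZ2` and `opJ` survive. The term `|m| • h 0` of
`lapSum` accounts for `opN` and the interior terms for `opY1` and `opZ2`, while the constant summand
gives the eigenvalue `m²` of `opJ`. -/
theorem traceEval_casimirOp_mono_one {A : G.grp} (hA : IsUnit (A : Matrix G.n G.n ℂ).det)
    (a b c : ℂ) (m : ℤ) :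
    traceEval A (casimirOp a b c (mono m 1)) =
      lapSum (fun r => (-ntr A r) • (A : Matrix G.n G.n ℂ) ^ (m - r) +
        a • (A : Matrix G.n G.n ℂ) ^ (m - 2 * r) + b • (A : Matrix G.n G.n ℂ) ^ m) m := by
  have hN : opN (mono m 1) = ((|m| : ℤ) : ℂ) • mono m 1 := by
    rw [opN, LinearMap.add_apply, opN0_eq, vField_mono_one, zero_add, opN1_mono]
  have hY2 : opY2 (mono m 1) = 0 := by
    rw [opY2, LinearMap.sub_apply, opY2p_eq, opY2m_eq, vField_mono_one, vField_mono_one, sub_zero]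
  have hZ1 : opZ1 (mono m 1) = 0 := by
    rw [opZ1, LinearMap.sub_apply, opZ1p_eq, opZ1m_eq, vField_mono_one, vField_mono_one, sub_zero]
  have hKp : opKp (mono m 1) = 0 := by
    rw [opKp, LinearMap.add_apply, LinearMap.smul_apply, opK1p_eq, opK2p_eq, vField_mul_du_mono_one,
      vHess_mono_one, smul_zero, add_zero]
  have hKm : opKm (mono m 1) = 0 := by
    rw [opKm, LinearMap.add_apply, LinearMap.smul_apply, opK1m_eq, opK2m_eq, vField_mul_du_mono_one,
      vHess_mono_one, smul_zero, add_zero]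
  have hJ : opJ (mono m 1) = ((m : ℂ) ^ 2) • mono m 1 := by
    rw [opJ_eq]
    simp only [LinearMap.add_apply, LinearMap.smul_apply]
    rw [vField_mul_du_mono_one, vHess_mono_one, vField_mono_one, smul_zero, add_zero, add_zero,
      zero_add, Module.End.mul_apply, Module.End.mul_apply, Module.End.mul_apply, du_mono, map_smul,
      du_mono, map_smul, map_smul, map_smul, mulOp_uPow_mono, mulOp_uPow_mono,
      show 2 + (m - 1 - 1) = m by ring, show 1 + (m - 1) = m by ring, smul_smul, ← add_smul]
    congr 1
    push_cast
    ring
  have hY1 : ∀ k : ℤ, traceEval A (mono (m - k) (vPoly k * 1)) =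
      ntr A k • (A : Matrix G.n G.n ℂ) ^ (m - k) := fun k => by
    rw [← v_mul_mono, traceEval_v_mul hA, ← uPow_eq_mono, traceEval_uPow]
  have hu : ∀ k : ℤ, traceEval A (mono k 1) = (A : Matrix G.n G.n ℂ) ^ k := fun k =>
    traceEval_uPow k A
  rw [lapSum_add, lapSum_add, lapSum_const, lapSum_smul]
  simp only [neg_smul]
  rw [show (fun r => -(ntr A r • (A : Matrix G.n G.n ℂ) ^ (m - r))) =
    fun r => (-1 : ℂ) • (ntr A r • (A : Matrix G.n G.n ℂ) ^ (m - r)) by simp, lapSum_smul]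
  rw [casimirOp_apply, hN, hY2, hZ1, hJ, hKp, hKm]
  simp only [opY1, opZ2, LinearMap.sub_apply, opY1p_mono, opY1m_mono, opZ2p_mono, opZ2m_mono,
    map_add, map_sub, map_neg, map_smul, map_zsmul, map_sum, hY1, hu, Int.cast_smul_eq_zsmul, lapSum,
    ntr_zero, smul_zero, sub_zero, add_zero, one_smul, mul_zero]
  rw [← Int.cast_smul_eq_zsmul ℂ m, ← Int.cast_smul_eq_zsmul ℂ m, ← Int.cast_smul_eq_zsmul ℂ 2,
    ← Int.cast_smul_eq_zsmul ℂ 2]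
  push_cast
  module

/-- The second half of the commutator in `opKp_v_mul` agrees with the first after evaluation, since
`v (k - j)` and `v (j - k)` have the same value up to the factor `a`. -/
theorem smul_traceEval_vField_sub {A : G.grp} (hA : IsUnit (A : Matrix G.n G.n ℂ).det) {a : ℂ}
    (h : ∀ k, a * ntr A (-k) = a * ntr A k) (k : VIdx) (P : CUV) :
    a • traceEval A (uPow (-k + 1) * du P + vField (fun j => (j : ℂ) • v (k - j)) P) =
      a • traceEval A (shiftDeriv (-k) P) := by
  have h1 : a • traceEval A (vField (fun j => (j : ℂ) • v (k - j)) P) =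
      a • traceEval A (vField (fun j => (j : ℂ) • v (j + -k.1)) P) := by
    refine traceEval_vField_congr hA (fun j => ?_) P
    rw [map_smul, map_smul, traceEval_v, traceEval_v, smul_comm a, smul_comm a (j : ℂ),
      smul_smul a, smul_smul a, ← sub_eq_add_neg, ← h (j - k), neg_sub]
  rw [shiftDeriv, LinearMap.add_apply, map_add, map_add, smul_add, smul_add,
    Module.End.mul_apply, mulOp_apply, h1]

theorem traceEval_sum_v_mul_v {A : G.grp} (hA : IsUnit (A : Matrix G.n G.n ℂ).det) (k : ℤ)
    (s : Finset ℤ) : traceEval A (∑ j ∈ s, (j : ℂ) • (v j * v (k - j))) =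
      (∑ j ∈ s, j • (ntr A j * ntr A (k - j))) • 1 := by
  rw [map_sum, Finset.sum_smul]
  refine Finset.sum_congr rfl fun j _ => ?_
  rw [map_smul, traceEval_v_mul hA, traceEval_v, zsmul_eq_mul, mul_smul, mul_smul]

theorem traceEval_sum_v (A : G.grp) (k : ℤ) (s : Finset ℤ) :
    traceEval A (∑ j ∈ s, ((k - j : ℤ) : ℂ) • v (k - 2 * j)) =
      (∑ j ∈ s, (k - j) • ntr A (k - 2 * j)) • 1 := by
  rw [map_sum, Finset.sum_smul]
  refine Finset.sum_congr rfl fun j _ => ?_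
  rw [map_smul, traceEval_v, zsmul_eq_mul, mul_smul]

theorem lapSum_trace {A : G.grp} (a b : ℂ) (k : ℤ) :
    lapSum (fun r => -(ntr A r * ntr A (k - r)) + a * ntr A (k - 2 * r) + b * ntr A k) k =
      -((|k| : ℤ) * ntr A k + 2 * (∑ j ∈ Finset.Icc 1 (k - 1), j • (ntr A j * ntr A (k - j)) -
        ∑ j ∈ Finset.Icc (k + 1) (-1), j • (ntr A j * ntr A (k - j)))) +
      a * ((|k| : ℤ) * ntr A k + 2 * (∑ j ∈ Finset.Icc 1 (k - 1), (k - j) • ntr A (k - 2 * j) -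
        ∑ j ∈ Finset.Icc (k + 1) (-1), (k - j) • ntr A (k - 2 * j))) +
      (k : ℂ) ^ 2 * (b * ntr A k) := by
  have hs : ∀ j, ntr A (k - j) * ntr A (k - (k - j)) = ntr A j * ntr A (k - j) := fun j => by
    rw [sub_sub_cancel, mul_comm]
  have h1 : lapSum (fun r => -(ntr A r * ntr A (k - r))) k =
      -lapSum (fun r => ntr A r * ntr A (k - r)) k :=
    (map_lapSum (negAddMonoidHom : ℂ →+ ℂ) _ k).symm
  have h2 : lapSum (fun r => a * ntr A (k - 2 * r)) k = a * lapSum (fun r => ntr A (k - 2 * r)) k :=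
    lapSum_smul a (fun r => ntr A (k - 2 * r)) k
  rw [lapSum_add, lapSum_add, lapSum_const, h1, h2, lapSum, lapSum,
    sum_Icc_zsmul_of_symm (h := fun r => ntr A r * ntr A (k - r)) hs,
    sum_Icc_neg_zsmul_of_symm (h := fun r => ntr A r * ntr A (k - r)) hs, mul_zero, sub_zero,
    ntr_zero, one_mul]
  simp only [zsmul_eq_mul]
  push_cast
  ring

/-- The operator side of the product rule: the first order commutators of `opKp`, `opKm` and `opJ`
form the cross term, and those with multiplication operators as commutators form the Laplacian of
the trace. -/
theorem traceEval_casimirOp_v_mul {a b c : ℂ} {A : G.grp}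
    (hA : IsUnit (A : Matrix G.n G.n ℂ).det) (h : ∀ k, a * ntr A (-k) = a * ntr A k)
    (k : VIdx) (P : CUV) :
    traceEval A (casimirOp a b c (v k * P)) = ntr A k • traceEval A (casimirOp a b c P) +
      (2 * k : ℂ) • (a ^ 2 • traceEval A (shiftDeriv (-k) P) - c • traceEval A (shiftDeriv k P) +
        (b * ntr A k) • traceEval A (shiftDeriv 0 P)) +
      lapSum (fun r => -(ntr A r * ntr A (k - r)) + a * ntr A (k - 2 * r) + b * ntr A k) k.1 •
        traceEval A P := by
  -- A second factor `a` is supplied because `opKp` enters `casimirOp` with coefficient `a ^ 2`.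
  have hK := congrArg (a • ·) (smul_traceEval_vField_sub hA h k P)
  simp only [smul_smul, ← pow_two] at hK
  rw [lapSum_trace, casimirOp_apply, casimirOp_apply, opN_v_mul, opY1_v_mul, opY2_v_mul, opZ1_v_mul,
    opZ2_v_mul, opKp_v_mul, opKm_v_mul, opJ_v_mul, sub_mul, sub_mul]
  simp only [map_add (traceEval A), map_sub (traceEval A),
    map_neg (traceEval A), map_smul (traceEval A), traceEval_v_mul hA,
    traceEval_mul_of_scalar hA (traceEval_sum_v_mul_v hA _ _),
    traceEval_mul_of_scalar hA (traceEval_sum_v A _ _), smul_mul_assoc] at hK ⊢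
  generalize ∑ j ∈ Finset.Icc 1 (k.1 - 1), j • (ntr A j * ntr A (k - j)) = s₁
  generalize ∑ j ∈ Finset.Icc (k.1 + 1) (-1), j • (ntr A j * ntr A (k - j)) = s₂
  generalize ∑ j ∈ Finset.Icc 1 (k.1 - 1), (k.1 - j) • ntr A (k - 2 * j) = s₃
  generalize ∑ j ∈ Finset.Icc (k.1 + 1) (-1), (k.1 - j) • ntr A (k - 2 * j) = s₄
  linear_combination (norm := module) (k : ℂ) • hK

theorem laplacianFormula_mono_one (hu : ∀ A : G.grp, IsUnit (A : Matrix G.n G.n ℂ).det)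
    (hX : CasimirRel X a b c) (m : ℤ) : LaplacianFormula X a b c (mono m 1) := by
  have hd := fun i m => hasLeftDeriv_zpow hu (X i) m
  -- The second derivative comes from the product rule on each `A^j X A^(m-j)`, either to the left
  -- or to the right of the inserted `X`.
  refine ⟨_, _, fun i => ?_, fun i => HasLeftDeriv.orientedSum (fun j =>
    ((hd i j).mul_const (X i : Matrix G.n G.n ℂ)).mul (hd i (m - j))) m, fun A => ?_, fun A l => ?_⟩
  · rw [show G.traceFn (mono m 1) = fun A : G.grp => (A : Matrix G.n G.n ℂ) ^ m from
      funext fun A => traceEval_uPow m A]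
    exact hd i m
  · rw [traceEval_casimirOp_mono_one (hu A), lapSum_eq_orientedSum, sum_orientedSum]
    congr 1
    funext j
    rw [Finset.sum_add_distrib]
    congr 1
    -- Second insertion on the left: the sandwiched power is `A^(j-l)`.
    · simp only [orientedSum_mul]
      rw [sum_orientedSum]
      congr 1
      funext l
      rw [sum_insert_insert (hu A) hX, show l + (m - j) = m - (j - l) by ring,
        show l - (j - l) + (m - j) = m - 2 * (j - l) by ring, show l + (j - l) + (m - j) = m by ring]
    -- Second insertion on the right: the sandwiched power is `A^l`.
    · simp only [mul_orientedSum]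
      rw [sum_orientedSum]
      congr 1
      funext l
      simp only [← mul_assoc]
      rw [sum_insert_insert (hu A) hX, show j + (m - j - l) = m - l by ring,
        show j - l + (m - j - l) = m - 2 * l by ring, show j + l + (m - j - l) = m by ring]
  · simp only [smul_orientedSum]
    rw [sum_orientedSum]
    simp only [sum_smul_insert (hu A) hX]
    -- After contraction the position of the insertion no longer matters, so the sum over `j` is the
    -- factor `m` of `shiftDeriv`.
    rw [orientedSum_const]
    simp only [shiftDeriv_mono_one, map_smul]
    simp only [← uPow_eq_mono, traceEval_uPow]
    rw [← Int.cast_smul_eq_zsmul ℂ]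
    module

/-- The cross term of the product rule is the pairing clause of the hypothesis at `l = k`, taken
twice. The pairing clause is itself reproduced because `shiftDeriv` is a derivation and
`sum_trace_mul_trace` gives the pairing of two traces. -/
theorem LaplacianFormula.v_mul (hu : ∀ A : G.grp, IsUnit (A : Matrix G.n G.n ℂ).det)
    (hX : CasimirRel X a b c) (k : VIdx) {P : CUV} (hP : LaplacianFormula X a b c P) :
    LaplacianFormula X a b c (v k * P) := by
  obtain ⟨g, h, h1, h2, h3, h4⟩ := hP
  have hτ := fun i => hasLeftDeriv_ntr hu (X i) k
  have hτ' := fun i => (((hasLeftDeriv_zpow hu (X i) k).const_mul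
    (X i : Matrix G.n G.n ℂ)).trace_mul ((k : ℂ) / (Fintype.card G.n : ℂ)))
  refine ⟨_, _, fun i => ?_, fun i => ((hτ' i).smul (h1 i)).add ((hτ i).smul (h2 i)), fun A => ?_,
    fun A l => ?_⟩
  · rw [show G.traceFn (v k * P) = fun A => ntr A k • G.traceFn P A from
      funext fun A => traceEval_v_mul (hu A) k P]
    exact (hτ i).smul (h1 i)
  · have h5 : ∑ i, (((k : ℂ) / (Fintype.card G.n : ℂ)) *
        ((X i : Matrix G.n G.n ℂ) * (A : Matrix G.n G.n ℂ) ^ (k : ℤ)).trace) • g i A =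
        (k : ℂ) • (a ^ 2 • traceEval A (shiftDeriv (-k) P) - c • traceEval A (shiftDeriv k P) +
        (b * ntr A k) • traceEval A (shiftDeriv 0 P)) := by
      rw [← h4, Finset.smul_sum]
      refine Finset.sum_congr rfl fun i _ => ?_
      rw [smul_smul]
      congr 1
      ring
    rw [traceEval_casimirOp_v_mul (hu A) (hX.symm A), Finset.sum_add_distrib,
      Finset.sum_add_distrib, Finset.sum_add_distrib, ← Finset.sum_smul, h5, ← Finset.smul_sum, h3,
      sum_trace_mul_orientedSum (hu A) hX, traceFn_eq_traceEval]
    module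
  · simp only [smul_add, Finset.sum_add_distrib, smul_smul, ← Finset.sum_smul]
    have h6 : ∀ i, (((X i : Matrix G.n G.n ℂ) * (A : Matrix G.n G.n ℂ) ^ l).trace /
        (Fintype.card G.n : ℂ) * ntr A k) • g i A = ntr A k •
          (((X i : Matrix G.n G.n ℂ) * (A : Matrix G.n G.n ℂ) ^ l).trace /
            (Fintype.card G.n : ℂ)) • g i A := fun i => by rw [smul_smul, mul_comm]
    have h5 : ∑ i, ((X i : Matrix G.n G.n ℂ) * (A : Matrix G.n G.n ℂ) ^ l).trace /
        (Fintype.card G.n : ℂ) * ((k : ℂ) / (Fintype.card G.n : ℂ) *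
          ((X i : Matrix G.n G.n ℂ) * (A : Matrix G.n G.n ℂ) ^ (k : ℤ)).trace) =
        (k : ℂ) * (a ^ 2 * ntr A (k + -l) - c * ntr A (k + l) + b * ntr A l * ntr A (k + 0)) := by
      rw [← sum_trace_mul_trace (hu A) hX, Finset.mul_sum]
      refine Finset.sum_congr rfl fun i _ => ?_
      ring
    simp only [h6, h5, ← Finset.smul_sum, h4, shiftDeriv_v_mul, map_add, traceEval_v_mul (hu A),
      smul_mul_assoc, map_smul, traceFn_eq_traceEval]
    module

theorem laplacianFormula (hu : ∀ A : G.grp, IsUnit (A : Matrix G.n G.n ℂ).det)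
    (hX : CasimirRel X a b c) (P : CUV) : LaplacianFormula X a b c P := by
  induction P using mono_induction with
  | hadd P Q hP hQ => exact hP.add hQ
  | hmono m q =>
    induction q using MvPolynomial.induction_on with
    | C z =>
      rw [MvPolynomial.C_eq_smul_one, map_smul]
      exact (laplacianFormula_mono_one hu hX m).smul z
    | add p q hp hq =>
      rw [map_add]
      exact hp.add hq
    | mul_X p k hp =>
      have := hp.v_mul hu hX k
      rwa [v_of_ne k.2, mono_mul_mono, zero_add, mul_comm] at this

theorem laplacian_traceFn {X : Module.Basis (Fin d) ℝ G.lie}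
    (hu : ∀ A : G.grp, IsUnit (A : Matrix G.n G.n ℂ).det) (hX : CasimirRel X a b c) (P : CUV) :
    G.laplacian X (G.traceFn P) = G.traceFn (casimirOp a b c P) := by
  obtain ⟨g, h, h1, h2, h3, -⟩ := laplacianFormula hu hX P
  funext A
  rw [traceFn_eq_traceEval, ← h3, laplacian, Finset.sum_apply]
  exact Finset.sum_congr rfl fun i _ => by rw [(h1 i).leftDeriv_eq, (h2 i).leftDeriv_eq]

end Main

end MatrixGroup

/-! ## The contraction identities for the three families of groups -/

namespace MatrixGroup

variable {G : MatrixGroup} {d : ℕ}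

/-- On skew-Hermitian matrices `Tr(XY) = -Tr(XY*)`, so this is the expansion of `Y` in the
orthonormal basis, up to the factor `-1/scale`. -/
theorem sum_trace_smul_of_mem {b : Module.Basis (Fin d) ℝ G.lie} (hb : G.IsOrthonormal b)
    (hs : G.scale ≠ 0) (hskew : ∀ X ∈ G.lie, Xᴴ = -X) {Y : Matrix G.n G.n ℂ} (hY : Y ∈ G.lie) :
    ∑ i, ((b i : Matrix G.n G.n ℂ) * Y).trace • (b i : Matrix G.n G.n ℂ) =
      (-(G.scale : ℂ)⁻¹) • Y := by
  set r := b.repr ⟨Y, hY⟩ with hr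
  have hYr : Y = ∑ j, (r j : ℂ) • (b j : Matrix G.n G.n ℂ) := by
    have h1 := congrArg (Subtype.val) (b.sum_repr ⟨Y, hY⟩)
    simp only [AddSubmonoidClass.coe_finsetSum, Submodule.coe_smul] at h1
    rw [← h1]
    exact Finset.sum_congr rfl fun j _ => (Complex.coe_smul (r j) _).symm
  have hs' : (G.scale : ℂ) ≠ 0 := Complex.ofReal_ne_zero.2 hs
  have htr : ∀ i j, ((b i : Matrix G.n G.n ℂ) * (b j : Matrix G.n G.n ℂ)).trace =
      -(G.scale : ℂ)⁻¹ * if i = j then 1 else 0 := fun i j => by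
    rw [← hb i j, hskew _ (b j).2, mul_neg, Matrix.trace_neg]
    field_simp
  have h2 : ∀ i, ((b i : Matrix G.n G.n ℂ) * Y).trace = -(G.scale : ℂ)⁻¹ * r i := fun i => by
    rw [hYr, Finset.mul_sum, Matrix.trace_sum, Finset.sum_eq_single i]
    · rw [mul_smul_comm, Matrix.trace_smul, htr, if_pos rfl, smul_eq_mul]
      ring
    · intro j _ hj
      rw [mul_smul_comm, Matrix.trace_smul, htr, if_neg hj.symm, mul_zero, smul_zero]
    · simp
  simp only [h2, mul_smul, ← Finset.smul_sum]
  rw [← hYr]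

/-- The contraction `∑ Tr(X_i B) X_i` is a multiple of the projection of `B` to the complexified Lie
algebra. -/
theorem sum_trace_smul {b : Module.Basis (Fin d) ℝ G.lie} (hb : G.IsOrthonormal b)
    (hs : G.scale ≠ 0) (hskew : ∀ X ∈ G.lie, Xᴴ = -X) {B C : Matrix G.n G.n ℂ}
    (hC : ∃ Y ∈ G.lie, ∃ Z ∈ G.lie, C = Y + Complex.I • Z)
    (hBC : ∀ X ∈ G.lie, (X * (B - C)).trace = 0) :
    ∑ i, ((b i : Matrix G.n G.n ℂ) * B).trace • (b i : Matrix G.n G.n ℂ) =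
      (-(G.scale : ℂ)⁻¹) • C := by
  obtain ⟨Y, hY, Z, hZ, rfl⟩ := hC
  have h1 : ∀ i, ((b i : Matrix G.n G.n ℂ) * B).trace =
      ((b i : Matrix G.n G.n ℂ) * Y).trace + Complex.I * ((b i : Matrix G.n G.n ℂ) * Z).trace := by
    intro i
    have h2 := hBC _ (b i).2
    rw [mul_sub, Matrix.trace_sub, sub_eq_zero] at h2
    rw [h2, mul_add, Matrix.trace_add, mul_smul_comm, Matrix.trace_smul, smul_eq_mul]
  simp only [h1, add_smul, Finset.sum_add_distrib, mul_smul, ← Finset.smul_sum]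
  rw [sum_trace_smul_of_mem hb hs hskew hY, sum_trace_smul_of_mem hb hs hskew hZ, smul_add,
    smul_comm Complex.I]

/-- Contracting with matrix units exposes the tensor `∑ X_i ⊗ X_i`; thus the sandwich identity
follows from a formula for the trace contraction. -/
theorem sum_mul_mul_apply (X : Fin d → Matrix G.n G.n ℂ) (A : Matrix G.n G.n ℂ) (p q : G.n) :
    (∑ i, X i * A * X i) p q = ∑ r, ∑ t, A r t *
      (∑ i, (X i * Matrix.single r p (1 : ℂ)).trace • X i) t q := by
  have h1 : ∀ i r, (X i * Matrix.single r p (1 : ℂ)).trace = X i p r := fun i r => by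
    simp [Matrix.trace_mul_single]
  have h2 : ∀ i, (X i * A * X i) p q = ∑ r, ∑ t, A r t * (X i p r * X i t q) := fun i => by
    simp only [Matrix.mul_apply, Finset.sum_mul]
    rw [Finset.sum_comm]
    exact Finset.sum_congr rfl fun r _ => Finset.sum_congr rfl fun t _ => by ring
  simp only [h1, Matrix.sum_apply, Matrix.smul_apply, smul_eq_mul, h2, Finset.mul_sum]
  rw [Finset.sum_comm]
  exact Finset.sum_congr rfl fun r _ => Finset.sum_comm

theorem sum_mul_single {n : Type} [Fintype n] [DecidableEq n] (B : Matrix n n ℂ) (p q : n) :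
    ∑ r, ∑ t, B r t * Matrix.single r p (1 : ℂ) t q =
      (B.trace • (1 : Matrix n n ℂ)) p q := by
  rw [Matrix.smul_apply, Matrix.one_apply, Matrix.trace, smul_eq_mul, Finset.sum_mul]
  refine Finset.sum_congr rfl fun r _ => ?_
  rw [Finset.sum_eq_single r]
  · simp [Matrix.single_apply]
  · intro t _ ht
    simp [ht.symm]
  · simp

/-- Both summands are skew-Hermitian apart from the factor `I`, so a complex subspace stable under
conjugate transposition is the complexification of its skew-Hermitian part. -/
theorem eq_skew_add_I_smul_skew {n : Type} (C : Matrix n n ℂ) :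
    C = (2⁻¹ : ℂ) • (C - Cᴴ) + Complex.I • ((-Complex.I * 2⁻¹) • (C + Cᴴ)) := by
  rw [smul_smul, ← mul_assoc, mul_neg, Complex.I_mul_I, neg_neg, one_mul]
  module

theorem conjTranspose_smul_sub_conjTranspose {n : Type} (C : Matrix n n ℂ) :
    ((2⁻¹ : ℂ) • (C - Cᴴ))ᴴ = -((2⁻¹ : ℂ) • (C - Cᴴ)) := by
  rw [Matrix.conjTranspose_smul, Matrix.conjTranspose_sub, Matrix.conjTranspose_conjTranspose,
    ← smul_neg, neg_sub]
  simp

theorem conjTranspose_I_smul_add_conjTranspose {n : Type} (C : Matrix n n ℂ) :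
    ((-Complex.I * 2⁻¹) • (C + Cᴴ))ᴴ = -((-Complex.I * 2⁻¹) • (C + Cᴴ)) := by
  rw [Matrix.conjTranspose_smul, Matrix.conjTranspose_add, Matrix.conjTranspose_conjTranspose,
    ← neg_smul, add_comm Cᴴ]
  simp

theorem zpow_preserves_form {n : Type} [Fintype n] [DecidableEq n] {A S : Matrix n n ℂ}
    (hA : IsUnit A.det) (h : Aᵀ * S * A = S) (k : ℤ) : (A ^ k)ᵀ * S * A ^ k = S := by
  have hinv : A⁻¹ᵀ * S * A⁻¹ = S := by
    calc A⁻¹ᵀ * S * A⁻¹ = A⁻¹ᵀ * (Aᵀ * S * A) * A⁻¹ := by rw [h]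
      _ = (A * A⁻¹)ᵀ * S * (A * A⁻¹) := by
        rw [Matrix.transpose_mul]; simp only [Matrix.mul_assoc]
      _ = S := by rw [Matrix.mul_nonsing_inv A hA]; simp
  have hmul : ∀ B C : Matrix n n ℂ, Bᵀ * S * B = S → Cᵀ * S * C = S →
      (B * C)ᵀ * S * (B * C) = S := fun B C hB hC => by
    calc (B * C)ᵀ * S * (B * C) = Cᵀ * (Bᵀ * S * B) * C := by
          simp only [Matrix.transpose_mul, Matrix.mul_assoc]
      _ = S := by rw [hB, hC]
  induction k using Int.induction_on with
  | zero => simp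
  | succ k ih => rw [Matrix.zpow_add_one hA]; exact hmul _ _ ih h
  | pred k ih => rw [Matrix.zpow_sub_one hA]; exact hmul _ _ ih hinv

/-- The contraction identities for the isometry group of a bilinear form `S` with `Sᵀ = ε S`. -/
theorem casimirRel_of_form [Nonempty G.n] {b : Module.Basis (Fin d) ℝ G.lie}
    (hb : G.IsOrthonormal b) (hs : G.scale = (Fintype.card G.n : ℝ) / 2)
    (hu : ∀ A : G.grp, IsUnit (A : Matrix G.n G.n ℂ).det)
    (hskew : ∀ X ∈ G.lie, Xᴴ = -X) {S T : Matrix G.n G.n ℂ} {ε : ℂ} (hε : ε * ε = 1)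
    (hST : T * S = 1) (hS : Sᵀ = ε • S) (hT : Tᵀ = ε • T)
    (hG : ∀ A : G.grp, (A : Matrix G.n G.n ℂ)ᵀ * S * (A : Matrix G.n G.n ℂ) = S)
    (hlie : ∀ X ∈ G.lie, T * Xᵀ * S = -X)
    (hspan : ∀ C, T * Cᵀ * S = -C → ∃ Y ∈ G.lie, ∃ Z ∈ G.lie, C = Y + Complex.I • Z) :
    CasimirRel b (ε / (Fintype.card G.n : ℂ)) 0 ((ε / (Fintype.card G.n : ℂ)) ^ 2) := by
  have hn : (Fintype.card G.n : ℂ) ≠ 0 := Nat.cast_ne_zero.2 Fintype.card_ne_zero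
  have hsc : (G.scale : ℂ) = (Fintype.card G.n : ℂ) / 2 := by rw [hs]; push_cast; rfl
  have hs0 : G.scale ≠ 0 := by
    rw [hs]
    exact div_ne_zero (Nat.cast_ne_zero.2 Fintype.card_ne_zero) two_ne_zero
  -- The adjoint for the form, `B ↦ T Bᵀ S`, is an involution; the signs from `S` and `T` cancel.
  have hinv : ∀ B : Matrix G.n G.n ℂ, T * (T * Bᵀ * S)ᵀ * S = B := fun B => by
    calc T * (T * Bᵀ * S)ᵀ * S = (ε * ε) • ((T * S) * B * (T * S)) := by
          simp only [Matrix.transpose_mul, Matrix.transpose_transpose, hS, hT, Matrix.mul_assoc,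
            Matrix.mul_smul, Matrix.smul_mul, smul_smul]
      _ = B := by rw [hε, hST]; simp
  have hF : ∀ B : Matrix G.n G.n ℂ,
      ∑ i, ((b i : Matrix G.n G.n ℂ) * B).trace • (b i : Matrix G.n G.n ℂ) =
        ((Fintype.card G.n : ℂ)⁻¹) • (T * Bᵀ * S - B) := fun B => by
    -- The complexified Lie algebra is the -1 eigenspace of this involution, so the projection is
    -- half the difference. The remainder is in the +1 eigenspace and is trace-orthogonal to it.
    rw [sum_trace_smul hb hs0 hskew (C := (2⁻¹ : ℂ) • (B - T * Bᵀ * S)), hsc, smul_smul,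
      ← neg_sub B, smul_neg, ← neg_smul]
    · congr 1
      field_simp
    · refine hspan _ ?_
      rw [Matrix.transpose_smul, Matrix.transpose_sub, Matrix.mul_smul, Matrix.smul_mul,
        Matrix.mul_sub, Matrix.sub_mul, hinv, ← smul_neg, neg_sub]
    · intro X hX
      have h1 : (X * (T * Bᵀ * S)).trace = -(X * B).trace := by
        calc (X * (T * Bᵀ * S)).trace = ((X * (T * Bᵀ * S))ᵀ).trace :=
              (Matrix.trace_transpose _).symm
          _ = (ε * ε) • (S * B * T * Xᵀ).trace := by
            simp only [Matrix.transpose_mul, Matrix.transpose_transpose, hS, hT, Matrix.mul_assoc,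
              Matrix.mul_smul, Matrix.smul_mul, smul_smul, Matrix.trace_smul]
          _ = (B * (T * Xᵀ * S)).trace := by
            rw [hε, one_smul, Matrix.mul_assoc, Matrix.mul_assoc, Matrix.trace_mul_comm]
            simp only [Matrix.mul_assoc]
          _ = _ := by rw [hlie X hX, Matrix.mul_neg, Matrix.trace_neg, Matrix.trace_mul_comm]
      have h2 : B - (2⁻¹ : ℂ) • (B - T * Bᵀ * S) = (2⁻¹ : ℂ) • (B + T * Bᵀ * S) := by module
      rw [h2, Matrix.mul_smul, Matrix.trace_smul, Matrix.mul_add, Matrix.trace_add, h1,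
        add_neg_cancel, smul_zero]
  -- Preserving the form means that the adjoint of a group element is its inverse; this turns
  -- transposes into negative powers.
  have hneg : ∀ (A : G.grp) (k : ℤ), (A : Matrix G.n G.n ℂ) ^ (-k) =
      T * ((A : Matrix G.n G.n ℂ) ^ k)ᵀ * S := fun A k => by
    rw [Matrix.zpow_neg (hu A)]
    refine Matrix.inv_eq_left_inv ?_
    rw [Matrix.mul_assoc, Matrix.mul_assoc, ← Matrix.mul_assoc _ᵀ,
      zpow_preserves_form (hu A) (hG A), hST]
  refine ⟨fun A k => ?_, fun A k => ?_, fun A k => ?_⟩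
  · ext p q
    rw [sum_mul_mul_apply]
    simp only [hF, Matrix.transpose_single]
    have h1 : ∀ r t, (T * Matrix.single p r (1 : ℂ) * S) t q = T t p * S r q := fun r t => by
      rw [Matrix.mul_assoc, Matrix.mul_apply, Finset.sum_eq_single p]
      · simp
      · intro j _ hj
        rw [Matrix.single_mul_apply_of_ne _ _ _ _ _ hj, mul_zero]
      · simp
    have h2 : ∑ r, ∑ t, ((A : Matrix G.n G.n ℂ) ^ k) r t * (T t p * S r q) =
        ε * ((A : Matrix G.n G.n ℂ) ^ (-k)) p q := by
      -- The matrix unit contraction produces `Tᵀ` in place of `T`; this is the origin of the sign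
      -- `ε` in the parameter `a`.
      have h3 : ε • (T * ((A : Matrix G.n G.n ℂ) ^ k)ᵀ * S) =
          Tᵀ * ((A : Matrix G.n G.n ℂ) ^ k)ᵀ * S := by
        rw [hT, Matrix.smul_mul, Matrix.smul_mul]
      rw [hneg, ← smul_eq_mul, ← Matrix.smul_apply, h3]
      simp only [Matrix.mul_apply, Matrix.transpose_apply, Finset.sum_mul]
      exact Finset.sum_congr rfl fun r _ => Finset.sum_congr rfl fun t _ => by ring
    have h5 : ∀ r t, ((A : Matrix G.n G.n ℂ) ^ k) r t * ((Fintype.card G.n : ℂ)⁻¹ •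
        (T * Matrix.single p r (1 : ℂ) * S - Matrix.single r p (1 : ℂ))) t q =
        (Fintype.card G.n : ℂ)⁻¹ * (((A : Matrix G.n G.n ℂ) ^ k) r t * (T t p * S r q)) -
        (Fintype.card G.n : ℂ)⁻¹ * (((A : Matrix G.n G.n ℂ) ^ k) r t *
          Matrix.single r p (1 : ℂ) t q) := fun r t => by
      rw [Matrix.smul_apply, Matrix.sub_apply, h1, smul_eq_mul]
      ring
    simp only [h5, Finset.sum_sub_distrib, ← Finset.mul_sum]
    rw [h2, sum_mul_single]
    simp only [ntr, Matrix.add_apply, Matrix.smul_apply, smul_eq_mul]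
    ring
  · simp only [div_eq_inv_mul, mul_smul, ← Finset.smul_sum, hF]
    rw [hneg, zero_smul, add_zero, ← smul_sub, smul_smul]
    congr 1
    rw [mul_pow, pow_two ε, hε]
    ring
  · rw [ntr, ntr, hneg, Matrix.mul_assoc, Matrix.trace_mul_comm, Matrix.mul_assoc,
      mul_eq_one_comm.1 hST, Matrix.mul_one, Matrix.trace_transpose]

/-- The contraction identities for the special unitary group. -/
theorem casimirRel_of_unitary [Nonempty G.n] {b : Module.Basis (Fin d) ℝ G.lie}
    (hb : G.IsOrthonormal b) (hs : G.scale = (Fintype.card G.n : ℝ))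
    (hlie : ∀ X : Matrix G.n G.n ℂ, X ∈ G.lie ↔ Xᴴ = -X ∧ X.trace = 0) :
    CasimirRel b 0 (1 / (Fintype.card G.n : ℂ) ^ 2) (1 / (Fintype.card G.n : ℂ) ^ 2) := by
  have hn : (Fintype.card G.n : ℂ) ≠ 0 := Nat.cast_ne_zero.2 Fintype.card_ne_zero
  have hsc : (G.scale : ℂ) = (Fintype.card G.n : ℂ) := by rw [hs]; push_cast; rfl
  have hs0 : G.scale ≠ 0 := by
    rw [hs]
    exact Nat.cast_ne_zero.2 Fintype.card_ne_zero
  have hF : ∀ B : Matrix G.n G.n ℂ,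
      ∑ i, ((b i : Matrix G.n G.n ℂ) * B).trace • (b i : Matrix G.n G.n ℂ) =
        (-(Fintype.card G.n : ℂ)⁻¹) • (B - (B.trace / (Fintype.card G.n : ℂ)) • 1) := fun B => by
    -- The projection removes the scalar part, to which traceless matrices are orthogonal; this
    -- correction produces the parameter `b = 1/n²`.
    rw [sum_trace_smul hb hs0 (fun X hX => ((hlie X).1 hX).1)
      (C := B - (B.trace / (Fintype.card G.n : ℂ)) • 1), hsc]
    · set C := B - (B.trace / (Fintype.card G.n : ℂ)) • (1 : Matrix G.n G.n ℂ) with hC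
      have hC0 : C.trace = 0 := by
        rw [hC, Matrix.trace_sub, Matrix.trace_smul, Matrix.trace_one, smul_eq_mul,
          div_mul_cancel₀ _ hn, sub_self]
      refine ⟨_, (hlie _).2 ⟨conjTranspose_smul_sub_conjTranspose C, ?_⟩, _,
        (hlie _).2 ⟨conjTranspose_I_smul_add_conjTranspose C, ?_⟩, eq_skew_add_I_smul_skew C⟩
      · rw [Matrix.trace_smul, Matrix.trace_sub, Matrix.trace_conjTranspose, hC0, star_zero,
          sub_zero, smul_zero]
      · rw [Matrix.trace_smul, Matrix.trace_add, Matrix.trace_conjTranspose, hC0, star_zero,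
          add_zero, smul_zero]
    · intro X hX
      rw [sub_sub_cancel, Matrix.mul_smul, Matrix.mul_one, Matrix.trace_smul,
        ((hlie X).1 hX).2, smul_zero]
  refine ⟨fun A k => ?_, fun A k => ?_, fun A k => ?_⟩
  · ext p q
    rw [sum_mul_mul_apply]
    have h1 : ∀ r t, ((A : Matrix G.n G.n ℂ) ^ k) r t * ((-(Fintype.card G.n : ℂ)⁻¹) •
        (Matrix.single r p (1 : ℂ) -
          ((Matrix.single r p (1 : ℂ)).trace / (Fintype.card G.n : ℂ)) • 1)) t q =
        (-(Fintype.card G.n : ℂ)⁻¹) * (((A : Matrix G.n G.n ℂ) ^ k) r t *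
          Matrix.single r p (1 : ℂ) t q) + (1 / (Fintype.card G.n : ℂ) ^ 2) *
        (((A : Matrix G.n G.n ℂ) ^ k) r t * ((Matrix.single r p (1 : ℂ)).trace *
          (1 : Matrix G.n G.n ℂ) t q)) := fun r t => by
      rw [Matrix.smul_apply, Matrix.sub_apply, Matrix.smul_apply, smul_eq_mul, smul_eq_mul]
      field_simp
      ring
    have h2 : ∑ r, ∑ t, ((A : Matrix G.n G.n ℂ) ^ k) r t *
        ((Matrix.single r p (1 : ℂ)).trace * (1 : Matrix G.n G.n ℂ) t q) =
        ((A : Matrix G.n G.n ℂ) ^ k) p q := by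
      rw [Finset.sum_eq_single p, Finset.sum_eq_single q]
      · simp
      · intro t _ ht
        rw [Matrix.one_apply_ne ht, mul_zero, mul_zero]
      · simp
      · intro r _ hr
        simp [Matrix.trace_single_eq_of_ne _ _ _ hr]
      · simp
    simp only [hF, h1, Finset.sum_add_distrib, ← Finset.mul_sum]
    rw [sum_mul_single, h2]
    simp only [ntr, Matrix.add_apply, Matrix.smul_apply, smul_eq_mul]
    ring
  · simp only [div_eq_inv_mul, mul_smul, ← Finset.smul_sum, hF, ntr]
    match_scalars <;> ring
  · simp

end MatrixGroup

/-! ### Verification of the hypotheses for SO, SU and Sp -/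

open MatrixGroup

theorem isUnit_det_realEmb {N : ℕ} {R : Matrix (Fin N) (Fin N) ℝ}
    (hR : R ∈ Matrix.specialOrthogonalGroup (Fin N) ℝ) : IsUnit (realEmb N R).det := by
  rw [realEmb, ← RingHom.map_det, (Matrix.mem_specialOrthogonalGroup_iff.1 hR).2, map_one]
  exact isUnit_one

theorem SOgroup_isUnit_det (N : ℕ) (A : (SOgroup N).grp) :
    IsUnit (A : Matrix (SOgroup N).n (SOgroup N).n ℂ).det := by
  obtain ⟨_, R, hR, rfl⟩ := A
  exact isUnit_det_realEmb hR

theorem SUgroup_isUnit_det (N : ℕ) (A : (SUgroup N).grp) :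
    IsUnit (A : Matrix (SUgroup N).n (SUgroup N).n ℂ).det := by
  have h : (A : Matrix (SUgroup N).n (SUgroup N).n ℂ).det = 1 :=
    (Matrix.mem_specialUnitaryGroup_iff.1 A.2).2
  rw [h]
  exact isUnit_one

theorem Spgroup_isUnit_det (N : ℕ) (A : (Spgroup N).grp) :
    IsUnit (A : Matrix (Spgroup N).n (Spgroup N).n ℂ).det :=
  (Matrix.isUnit_iff_isUnit_det _).1 (IsUnit.of_mul_eq_one_right _ A.2.2)

theorem realEmb_transpose {N : ℕ} (R : Matrix (Fin N) (Fin N) ℝ) :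
    (realEmb N R)ᵀ = realEmb N Rᵀ := by
  ext i j
  simp [realEmb]

theorem realEmb_conjTranspose {N : ℕ} (R : Matrix (Fin N) (Fin N) ℝ) :
    (realEmb N R)ᴴ = realEmb N Rᵀ := by
  ext i j
  simp [realEmb]

theorem transpose_of_mem_soLie {N : ℕ} {X : Matrix (Fin N) (Fin N) ℂ} (hX : X ∈ soLie N) :
    Xᵀ = -X := by
  obtain ⟨Y, hY, rfl⟩ := hX
  rw [realEmb_transpose, hY, map_neg]

theorem conjTranspose_of_mem_soLie {N : ℕ} {X : Matrix (Fin N) (Fin N) ℂ} (hX : X ∈ soLie N) :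
    Xᴴ = -X := by
  obtain ⟨Y, hY, rfl⟩ := hX
  rw [realEmb_conjTranspose, hY, map_neg]

/-- The real and imaginary parts of an antisymmetric matrix are antisymmetric. -/
theorem exists_mem_soLie {N : ℕ} {C : Matrix (Fin N) (Fin N) ℂ} (hC : Cᵀ = -C) :
    ∃ Y ∈ soLie N, ∃ Z ∈ soLie N, C = Y + Complex.I • Z := by
  refine ⟨realEmb N (C.map Complex.re), ⟨_, ?_, rfl⟩, realEmb N (C.map Complex.im),
    ⟨_, ?_, rfl⟩, ?_⟩
  · ext i j
    exact congrArg Complex.re (congrFun (congrFun hC i) j)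
  · ext i j
    exact congrArg Complex.im (congrFun (congrFun hC i) j)
  · ext i j
    change C i j = ((C i j).re : ℂ) + Complex.I * ((C i j).im : ℂ)
    rw [mul_comm, Complex.re_add_im]

theorem realEmb_preserves_form {N : ℕ} {R : Matrix (Fin N) (Fin N) ℝ}
    (hR : R ∈ Matrix.specialOrthogonalGroup (Fin N) ℝ) :
    (realEmb N R)ᵀ * 1 * realEmb N R = 1 := by
  rw [Matrix.mul_one, realEmb_transpose, ← map_mul, (Matrix.mem_orthogonalGroup_iff' (Fin N) ℝ).1
    (Matrix.mem_specialOrthogonalGroup_iff.1 hR).1, map_one]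

theorem casimirRel_SOgroup {N d : ℕ} (hN : 0 < N) {b : Module.Basis (Fin d) ℝ (SOgroup N).lie}
    (hb : (SOgroup N).IsOrthonormal b) : CasimirRel b (1 / (N : ℂ)) 0 ((1 / (N : ℂ)) ^ 2) := by
  have : Nonempty (SOgroup N).n := ⟨(⟨0, hN⟩ : Fin N)⟩
  have hcard : Fintype.card (SOgroup N).n = N := Fintype.card_fin N
  have hmain := casimirRel_of_form (G := SOgroup N) hb (by rw [hcard]; rfl)
    (SOgroup_isUnit_det N) (S := 1) (T := 1) (ε := 1)
    (fun _ hX => conjTranspose_of_mem_soLie hX) (one_mul 1) (one_mul 1) (by simp) (by simp) ?_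
    (fun X hX => ?_) fun C hC => ?_
  · rwa [hcard] at hmain
  · rintro ⟨_, R, hR, rfl⟩
    exact realEmb_preserves_form hR
  · rw [Matrix.one_mul, Matrix.mul_one]
    exact transpose_of_mem_soLie hX
  · rw [Matrix.one_mul, Matrix.mul_one] at hC
    exact exists_mem_soLie hC

theorem casimirRel_SUgroup {N d : ℕ} (hN : 0 < N) {b : Module.Basis (Fin d) ℝ (SUgroup N).lie}
    (hb : (SUgroup N).IsOrthonormal b) :
    CasimirRel b 0 (1 / (N : ℂ) ^ 2) (1 / (N : ℂ) ^ 2) := by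
  have : Nonempty (SUgroup N).n := ⟨(⟨0, hN⟩ : Fin N)⟩
  have hcard : Fintype.card (SUgroup N).n = N := Fintype.card_fin N
  have hmain := casimirRel_of_unitary (G := SUgroup N) hb (by rw [hcard]; rfl) fun X => Iff.rfl
  rwa [hcard] at hmain

theorem Omega_transpose (N : ℕ) : (Omega N)ᵀ = -Omega N := by
  ext ⟨i, a⟩ ⟨j, b⟩
  by_cases h : i = j
  · subst h
    fin_cases a <;> fin_cases b <;> simp [Omega]
  · simp [Omega, h, Ne.symm h]

theorem Omega_conjTranspose (N : ℕ) : (Omega N)ᴴ = -Omega N := by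
  ext ⟨i, a⟩ ⟨j, b⟩
  by_cases h : i = j
  · subst h
    fin_cases a <;> fin_cases b <;> simp [Omega]
  · simp [Omega, h, Ne.symm h]

theorem neg_Omega_mul_transpose_mul_Omega {N : ℕ}
    {C : Matrix (Fin N × Fin 2) (Fin N × Fin 2) ℂ} :
    -Omega N * Cᵀ * Omega N = -C ↔ Omega N * Cᵀ * Omega N = C := by
  rw [Matrix.neg_mul, Matrix.neg_mul, neg_inj]

/-- Since `Omega` is skew-Hermitian, the symplectic condition passes to `Cᴴ`, hence to both summands
of `eq_skew_add_I_smul_skew`. -/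
theorem exists_mem_spLie {N : ℕ} {C : Matrix (Fin N × Fin 2) (Fin N × Fin 2) ℂ}
    (h : Omega N * Cᵀ * Omega N = C) : ∃ Y ∈ spLie N, ∃ Z ∈ spLie N, C = Y + Complex.I • Z := by
  have hH : Omega N * Cᴴᵀ * Omega N = Cᴴ := by
    conv_rhs => rw [← h]
    rw [Matrix.conjTranspose_mul, Matrix.conjTranspose_mul, Omega_conjTranspose]
    simp only [Matrix.mul_assoc, Matrix.mul_neg, Matrix.neg_mul, neg_neg]
    rfl
  refine ⟨_, ⟨?_, conjTranspose_smul_sub_conjTranspose C⟩, _,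
    ⟨?_, conjTranspose_I_smul_add_conjTranspose C⟩, eq_skew_add_I_smul_skew C⟩
  · rw [Matrix.transpose_smul, Matrix.transpose_sub, Matrix.mul_smul, Matrix.smul_mul,
      Matrix.mul_sub, Matrix.sub_mul, h, hH]
  · rw [Matrix.transpose_smul, Matrix.transpose_add, Matrix.mul_smul, Matrix.smul_mul,
      Matrix.mul_add, Matrix.add_mul, h, hH]

theorem neg_Omega_mul_Omega (N : ℕ) : -Omega N * Omega N = 1 := by
  rw [Matrix.neg_mul, Omega_mul_Omega, neg_neg]

/-- The form is `Omega`, with inverse `-Omega` and `ε = -1`. The matrices have size `2N`, so the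
scale `N` is half the size, as for SO. -/
theorem casimirRel_Spgroup {N d : ℕ} (hN : 0 < N) {b : Module.Basis (Fin d) ℝ (Spgroup N).lie}
    (hb : (Spgroup N).IsOrthonormal b) :
    CasimirRel b (-1 / (2 * (N : ℂ))) 0 ((-1 / (2 * (N : ℂ))) ^ 2) := by
  have : Nonempty (Spgroup N).n := ⟨((⟨0, hN⟩, 0) : Fin N × Fin 2)⟩
  have hcard : Fintype.card (Spgroup N).n = N * 2 := by
    change Fintype.card (Fin N × Fin 2) = _
    simp
  have hcard' : ((Fintype.card (Spgroup N).n : ℕ) : ℂ) = 2 * (N : ℂ) := by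
    rw [hcard]
    push_cast
    ring
  have hΩ : (Omega N)ᵀ = (-1 : ℂ) • Omega N := by rw [Omega_transpose, neg_one_smul]
  have hΩ' : (-Omega N)ᵀ = (-1 : ℂ) • -Omega N := by
    rw [Matrix.transpose_neg, Omega_transpose, neg_one_smul]
  have hmain := casimirRel_of_form (G := Spgroup N) hb
    (by rw [hcard]; change (N : ℝ) = _; push_cast; ring)
    (Spgroup_isUnit_det N) (S := Omega N) (T := -Omega N) (ε := -1) (fun X hX => hX.2)
    (by norm_num) (neg_Omega_mul_Omega N) hΩ hΩ' (fun A => A.2.1)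
    (fun X hX => neg_Omega_mul_transpose_mul_Omega.2 hX.1)
    (fun C hC => exists_mem_spLie (neg_Omega_mul_transpose_mul_Omega.1 hC))
  rwa [hcard'] at hmain

/-! ## The three families of groups, and the exponential -/

/-- With `c = a ^ 2` the terms in `opKp` and `opKm` combine to `2 K₁ + K₂`. -/
theorem D_one_eq (N : ℕ) : D .one N = casimirOp (1 / (N : ℂ)) 0 ((1 / (N : ℂ)) ^ 2) := by
  rw [D, L1, L2, casimirOp, opKp, opKm, opK1, opK2]
  module

theorem D_two_eq (N : ℕ) : D .two N = casimirOp 0 (1 / (N : ℂ) ^ 2) (1 / (N : ℂ) ^ 2) := by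
  rw [D, L1, L2, casimirOp, opKp, opKm]
  module

/-- The value `a = -1/(2N)` accounts for the factors `-1/2` in `L1` and `1/4` in `L2`. -/
theorem D_four_eq (N : ℕ) :
    D .four N = casimirOp (-1 / (2 * (N : ℂ))) 0 ((-1 / (2 * (N : ℂ))) ^ 2) := by
  rw [D, L1, L2, casimirOp, opKp, opKm, opK1, opK2]
  module

theorem laplacian_traceFn_K (β : Beta) {N : ℕ} (hN : 0 < N) {d : ℕ}
    {b : Module.Basis (Fin d) ℝ (K β N).lie} (hb : (K β N).IsOrthonormal b) (P : CUV) :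
    (K β N).laplacian b ((K β N).traceFn P) = (K β N).traceFn (D β N P) := by
  cases β with
  | one =>
    have : Nonempty (SOgroup N).n := ⟨(⟨0, hN⟩ : Fin N)⟩
    rw [D_one_eq]
    exact MatrixGroup.laplacian_traceFn (G := SOgroup N) (SOgroup_isUnit_det N)
      (casimirRel_SOgroup hN hb) P
  | two =>
    have : Nonempty (SUgroup N).n := ⟨(⟨0, hN⟩ : Fin N)⟩
    rw [D_two_eq]
    exact MatrixGroup.laplacian_traceFn (G := SUgroup N) (SUgroup_isUnit_det N)
      (casimirRel_SUgroup hN hb) P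
  | four =>
    have : Nonempty (Spgroup N).n := ⟨((⟨0, hN⟩, 0) : Fin N × Fin 2)⟩
    rw [D_four_eq]
    exact MatrixGroup.laplacian_traceFn (G := Spgroup N) (Spgroup_isUnit_det N)
      (casimirRel_Spgroup hN hb) P

theorem iterate_laplacian_traceFn_K (β : Beta) {N : ℕ} (hN : 0 < N) {d : ℕ}
    {b : Module.Basis (Fin d) ℝ (K β N).lie} (hb : (K β N).IsOrthonormal b) (n : ℕ) (P : CUV) :
    ((K β N).laplacian b)^[n] ((K β N).traceFn P) = (K β N).traceFn ((D β N ^ n) P) := by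
  induction n with
  | zero => simp
  | succ n ih =>
    rw [Function.iterate_succ_apply', ih, laplacian_traceFn_K β hN hb, pow_succ',
      Module.End.mul_apply]

end TracePoly
end

theorem theorem1 :
    TracePoly.IsPseudoDiffOp 1 TracePoly.L0 ∧
    (∀ β : TracePoly.Beta, TracePoly.IsPseudoDiffOp 1 (TracePoly.L1 β)) ∧
    (∀ β : TracePoly.Beta, TracePoly.IsDiffOp 2 (TracePoly.L2 β)) ∧
    ∀ (β : TracePoly.Beta) (N : ℕ), 0 < N →
      TracePoly.D β N =
        TracePoly.L0 + (1 / (N : ℂ)) • TracePoly.L1 β + (1 / (N : ℂ) ^ 2) • TracePoly.L2 β ∧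
      (∀ P : TracePoly.CUV,
        (TracePoly.K β N).IsSmooth ((TracePoly.K β N).traceFn P)) ∧
      (∀ (d : ℕ) (b : Module.Basis (Fin d) ℝ (TracePoly.K β N).lie),
        (TracePoly.K β N).IsOrthonormal b →
        ∀ P : TracePoly.CUV,
          (TracePoly.K β N).laplacian b ((TracePoly.K β N).traceFn P) =
            (TracePoly.K β N).traceFn (TracePoly.D β N P)) ∧
      (∀ τ : ℂ, ∃ E : TracePoly.Op, TracePoly.IsExp ((τ / 2) • TracePoly.D β N) E ∧
        ∀ (d : ℕ) (b : Module.Basis (Fin d) ℝ (TracePoly.K β N).lie),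
          (TracePoly.K β N).IsOrthonormal b →
          ∀ (P : TracePoly.CUV) (A : (TracePoly.K β N).grp),
            HasSum
              (fun n : ℕ => ((τ / 2) ^ n / (n.factorial : ℂ)) •
                (((TracePoly.K β N).laplacian b)^[n] ((TracePoly.K β N).traceFn P)) A)
              ((TracePoly.K β N).traceFn (E P) A)) := by
  refine ⟨TracePoly.isPseudoDiffOp_L0, TracePoly.isPseudoDiffOp_L1, TracePoly.isDiffOp_L2,
    fun β N hN => ⟨rfl, fun P => TracePoly.MatrixGroup.isSmooth_traceFn P,
      fun d b hb P => TracePoly.laplacian_traceFn_K β hN hb P, fun τ => ?_⟩⟩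
  obtain ⟨E, hE, hsum⟩ := ((TracePoly.degPres_D β N).smul (τ / 2)).exists_isExp
  -- Convergence of matrices is entrywise, and each entry of the evaluation at `A` is a linear
  -- functional on trace polynomials, to which `hsum` applies.
  refine ⟨E, hE, fun d b hb P A => Pi.hasSum.2 fun i => Pi.hasSum.2 fun j => ?_⟩
  convert hsum (Matrix.entryLinearMap ℂ ℂ i j ∘ₗ TracePoly.MatrixGroup.traceEval A) P using 2 with n
  · rw [TracePoly.iterate_laplacian_traceFn_K β hN hb, smul_pow, LinearMap.smul_apply, map_smul,
      smul_eq_mul, div_eq_inv_mul, ← mul_assoc]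
    rfl
  · rfl
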